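/- **Setting.** Let $r>1$ and let $0<c<1$ be the Rayleigh speed, i.e. $(2-c^2)^2=4q^2$, where $\omega_1=i\sqrt{1-c^2}$, $\omega_2=i\sqrt{1-c^2/r}$ and $q>0$, $q^2=-\omega_1\omega_2$. Put $r_1=(-\omega_1,1)^T$, $r_2=(1,\omega_2)^T$, $r_3=\overline{r_1}$, $r_4=\overline{r_2}$, $\omega_3=\overline{\omega_1}$, $\omega_4=\overline{\omega_2}$, and $$\mathcal B_{Lop}=\begin{pmatrix}2-c^2&2\omega_2\\2\omega_1&c^2-2\end{pmatrix},\qquad \hat r(n,Y)=\omega_2e^{in\omega_1Y}r_1-q\,e^{in\omega_2Y}r_2\ (n>0),\qquad \hat r(n,Y)=\overline{\hat r(-n,Y)}\ (n<0).$$ *Spaces.* Let $0<T\le T_0$ and $\mathbb T=\mathbb R/2\pi\mathbb Z$. $\underline S=H^\infty([0,T]\times\mathbb R_x\times[0,\infty)_y)$. $S^*$ is the set of $u\in H^\infty([0,T]\times\mathbb R_x\times\mathbb T_\theta\times[0,\infty)_Y)$ for which there is $\delta>0$ such that for every multi-index $\alpha$ there is $C_\alpha$ with $\|\partial^\alpha_{t,x,\theta,Y}u(t,\cdot,\theta,Y)\|_{L^2(\mathbb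 R_x)}\le C_\alpha e^{-\delta Y}$. $S=\underline S\oplus S^*$, and $S^m$ is the span of the products of an element of $\underline S$ and one of $S^*$. A function $f\in S\oplus S^m$ is decomposed as $f=\underline f+f^*+f^m$; $f^n$ denotes its Fourier coefficients in $\theta$, $f^0$ its Fourier mean and $f^{osc}=f-f^0$. All profiles $U=(u,v)^T$ are real and vanish in $t\le0$. *Operators.* With $J_a=\begin{pmatrix}0&a\\a&0\end{pmatrix}$ and $P=\begin{pmatrix}0&1\\r-2&0\end{pmatrix}$, let $$L_{ff}=\mathrm{diag}(c^2-r,c^2-1)\partial_{\theta\theta}-J_{r-1}\partial_{\theta Y}-\mathrm{diag}(1,r)\partial_{YY},$$ $$L_{fs}=-2c\,\partial_{t\theta}-\mathrm{diag}(2r,2)\partial_{x\theta}-J_{r-1}(\partial_{xY}+\partial_{y\theta})-\mathrm{diag}(2,2r)\partial_{yY},$$ $$L_{ss}=\partial_{tt}-\mathrm{diag}(r,1)\partial_{xx}-J_{r-1}\partial_{xy}-\mathrm{diag}(1,r)\partial_{yy},$$ $$l_f=P\partial_\theta+\mathrm{diag}(1,r)\partial_Y,\qquad l_s=P\partial_x+\mathrm{diag}(1,r)\partial_y.$$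 Let $Q(N,N)$ and $C(N,N,N)$ be the quadratic and cubic parts of the Saint Venant–Kirchhoff stress $(I+N)\big((r-2)\,\mathrm{tr}(E)I+2E\big)$, $E=\tfrac12(N+N^T+N^TN)$, written as multilinear maps of displacement gradients, with columns $Q_1,Q_2$ and $C_1,C_2$. A subscript $f$ (fast) or $s$ (slow) on an argument means that its gradient is taken in $(\theta,Y)$ or in $(x,y)$, and $\mathrm{div}_f,\mathrm{div}_s$ are the divergences (first column, second column) in $(\theta,Y)$ and $(x,y)$. The profile equations $L_{ff}U_{j+1}=(H_j,K_j)^T$, $l_fU_{j+1}=(h_j,k_j)^T$, obtained by inserting $\sum_{k\ge2}\varepsilon^kU_k(t,x,y,\frac{x-ct}\varepsilon,\frac y\varepsilon)$ into the traction problem with boundary forcing $\varepsilon^2G(t,x,\frac{x-ct}\varepsilon)$, have (with $U_0=U_1=0$) right sides $(H_1,K_1)=(h_1,k_1)=0$ and $$(H_2,K_2)^T=-L_{fs}U_2+\mathrm{div}_fQ(U_{2,f},U_{2,f}),\qquad (h_2,k_2)^T=-l_sU_2-Q_2(U_{2,f},U_{2,f})+G,$$ $$\begin{aligned}(H_3,K_3)^T=&-L_{fs}U_3-L_{ss}U_2+\mathrm{div}_f\big[Q(U_{2,f},U_{2,s})+Q(U_{2,s},U_{2,f})\big]+\mathrm{div}_sQ(U_{2,f},U_{2,f})\\&+\mathrm{div}_f\big[Q(U_{2,f},U_{3,f})+Q(U_{3,f},U_{2,f})+C(U_{2,f},U_{2,f},U_{2,f})\big].\end{aligned}$$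 For $j\le4$ the modified right sides are $(H_j',K_j')=\underline{(H_j,K_j)}+(H_j,K_j)^*$. *Leading profile.* Let $G\in H^\infty([0,T_0]\times\mathbb R_x\times\mathbb T_\theta;\mathbb R^2)$ vanish in $t\le0$ and have zero Fourier mean, $\int_0^{2\pi}G(t,x,\theta)\,d\theta=0$. Suppose that $U_2\in S$ is a leading profile on $[0,T]$ with forcing $G$, that is, for some $U_3\in S$, $$U_2=\underline{U}_2(t,x,y)+U_2^{0*}(t,x,Y)+U_{2,h}+U_{2,p}+U_{2,\alpha},$$ where $\underline U_2\in\underline S$, the other pieces are in $S^*$, $U_2^{0*}$ does not depend on $\theta$, the last three pieces depend on $(t,x,\theta,Y)$ and have zero Fourier mean, and the following equations hold (those with $L_{ff}$ for $y,Y>0$, those with $l_f$ on $y=Y=0$): (a) $L_{ff}U_2^{0*}=(H_1',K_1')^0$; (b) $L_{ff}U_{2,p}=(H'_1,K'_1)^{osc}$, where, for $F=(H,K)$ the right side, the particular solution is the one with coefficients for $n>0$ $$\begin{aligned}&-\int_0^Y\Big(\tfrac{e^{in\omega_1(Y-s)}}{-2i\omega_1c^2n}[\omega_1H^n-K^n]r_1+\tfrac{e^{in\omega_2(Y-s)}}{2i\omega_2c^2n}[H^n+\omega_2K^n]r_2\Big)ds\\&-\int_\infty^Y\Big(\tfrac{e^{in\omega_3(Y-s)}}{2i\omega_1c^2n}[-\omega_1H^n-K^n]r_3+\tfrac{e^{in\omega_4(Y-s)}}{-2i\omega_2c^2n}[H^n-\omega_2K^n]r_4\Big)ds;\end{aligned}$$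 (c) $L_{ff}U_{2,h}=0$, $l_fU_{2,h}=(h_1,k_1)^{osc}-l_fU_{2,p}=:g$, where $U_{2,h}^n=\sigma_1e^{in\omega_1Y}r_1+\sigma_2e^{in\omega_2Y}r_2$ for $n>0$ with $\sigma\perp\ker\mathcal B_{Lop}=\mathrm{span}(\omega_2,-q)^T$ and $in\,\mathcal B_{Lop}\sigma=g^n$; (d) $L_{ff}U_{2,\alpha}=0$, $l_fU_{2,\alpha}=0$, and, for $n>0$, $(q\ \ \omega_2)\big((h_2,k_2)^{osc}-l_fU_{3,p}\big)^n=0$ on $y=Y=0$, where $U_{3,p}\in S^*$ is the particular solution of $L_{ff}U_{3,p}=(H_2',K_2')^{osc}$ given by the formula in (b); (e) $\underline{(H_3',K_3')}=0$, and $\int_0^\infty(H_2',K_2')^0\,dY=(h_2,k_2)^0$ on $y=Y=0$. **Proposition.** For every such leading profile, on $t\in[0,T]$, $x\in\mathbb R$, $\theta\in\mathbb T$, $y,Y\ge0$: $$U_2=U_{2,\alpha}(t,x,\theta,Y)\in S^*,$$ and there are amplitudes $\alpha(t,x,n)$ with $\alpha(t,x,-n)=\overline{\alpha(t,x,n)}$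 such that $U_2^n=\alpha(t,x,n)\,\hat r(n,Y)$ for all $n\neq0$, while $U_2^0=0$. Moreover $U_2^{0*}=U_{2,p}=U_{2,h}=0$, and $\underline U_2$ satisfies $L_{ss}\underline U_2=0$ in $y>0$ and $l_s\underline U_2=0$ on $y=0$, and $\underline U_2=0$. -/

import Mathlib

namespace SVK

open MeasureTheory Filter Topology
open scoped ContDiff Matrix

noncomputable section

/-! ### Profiles and their partial derivatives -/

/-- Scalar real profiles, functions of `(t, x, y, θ, Y)`. A function of fewer variables is a profile
that does not depend on the others. Profiles are smooth functions on all of `ℝ⁵` which represent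
their restriction to `t ∈ [0,T]`, `y, Y ≥ 0`; functions that are smooth up to the boundary of that
set have such representatives, and the values of all their derivatives on the set are
independent of the representative. -/
abbrev Prof : Type := ℝ → ℝ → ℝ → ℝ → ℝ → ℝ

/-- Profiles with two components `U = (u, v) = (U 0, U 1)`. -/
abbrev VProf : Type := Fin 2 → Prof

def dt (f : Prof) : Prof := fun t x y θ Y => deriv (fun s => f s x y θ Y) t
def dx (f : Prof) : Prof := fun t x y θ Y => deriv (fun s => f t s y θ Y) x
def dy (f : Prof) : Prof := fun t x y θ Y => deriv (fun s => f t x s θ Y) y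
def dθ (f : Prof) : Prof := fun t x y θ Y => deriv (fun s => f t x y s Y) θ
def dY (f : Prof) : Prof := fun t x y θ Y => deriv (fun s => f t x y θ s) Y

def SmoothProf (f : Prof) : Prop :=
  ContDiff ℝ ∞ (fun p : ℝ × ℝ × ℝ × ℝ × ℝ => f p.1 p.2.1 p.2.2.1 p.2.2.2.1 p.2.2.2.2)

/-! ### Spaces of profiles -/

/-- `H^∞([0,T] × ℝ_x × [0,∞)_y)`: smooth up to the boundary, all derivatives in `L²`. -/
structure InSbar (T : ℝ) (f : Prof) : Prop where
  smooth : SmoothProf f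
  indep : ∀ t x y θ Y θ' Y', f t x y θ Y = f t x y θ' Y'
  memLp : ∀ a b c : ℕ,
    MemLp (fun p : ℝ × ℝ × ℝ => (dt^[a] (dx^[b] (dy^[c] f))) p.1 p.2.1 p.2.2 0 0) 2
      (volume.restrict (Set.Icc 0 T ×ˢ (Set.univ : Set ℝ) ×ˢ Set.Ici (0 : ℝ)))

/-- `S*`: functions in `H^∞([0,T] × ℝ_x × 𝕋_θ × [0,∞)_Y)`, with `𝕋 = ℝ / 2πℤ`, all of whose derivatives
have an `L²(ℝ_x)` norm that decays like `exp (-δ Y)`, with the same `δ` for all derivatives. -/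
structure InSstar (T : ℝ) (f : Prof) : Prop where
  smooth : SmoothProf f
  indep : ∀ t x y θ Y y', f t x y θ Y = f t x y' θ Y
  periodic : ∀ t x y θ Y, f t x y (θ + 2 * Real.pi) Y = f t x y θ Y
  memLp : ∀ a b c d : ℕ,
    MemLp (fun p : ℝ × ℝ × ℝ × ℝ =>
        (dt^[a] (dx^[b] (dθ^[c] (dY^[d] f)))) p.1 p.2.1 0 p.2.2.1 p.2.2.2) 2
      (volume.restrict
        (Set.Icc 0 T ×ˢ (Set.univ : Set ℝ) ×ˢ Set.Icc (0 : ℝ) (2 * Real.pi) ×ˢ Set.Ici (0 : ℝ)))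
  decay : ∃ δ : ℝ, 0 < δ ∧ ∀ a b c d : ℕ, ∃ C : ℝ, 0 < C ∧
    ∀ t ∈ Set.Icc 0 T, ∀ θ Y : ℝ, 0 ≤ Y →
      eLpNorm (fun x => (dt^[a] (dx^[b] (dθ^[c] (dY^[d] f)))) t x 0 θ Y) 2 volume
        ≤ ENNReal.ofReal (C * Real.exp (-(δ * Y)))

/-- The sum `S` of the two preceding spaces. -/
def InS (T : ℝ) (f : Prof) : Prop :=
  ∃ a b : Prof, InSbar T a ∧ InSstar T b ∧ f = a + b

/-- Boundary functions, `H^∞([0,T] × ℝ_x × 𝕋_θ)`. -/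
structure InSb (T : ℝ) (f : Prof) : Prop where
  smooth : SmoothProf f
  indep : ∀ t x y θ Y y' Y', f t x y θ Y = f t x y' θ Y'
  periodic : ∀ t x y θ Y, f t x y (θ + 2 * Real.pi) Y = f t x y θ Y
  memLp : ∀ a b c : ℕ,
    MemLp (fun p : ℝ × ℝ × ℝ => (dt^[a] (dx^[b] (dθ^[c] f))) p.1 p.2.1 0 p.2.2 0) 2
      (volume.restrict (Set.Icc 0 T ×ˢ (Set.univ : Set ℝ) ×ˢ Set.Icc (0 : ℝ) (2 * Real.pi)))

/-- `f = 0` in `t ≤ 0`. -/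
def VanishesInPast (f : Prof) : Prop :=
  ∀ t x y θ Y, t ≤ 0 → 0 ≤ y → 0 ≤ Y → f t x y θ Y = 0

/-- Equality on the closed domain `t ∈ [0,T]`, `y, Y ≥ 0`. -/
def EqDom (T : ℝ) (f g : Prof) : Prop :=
  ∀ t ∈ Set.Icc 0 T, ∀ x y θ Y, 0 ≤ y → 0 ≤ Y → f t x y θ Y = g t x y θ Y

/-- Equality in the interior, `t ∈ [0,T]`, `y, Y > 0`. -/
def EqInt (T : ℝ) (f g : Prof) : Prop :=
  ∀ t ∈ Set.Icc 0 T, ∀ x y θ Y, 0 < y → 0 < Y → f t x y θ Y = g t x y θ Y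

/-- Equality on the boundary, `t ∈ [0,T]`, `y = Y = 0`. -/
def EqBdy (T : ℝ) (f g : Prof) : Prop :=
  ∀ t ∈ Set.Icc 0 T, ∀ x θ, f t x 0 θ 0 = g t x 0 θ 0

/-! ### Fourier analysis in `θ` -/

/-- The Fourier coefficient `fⁿ(t,x,y,Y)` of `f = ∑ fⁿ e^{inθ}`. -/
def mode (n : ℤ) (f : Prof) (t x y Y : ℝ) : ℂ :=
  (1 / (2 * Real.pi) : ℂ) *
    ∫ θ in (0 : ℝ)..(2 * Real.pi),
      (f t x y θ Y : ℂ) * Complex.exp (-(Complex.I * (n : ℂ) * (θ : ℂ)))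

/-- The Fourier mean `f⁰`. -/
def mean (f : Prof) : Prof :=
  fun t x y _ Y => (1 / (2 * Real.pi)) * ∫ θ in (0 : ℝ)..(2 * Real.pi), f t x y θ Y

/-- The oscillating part `f - f⁰`. -/
def osc (f : Prof) : Prof := f - mean f

/-! ### Linear operators -/

def Lff (r c : ℝ) (U : VProf) : VProf :=
  ![(c ^ 2 - r) • dθ (dθ (U 0)) - (r - 1) • dθ (dY (U 1)) - dY (dY (U 0)),
    (c ^ 2 - 1) • dθ (dθ (U 1)) - (r - 1) • dθ (dY (U 0)) - r • dY (dY (U 1))]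

def Lfs (r c : ℝ) (U : VProf) : VProf :=
  ![-((2 * c) • dt (dθ (U 0))) - (2 * r) • dx (dθ (U 0))
      - (r - 1) • (dx (dY (U 1)) + dy (dθ (U 1))) - (2 : ℝ) • dy (dY (U 0)),
    -((2 * c) • dt (dθ (U 1))) - (2 : ℝ) • dx (dθ (U 1))
      - (r - 1) • (dx (dY (U 0)) + dy (dθ (U 0))) - (2 * r) • dy (dY (U 1))]

def Lss (r : ℝ) (U : VProf) : VProf :=
  ![dt (dt (U 0)) - r • dx (dx (U 0)) - (r - 1) • dx (dy (U 1)) - dy (dy (U 0)),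
    dt (dt (U 1)) - dx (dx (U 1)) - (r - 1) • dx (dy (U 0)) - r • dy (dy (U 1))]

def lf (r : ℝ) (U : VProf) : VProf :=
  ![dθ (U 1) + dY (U 0), (r - 2) • dθ (U 0) + r • dY (U 1)]

def ls (r : ℝ) (U : VProf) : VProf :=
  ![dx (U 1) + dy (U 0), (r - 2) • dx (U 0) + r • dy (U 1)]

/-! ### The Saint Venant-Kirchhoff nonlinearity

In units with `μ = 1`, `λ = r - 2`, and with `E = (N + Nᵀ + NᵀN)/2` for the displacement gradient `N`,
the stress tensor is `(1 + N)((r - 2) tr(E) 1 + 2 E)`. -/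

/-- A bilinear map with `quad r N N` the quadratic part of the stress tensor. (All bilinear maps
with this property give the same sums in the cascade below.) -/
def quad (r : ℝ) (M N : Matrix (Fin 2) (Fin 2) Prof) : Matrix (Fin 2) (Fin 2) Prof :=
  ((r - 2) / 2) • ((Mᵀ * N).trace • (1 : Matrix (Fin 2) (Fin 2) Prof)) + Mᵀ * N
    + (r - 2) • (N.trace • M) + M * (N + Nᵀ)

/-- A trilinear map with `cub r N N N` the cubic part of the stress tensor. -/
def cub (r : ℝ) (M N K : Matrix (Fin 2) (Fin 2) Prof) : Matrix (Fin 2) (Fin 2) Prof :=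
  ((r - 2) / 2) • ((Nᵀ * K).trace • M) + M * (Nᵀ * K)

/-- Fast derivatives `(∂_θ, ∂_Y)` or slow derivatives `(∂_x, ∂_y)`. -/
inductive Scale : Type
  | fast
  | slow

open Scale

/-- First (tangential) derivative of the given scale. -/
def Scale.d₁ : Scale → Prof → Prof
  | fast => dθ
  | slow => dx

/-- Second (normal) derivative of the given scale. -/
def Scale.d₂ : Scale → Prof → Prof
  | fast => dY
  | slow => dy

/-- The gradient matrix; row `i` holds the derivatives of the component `U i`. -/
def grad (s : Scale) (U : VProf) : Matrix (Fin 2) (Fin 2) Prof :=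
  fun i => ![s.d₁ (U i), s.d₂ (U i)]

/-- `d₁` of the first column plus `d₂` of the second column. -/
def divg (s : Scale) (M : Matrix (Fin 2) (Fin 2) Prof) : VProf :=
  fun i => s.d₁ (M i 0) + s.d₂ (M i 1)

def Q (r : ℝ) (a b : Scale) (U V : VProf) : Matrix (Fin 2) (Fin 2) Prof :=
  quad r (grad a U) (grad b V)

def C (r : ℝ) (a b d : Scale) (U V W : VProf) : Matrix (Fin 2) (Fin 2) Prof :=
  cub r (grad a U) (grad b V) (grad d W)

/-- The second column `Q₂`. -/
def Q₂ (r : ℝ) (a b : Scale) (U V : VProf) : VProf := fun i => Q r a b U V i 1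

/-- The second column `C₂`. -/
def C₂ (r : ℝ) (a b d : Scale) (U V W : VProf) : VProf := fun i => C r a b d U V W i 1

def Afff (r : ℝ) (U V : VProf) : VProf := divg fast (Q r fast fast U V)

def Affs (r : ℝ) (U V : VProf) : VProf :=
  divg fast (Q r fast slow U V) + divg fast (Q r slow fast U V) + divg slow (Q r fast fast U V)

def Afss (r : ℝ) (U V : VProf) : VProf :=
  divg fast (Q r slow slow U V) + divg slow (Q r slow fast U V) + divg slow (Q r fast slow U V)

def Asss (r : ℝ) (U V : VProf) : VProf := divg slow (Q r slow slow U V)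

def Bffff (r : ℝ) (U V W : VProf) : VProf := divg fast (C r fast fast fast U V W)

def Bfffs (r : ℝ) (U V W : VProf) : VProf :=
  divg fast (C r fast fast slow U V W) + divg fast (C r fast slow fast U V W)
    + divg fast (C r slow fast fast U V W) + divg slow (C r fast fast fast U V W)

def Bffss (r : ℝ) (U V W : VProf) : VProf :=
  divg fast (C r fast slow slow U V W) + divg fast (C r slow fast slow U V W)
    + divg fast (C r slow slow fast U V W) + divg slow (C r fast fast slow U V W)
    + divg slow (C r fast slow fast U V W) + divg slow (C r slow fast fast U V W)

def Bfsss (r : ℝ) (U V W : VProf) : VProf :=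
  divg fast (C r slow slow slow U V W) + divg slow (C r fast slow slow U V W)
    + divg slow (C r slow fast slow U V W) + divg slow (C r slow slow fast U V W)

def Bssss (r : ℝ) (U V W : VProf) : VProf := divg slow (C r slow slow slow U V W)

/-! ### The cascade of profile equations `L_ff U_{j+1} = (H_j, K_j)`, `l_f U_{j+1} = (h_j, k_j)` -/

/-- `∑_{i + j = m} F(U_i, U_j)`. -/
def sum₂ (U : ℕ → VProf) (m : ℕ) (F : VProf → VProf → VProf) : VProf :=
  ∑ p ∈ Finset.HasAntidiagonal.antidiagonal m, F (U p.1) (U p.2)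

/-- `∑_{l + m + n = N} F(U_l, U_m, U_n)`. -/
def sum₃ (U : ℕ → VProf) (N : ℕ) (F : VProf → VProf → VProf → VProf) : VProf :=
  ∑ p ∈ Finset.HasAntidiagonal.antidiagonal N, ∑ p' ∈ Finset.HasAntidiagonal.antidiagonal p.2, F (U p.1) (U p'.1) (U p'.2)

/-- The interior right side `(H_j, K_j)`, for `j ≥ 1`. -/
def intRHS (r c : ℝ) (U : ℕ → VProf) (j : ℕ) : VProf :=
  -Lfs r c (U j) - Lss r (U (j - 1))
    + sum₂ U (j - 1) (Asss r) + sum₂ U j (Afss r)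
    + sum₂ U (j + 1) (Affs r) + sum₂ U (j + 2) (Afff r)
    + sum₃ U (j - 1) (Bssss r) + sum₃ U j (Bfsss r) + sum₃ U (j + 1) (Bffss r)
    + sum₃ U (j + 2) (Bfffs r) + sum₃ U (j + 3) (Bffff r)

/-- The boundary right side `(h_j, k_j)`, for `j ≥ 1`, with boundary forcing `G = (f, g)`. -/
def bdyRHS (r : ℝ) (G : VProf) (U : ℕ → VProf) (j : ℕ) : VProf :=
  -ls r (U j)
    - sum₂ U (j + 2) (Q₂ r fast fast)
    - sum₂ U (j + 1) (Q₂ r fast slow) - sum₂ U (j + 1) (Q₂ r slow fast)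
    - sum₂ U j (Q₂ r slow slow)
    - sum₃ U (j + 3) (C₂ r fast fast fast)
    - sum₃ U (j + 2) (C₂ r fast fast slow) - sum₃ U (j + 2) (C₂ r fast slow fast)
    - sum₃ U (j + 2) (C₂ r slow fast fast)
    - sum₃ U (j + 1) (C₂ r fast slow slow) - sum₃ U (j + 1) (C₂ r slow fast slow)
    - sum₃ U (j + 1) (C₂ r slow slow fast)
    - sum₃ U j (C₂ r slow slow slow)
    + if j = 2 then G else 0

/-- The component `f̲(t,x,y)` of `f = f̲ + f* + f^m`, with `f*` in `S*` and `f^m` a finite sum of products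
of elements of `S̲` and `S*`: the limit as `Y → ∞` (which is the same for all `θ`). -/
def barPart (f : Prof) : Prof :=
  fun t x y _ _ => limUnder atTop (fun Y => f t x y 0 Y)

/-- The component `f*(t,x,θ,Y)` of `f = f̲ + f* + f^m`: as `f^m → 0` for `y → ∞`, it is the limit of
`f - f̲` as `y → ∞`. -/
def starPart (f : Prof) : Prof :=
  fun t x _ θ Y => limUnder atTop (fun y => f t x y θ Y - barPart f t x y θ Y)

/-- The component in `S̲` of the modified right side `(H'_j, K'_j)`, for `1 ≤ j ≤ 4`. -/
def modBar (r c : ℝ) (U : ℕ → VProf) (j : ℕ) : VProf := fun i => barPart (intRHS r c U j i)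

/-- The modified right side `(H'_j, K'_j)`, for `1 ≤ j ≤ 4`: the sum of the components of `(H_j, K_j)` in
`S̲` and in `S*`. -/
def modRHS (r c : ℝ) (U : ℕ → VProf) (j : ℕ) : VProf :=
  fun i => modBar r c U j i + starPart (intRHS r c U j i)

/-! ### Rayleigh modes -/

def ω₁ (c : ℝ) : ℂ := Complex.I * (Real.sqrt (1 - c ^ 2) : ℂ)
def ω₂ (r c : ℝ) : ℂ := Complex.I * (Real.sqrt (1 - c ^ 2 / r) : ℂ)

/-- `q > 0` with `q² = -ω₁ ω₂`. -/
def q (r c : ℝ) : ℝ := Real.sqrt (Real.sqrt (1 - c ^ 2) * Real.sqrt (1 - c ^ 2 / r))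

/-- `(-c, 1)` is a Rayleigh frequency. -/
def IsRayleighSpeed (r c : ℝ) : Prop :=
  0 < c ∧ c < 1 ∧ (2 - c ^ 2) ^ 2 = 4 * q r c ^ 2

def r₁ (c : ℝ) : Fin 2 → ℂ := ![-ω₁ c, 1]
def r₂ (r c : ℝ) : Fin 2 → ℂ := ![1, ω₂ r c]
def r₃ (c : ℝ) : Fin 2 → ℂ := star (r₁ c)
def r₄ (r c : ℝ) : Fin 2 → ℂ := star (r₂ r c)

/-- The Lopatinski matrix. -/
def BLop (r c : ℝ) : Matrix (Fin 2) (Fin 2) ℂ :=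
  !![2 - (c : ℂ) ^ 2, 2 * ω₂ r c; 2 * ω₁ c, (c : ℂ) ^ 2 - 2]

/-- `e^{inwY}`. -/
def expo (n : ℤ) (w : ℂ) (Y : ℝ) : ℂ := Complex.exp (Complex.I * (n : ℂ) * w * (Y : ℂ))

/-- `r̂(n,Y) = ω₂ e^{inω₁Y} r₁ - q e^{inω₂Y} r₂` for `n > 0`, and `r̂(n,Y)` is the conjugate of `r̂(-n,Y)`
for `n < 0`. -/
def rhat (r c : ℝ) (n : ℤ) (Y : ℝ) : Fin 2 → ℂ :=
  let e : ℤ → Fin 2 → ℂ := fun m =>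
    (ω₂ r c * expo m (ω₁ c) Y) • r₁ c - ((q r c : ℂ) * expo m (ω₂ r c) Y) • r₂ r c
  if 0 < n then e n else star (e (-n))

/-- The `n`-th Fourier coefficient (`n > 0`) of the particular decaying solution of `L_ff U = F`,
obtained by diagonalization. The second integral is `-∫_∞^Y`. -/
def particularMode (r c : ℝ) (F : VProf) (n : ℤ) (t x Y : ℝ) : Fin 2 → ℂ :=
  let H : ℝ → ℂ := mode n (F 0) t x 0
  let K : ℝ → ℂ := mode n (F 1) t x 0
  let w₁ : ℂ := ω₁ c
  let w₂ : ℂ := ω₂ r c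
  let d₁ : ℂ := 2 * Complex.I * w₁ * (c : ℂ) ^ 2 * (n : ℂ)
  let d₂ : ℂ := 2 * Complex.I * w₂ * (c : ℂ) ^ 2 * (n : ℂ)
  fun i =>
    -(∫ s in (0 : ℝ)..Y,
        (expo n w₁ (Y - s) / (-d₁) * (w₁ * H s - K s) * r₁ c i
          + expo n w₂ (Y - s) / d₂ * (H s + w₂ * K s) * r₂ r c i))
    + ∫ s in Set.Ioi Y,
        (expo n (star w₁) (Y - s) / d₁ * (-(w₁ * H s) - K s) * r₃ c i
          + expo n (star w₂) (Y - s) / (-d₂) * (H s - w₂ * K s) * r₄ r c i)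

/-- `V` is the real, purely oscillating, decaying particular solution of `L_ff V = F^osc` given by the
diagonalization formula. (The coefficients with `n < 0` are the conjugates of those with `n > 0`.) -/
structure IsParticular (r c T : ℝ) (F V : VProf) : Prop where
  memS : ∀ i, InSstar T (V i)
  mean_zero : ∀ i, EqDom T (mean (V i)) 0
  eqn : ∀ i, EqInt T (Lff r c V i) (osc (F i))
  formula : ∀ n : ℤ, 0 < n → ∀ t ∈ Set.Icc 0 T, ∀ x Y, 0 ≤ Y → ∀ i,
    mode n (V i) t x 0 Y = particularMode r c F n t x Y i

/-- `V` is the real, purely oscillating, decaying solution of `L_ff V = 0`, `l_f V = g` whose coefficient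
vector `σ(t,x,n)` for `n > 0` is orthogonal to the kernel `span (ω₂, -q)` of the Lopatinski matrix. -/
structure IsHomogeneous (r c T : ℝ) (g V : VProf) : Prop where
  memS : ∀ i, InSstar T (V i)
  mean_zero : ∀ i, EqDom T (mean (V i)) 0
  eqn : ∀ i, EqInt T (Lff r c V i) 0
  bdy : ∀ i, EqBdy T (lf r V i) (g i)
  formula : ∀ n : ℤ, 0 < n → ∀ t ∈ Set.Icc 0 T, ∀ x, ∃ σ : Fin 2 → ℂ,
    star (ω₂ r c) * σ 0 - (q r c : ℂ) * σ 1 = 0 ∧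
    (Complex.I * (n : ℂ)) • (BLop r c *ᵥ σ) = (fun i => mode n (g i) t x 0 0) ∧
    ∀ Y, 0 ≤ Y → ∀ i, mode n (V i) t x 0 Y =
      σ 0 * expo n (ω₁ c) Y * r₁ c i + σ 1 * expo n (ω₂ r c) Y * r₂ r c i

/-- `U 2` is the leading profile with forcing `G`, with pieces
`U 2 = Ubar + U0 + Uh + Up + Uα`; `Up3` is the particular piece of the next profile, and the profiles
`U j`, `j ≥ 3`, are otherwise undetermined elements of `S`. -/
structure IsLeadingProfile (r c T : ℝ) (G : VProf) (U : ℕ → VProf)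
    (Ubar U0 Uh Up Uα Up3 : VProf) : Prop where
  zero : U 0 = 0
  one : U 1 = 0
  memS : ∀ j i, InS T (U j i)
  past : ∀ j i, VanishesInPast (U j i)
  /- the five pieces -/
  split : U 2 = Ubar + U0 + Uh + Up + Uα
  bar_mem : ∀ i, InSbar T (Ubar i)
  star0_mem : ∀ i, InSstar T (U0 i)
  star0_indep : ∀ i t x y θ Y θ', U0 i t x y θ Y = U0 i t x y θ' Y
  alpha_mem : ∀ i, InSstar T (Uα i)
  alpha_mean : ∀ i, EqDom T (mean (Uα i)) 0
  /- equation for `U0` -/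
  star0_eqn : ∀ i, EqInt T (Lff r c U0 i) (mean (modRHS r c U 1 i))
  /- equation for `Up` -/
  particular : IsParticular r c T (modRHS r c U 1) Up
  /- equations for `Uh` -/
  homogeneous : IsHomogeneous r c T (fun i => osc (bdyRHS r G U 1 i) - lf r Up i) Uh
  /- equations for `Uα`, including solvability (for `n > 0`; conjugate for `n < 0`) of the problem for
  the homogeneous piece of the next profile -/
  alpha_eqn : ∀ i, EqInt T (Lff r c Uα i) 0
  alpha_bdy : ∀ i, EqBdy T (lf r Uα i) 0
  particular_next : IsParticular r c T (modRHS r c U 2) Up3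
  solvable : ∀ n : ℤ, 0 < n → ∀ t ∈ Set.Icc 0 T, ∀ x,
    (q r c : ℂ) * mode n (osc (bdyRHS r G U 2 0) - lf r Up3 0) t x 0 0
      + ω₂ r c * mode n (osc (bdyRHS r G U 2 1) - lf r Up3 1) t x 0 0 = 0
  /- equations for `Ubar`: `H̲'_3 = K̲'_3 = 0` and solvability for the mean of the next profile -/
  bar_eqn : ∀ i, EqInt T (modBar r c U 3 i) 0
  bar_bdy : ∀ i, ∀ t ∈ Set.Icc 0 T, ∀ x,
    ∫ Y in Set.Ioi (0 : ℝ), mean (modRHS r c U 2 i) t x 0 0 Y = mean (bdyRHS r G U 2 i) t x 0 0 0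

end

end SVK

namespace SVK

open MeasureTheory Filter Topology
open scoped ContDiff Matrix

/-! ### Calculus of partial derivatives -/

/-! The forced pieces vanish for lack of forcing. Since `U 0 = U 1 = 0`, each term of the right
sides of index one contains a vanishing profile, so `(H₁, K₁) = (h₁, k₁) = 0`. The explicit formula
then gives `Up = 0`. The coefficient vector of `Uh` lies in the kernel of the Lopatinski matrix and
is orthogonal to that kernel, so it is zero. The mean piece `U0` is affine in `Y` and decays, so it
is zero. Of the part in `S*` only `Uα` is left.

Each Fourier mode of `Uα` is found by passing to its fast divergence `d` and rotation `w`, which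
decouple `L_ff U = 0` into `d'' = n²κ₂² d` and `w'' = n²κ₁² w`, where `ω₁ = iκ₁` and `ω₂ = iκ₂`.
Bounded solutions are decaying exponentials, and `u`, `v` are algebraic expressions in `w`, `w'`,
`d`, `d'`. The traction condition ties `w(0)` to `d(0)`, which leaves the multiples of `rhat`
(`exists_amplitude`).

The slow part `Ubar` solves linear elastodynamics in the half plane with no force, no traction and
no initial data. As `Y → ∞` each term of `(H₃, K₃)` with a fast derivative decays, so `modBar` of
index 3 is `-L_ss Ubar` (`IsLeadingProfile.Lss_eq_zero`). The `θ`-mean of `(H₂, K₂)` reduces to that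
of `∂_Y Q₂`, whose integral over `Y` is minus the mean of `Q₂` at `Y = 0`. The same term occurs in
the mean of `(h₂, k₂)`, and `G` has mean zero, so the solvability condition reduces to `l_s Ubar =
0` (`IsLeadingProfile.ls_eq_zero`). At `t = 0` the decay of the part in `S*` separates `Ubar` from
it, so the data of `Ubar` vanish, and an energy estimate gives `Ubar = 0` (`traction_uniqueness`).

The bookkeeping of decay rests on an algebra `IsBdd`, generated by slow profiles and `S*`, and its
ideal `IsDec`, generated by `S*`; both are stable under all partial derivatives, and elements of
`IsDec` decay exponentially in `Y`. -/

/-- A profile as a function on `ℝ⁵`. -/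
def unc (f : Prof) : ℝ × ℝ × ℝ × ℝ × ℝ → ℝ :=
  fun p => f p.1 p.2.1 p.2.2.1 p.2.2.2.1 p.2.2.2.2

lemma smoothProf_iff {f : Prof} : SmoothProf f ↔ ContDiff ℝ ∞ (unc f) := Iff.rfl

/-- The coordinate directions in `ℝ⁵`. -/
def basisVec : Fin 5 → ℝ × ℝ × ℝ × ℝ × ℝ :=
  ![(1, 0, 0, 0, 0), (0, 1, 0, 0, 0), (0, 0, 1, 0, 0), (0, 0, 0, 1, 0), (0, 0, 0, 0, 1)]

/-- The partial derivatives, indexed. -/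
noncomputable def pd : Fin 5 → Prof → Prof := ![dt, dx, dy, dθ, dY]

lemma pd_zero : pd 0 = dt := rfl
lemma pd_one : pd 1 = dx := rfl
lemma pd_two : pd 2 = dy := rfl
lemma pd_three : pd 3 = dθ := rfl
lemma pd_four : pd 4 = dY := rfl

lemma SmoothProf.hasFDerivAt {f : Prof} (hf : SmoothProf f) (p : ℝ × ℝ × ℝ × ℝ × ℝ) :
    HasFDerivAt (unc f) (fderiv ℝ (unc f) p) p :=
  ((smoothProf_iff.1 hf).differentiable (by simp) p).hasFDerivAt

lemma SmoothProf.hasDerivAt_t_aux {f : Prof} (hf : SmoothProf f) (t x y θ Y : ℝ) :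
    HasDerivAt (fun s => f s x y θ Y) (fderiv ℝ (unc f) (t, x, y, θ, Y) (1, 0, 0, 0, 0)) t :=
  (hf.hasFDerivAt (t, x, y, θ, Y)).comp_hasDerivAt (f := fun s : ℝ => (s, x, y, θ, Y)) t
    ((hasDerivAt_id t).prodMk (hasDerivAt_const t (x, y, θ, Y)))

lemma SmoothProf.hasDerivAt_x_aux {f : Prof} (hf : SmoothProf f) (t x y θ Y : ℝ) :
    HasDerivAt (fun s => f t s y θ Y) (fderiv ℝ (unc f) (t, x, y, θ, Y) (0, 1, 0, 0, 0)) x :=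
  (hf.hasFDerivAt (t, x, y, θ, Y)).comp_hasDerivAt (f := fun s : ℝ => (t, s, y, θ, Y)) x
    ((hasDerivAt_const x t).prodMk ((hasDerivAt_id x).prodMk (hasDerivAt_const x (y, θ, Y))))

lemma SmoothProf.hasDerivAt_y_aux {f : Prof} (hf : SmoothProf f) (t x y θ Y : ℝ) :
    HasDerivAt (fun s => f t x s θ Y) (fderiv ℝ (unc f) (t, x, y, θ, Y) (0, 0, 1, 0, 0)) y :=
  (hf.hasFDerivAt (t, x, y, θ, Y)).comp_hasDerivAt (f := fun s : ℝ => (t, x, s, θ, Y)) y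
    ((hasDerivAt_const y t).prodMk ((hasDerivAt_const y x).prodMk
      ((hasDerivAt_id y).prodMk (hasDerivAt_const y (θ, Y)))))

lemma SmoothProf.hasDerivAt_θ_aux {f : Prof} (hf : SmoothProf f) (t x y θ Y : ℝ) :
    HasDerivAt (fun s => f t x y s Y) (fderiv ℝ (unc f) (t, x, y, θ, Y) (0, 0, 0, 1, 0)) θ :=
  (hf.hasFDerivAt (t, x, y, θ, Y)).comp_hasDerivAt (f := fun s : ℝ => (t, x, y, s, Y)) θ
    ((hasDerivAt_const θ t).prodMk ((hasDerivAt_const θ x).prodMk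
      ((hasDerivAt_const θ y).prodMk ((hasDerivAt_id θ).prodMk (hasDerivAt_const θ Y)))))

lemma SmoothProf.hasDerivAt_Y_aux {f : Prof} (hf : SmoothProf f) (t x y θ Y : ℝ) :
    HasDerivAt (fun s => f t x y θ s) (fderiv ℝ (unc f) (t, x, y, θ, Y) (0, 0, 0, 0, 1)) Y :=
  (hf.hasFDerivAt (t, x, y, θ, Y)).comp_hasDerivAt (f := fun s : ℝ => (t, x, y, θ, s)) Y
    ((hasDerivAt_const Y t).prodMk ((hasDerivAt_const Y x).prodMk
      ((hasDerivAt_const Y y).prodMk ((hasDerivAt_const Y θ).prodMk (hasDerivAt_id Y)))))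

/-- The bridge from iterated one-variable derivatives to Fréchet calculus. It allows smoothness,
symmetry, and the sum and product rules to be proved once for all five directions. -/
lemma unc_pd {f : Prof} (hf : SmoothProf f) (i : Fin 5) :
    unc (pd i f) = fun p => fderiv ℝ (unc f) p (basisVec i) := by
  funext ⟨t, x, y, θ, Y⟩
  fin_cases i
  · exact (hf.hasDerivAt_t_aux t x y θ Y).deriv
  · exact (hf.hasDerivAt_x_aux t x y θ Y).deriv
  · exact (hf.hasDerivAt_y_aux t x y θ Y).deriv
  · exact (hf.hasDerivAt_θ_aux t x y θ Y).deriv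
  · exact (hf.hasDerivAt_Y_aux t x y θ Y).deriv

lemma SmoothProf.hasDerivAt_t {f : Prof} (hf : SmoothProf f) (t x y θ Y : ℝ) :
    HasDerivAt (fun s => f s x y θ Y) (dt f t x y θ Y) t :=
  (hf.hasDerivAt_t_aux t x y θ Y).differentiableAt.hasDerivAt

lemma SmoothProf.hasDerivAt_x {f : Prof} (hf : SmoothProf f) (t x y θ Y : ℝ) :
    HasDerivAt (fun s => f t s y θ Y) (dx f t x y θ Y) x :=
  (hf.hasDerivAt_x_aux t x y θ Y).differentiableAt.hasDerivAt

lemma SmoothProf.hasDerivAt_y {f : Prof} (hf : SmoothProf f) (t x y θ Y : ℝ) :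
    HasDerivAt (fun s => f t x s θ Y) (dy f t x y θ Y) y :=
  (hf.hasDerivAt_y_aux t x y θ Y).differentiableAt.hasDerivAt

lemma SmoothProf.hasDerivAt_θ {f : Prof} (hf : SmoothProf f) (t x y θ Y : ℝ) :
    HasDerivAt (fun s => f t x y s Y) (dθ f t x y θ Y) θ :=
  (hf.hasDerivAt_θ_aux t x y θ Y).differentiableAt.hasDerivAt

lemma SmoothProf.hasDerivAt_Y {f : Prof} (hf : SmoothProf f) (t x y θ Y : ℝ) :
    HasDerivAt (fun s => f t x y θ s) (dY f t x y θ Y) Y :=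
  (hf.hasDerivAt_Y_aux t x y θ Y).differentiableAt.hasDerivAt

lemma unc_injective {f g : Prof} (h : unc f = unc g) : f = g := by
  funext t x y θ Y
  exact congrFun h (t, x, y, θ, Y)

lemma SmoothProf.pd {f : Prof} (hf : SmoothProf f) (i : Fin 5) : SmoothProf (pd i f) := by
  rw [smoothProf_iff, unc_pd hf]
  exact ((smoothProf_iff.1 hf).fderiv_right (m := ∞) (by simp)).clm_apply contDiff_const

lemma SmoothProf.dt {f : Prof} (hf : SmoothProf f) : SmoothProf (dt f) := hf.pd 0
lemma SmoothProf.dx {f : Prof} (hf : SmoothProf f) : SmoothProf (dx f) := hf.pd 1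
lemma SmoothProf.dy {f : Prof} (hf : SmoothProf f) : SmoothProf (dy f) := hf.pd 2
lemma SmoothProf.dθ {f : Prof} (hf : SmoothProf f) : SmoothProf (dθ f) := hf.pd 3
lemma SmoothProf.dY {f : Prof} (hf : SmoothProf f) : SmoothProf (dY f) := hf.pd 4

lemma pd_comm {f : Prof} (hf : SmoothProf f) (i j : Fin 5) : pd i (pd j f) = pd j (pd i f) := by
  have hF := smoothProf_iff.1 hf
  have hd : Differentiable ℝ (fderiv ℝ (unc f)) :=
    (hF.fderiv_right (m := ∞) (by simp)).differentiable (by simp)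
  have key : ∀ (i j : Fin 5) (p : ℝ × ℝ × ℝ × ℝ × ℝ),
      unc (pd i (pd j f)) p = fderiv ℝ (fderiv ℝ (unc f)) p (basisVec i) (basisVec j) := by
    intro i j p
    rw [unc_pd (hf.pd j), unc_pd hf]
    have := ((hd p).hasFDerivAt.clm_apply (hasFDerivAt_const (basisVec j) p)).fderiv
    simp [this]
  apply unc_injective
  funext p
  rw [key, key]
  exact (hF.contDiffAt.isSymmSndFDerivAt
    (by simpa using WithTop.coe_le_coe.2 (le_top : (2 : ℕ∞) ≤ ⊤))) _ _

lemma SmoothProf.add {f g : Prof} (hf : SmoothProf f) (hg : SmoothProf g) : SmoothProf (f + g) :=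
  ContDiff.add hf hg

lemma SmoothProf.sub {f g : Prof} (hf : SmoothProf f) (hg : SmoothProf g) : SmoothProf (f - g) :=
  ContDiff.sub hf hg

lemma SmoothProf.neg {f : Prof} (hf : SmoothProf f) : SmoothProf (-f) :=
  ContDiff.neg hf

lemma SmoothProf.mul {f g : Prof} (hf : SmoothProf f) (hg : SmoothProf g) : SmoothProf (f * g) :=
  ContDiff.mul hf hg

lemma SmoothProf.smul {f : Prof} (a : ℝ) (hf : SmoothProf f) : SmoothProf (a • f) :=
  ContDiff.smul (f := fun _ => a) contDiff_const hf

lemma SmoothProf.zero : SmoothProf 0 :=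
  contDiff_const (c := (0 : ℝ))

lemma pd_add {f g : Prof} (hf : SmoothProf f) (hg : SmoothProf g) (i : Fin 5) :
    pd i (f + g) = pd i f + pd i g := by
  apply unc_injective
  funext p
  rw [unc_pd (hf.add hg)]
  have h : unc (pd i f + pd i g) p = unc (pd i f) p + unc (pd i g) p := rfl
  rw [h, unc_pd hf, unc_pd hg]
  have := ((hf.hasFDerivAt p).add (hg.hasFDerivAt p)).fderiv
  have e : unc (f + g) = unc f + unc g := rfl
  beta_reduce
  rw [e, this]; rfl

lemma pd_mul {f g : Prof} (hf : SmoothProf f) (hg : SmoothProf g) (i : Fin 5) :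
    pd i (f * g) = pd i f * g + f * pd i g := by
  apply unc_injective
  funext p
  rw [unc_pd (hf.mul hg)]
  have h : unc (pd i f * g + f * pd i g) p = unc (pd i f) p * unc g p + unc f p * unc (pd i g) p :=
    rfl
  rw [h, unc_pd hf, unc_pd hg]
  have := ((hf.hasFDerivAt p).mul (hg.hasFDerivAt p)).fderiv
  have e : unc (f * g) = unc f * unc g := rfl
  beta_reduce
  rw [e, this]
  simp
  ring

lemma pd_const (a : ℝ) (i : Fin 5) : pd i (fun _ _ _ _ _ => a) = 0 := by
  funext t x y θ Y
  fin_cases i <;> exact deriv_const _ _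

lemma pd_zero_fun (i : Fin 5) : pd i 0 = 0 := pd_const 0 i

lemma smoothProf_const (a : ℝ) : SmoothProf (fun _ _ _ _ _ => a) :=
  contDiff_const (c := a)

lemma smul_eq_const_mul (a : ℝ) (f : Prof) : a • f = (fun _ _ _ _ _ => a) * f := rfl

lemma pd_smul {f : Prof} (hf : SmoothProf f) (a : ℝ) (i : Fin 5) :
    pd i (a • f) = a • pd i f := by
  rw [smul_eq_const_mul, smul_eq_const_mul, pd_mul (smoothProf_const a) hf, pd_const]
  simp

lemma SmoothProf.iterate_pd {f : Prof} (hf : SmoothProf f) (i : Fin 5) (n : ℕ) :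
    SmoothProf ((SVK.pd i)^[n] f) := by
  induction n with
  | zero => exact hf
  | succ n ih => rw [Function.iterate_succ_apply']; exact ih.pd i

lemma iterate_pd_comm {f : Prof} (hf : SmoothProf f) (i j : Fin 5) (n : ℕ) :
    (pd i)^[n] (pd j f) = pd j ((pd i)^[n] f) := by
  induction n with
  | zero => rfl
  | succ n ih =>
    rw [Function.iterate_succ_apply', Function.iterate_succ_apply', ih,
      pd_comm (hf.iterate_pd i n)]

lemma pd_congr_indep_y {f : Prof} (hf : ∀ t x y θ Y y', f t x y θ Y = f t x y' θ Y) (i : Fin 5) :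
    ∀ t x y θ Y y', pd i f t x y θ Y = pd i f t x y' θ Y := by
  intro t x y θ Y y'
  have h : f = fun t x _ θ Y => f t x y θ Y := by
    funext t x y₁ θ Y
    exact hf t x y₁ θ Y y
  have h2 : dy f = 0 := by
    rw [h]
    funext t x y θ Y
    exact deriv_const _ _
  fin_cases i
  · change deriv _ _ = deriv _ _
    congr 1; funext s; exact hf s x y θ Y y'
  · change deriv _ _ = deriv _ _
    congr 1; funext s; exact hf t s y θ Y y'
  · change dy f t x y θ Y = dy f t x y' θ Y
    rw [h2]; rfl
  · change deriv _ _ = deriv _ _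
    congr 1; funext s; exact hf t x y s Y y'
  · change deriv _ _ = deriv _ _
    congr 1; funext s; exact hf t x y θ s y'

lemma dy_eq_zero {f : Prof} (hf : ∀ t x y θ Y y', f t x y θ Y = f t x y' θ Y) : dy f = 0 := by
  funext t x y θ Y
  have h : (fun s => f t x s θ Y) = fun _ => f t x 0 θ Y := by
    funext s
    exact hf t x s θ Y 0
  change deriv (fun s => f t x s θ Y) y = 0
  rw [h]
  exact deriv_const _ _

/-- Profiles that depend on `(t, x, y)` only. -/
def IsSlow (f : Prof) : Prop := ∀ t x y θ Y θ' Y', f t x y θ Y = f t x y θ' Y'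

lemma IsSlow.dθ_eq_zero {f : Prof} (hf : IsSlow f) : dθ f = 0 := by
  funext t x y θ Y
  have h : (fun s => f t x y s Y) = fun _ => f t x y 0 Y := by
    funext s
    exact hf t x y s Y 0 Y
  change deriv (fun s => f t x y s Y) θ = 0
  rw [h]
  exact deriv_const _ _

lemma IsSlow.dY_eq_zero {f : Prof} (hf : IsSlow f) : dY f = 0 := by
  funext t x y θ Y
  have h : (fun s => f t x y θ s) = fun _ => f t x y θ 0 := by
    funext s
    exact hf t x y θ s θ 0
  change deriv (fun s => f t x y θ s) Y = 0
  rw [h]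
  exact deriv_const _ _

lemma IsSlow.pd {f : Prof} (hf : IsSlow f) (i : Fin 5) : IsSlow (pd i f) := by
  intro t x y θ Y θ' Y'
  fin_cases i
  · change deriv _ _ = deriv _ _
    congr 1; funext s; exact hf s x y θ Y θ' Y'
  · change deriv _ _ = deriv _ _
    congr 1; funext s; exact hf t s y θ Y θ' Y'
  · change deriv _ _ = deriv _ _
    congr 1; funext s; exact hf t x s θ Y θ' Y'
  · change dθ f t x y θ Y = dθ f t x y θ' Y'
    rw [hf.dθ_eq_zero]; rfl
  · change dY f t x y θ Y = dY f t x y θ' Y'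
    rw [hf.dY_eq_zero]; rfl

/-- Profiles that are `2π`-periodic in `θ`. -/
def IsPeriodic (f : Prof) : Prop := ∀ t x y θ Y, f t x y (θ + 2 * Real.pi) Y = f t x y θ Y

lemma IsPeriodic.pd {f : Prof} (hf : IsPeriodic f) (i : Fin 5) : IsPeriodic (pd i f) := by
  intro t x y θ Y
  fin_cases i
  · change deriv _ _ = deriv _ _
    congr 1; funext s; exact hf s x y θ Y
  · change deriv _ _ = deriv _ _
    congr 1; funext s; exact hf t s y θ Y
  · change deriv _ _ = deriv _ _
    congr 1; funext s; exact hf t x s θ Y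
  · change deriv (fun s => f t x y s Y) (θ + 2 * Real.pi) = deriv (fun s => f t x y s Y) θ
    have := deriv_comp_add_const (fun s => f t x y s Y) (2 * Real.pi) θ
    rw [← this]
    congr 1; funext s; exact hf t x y s Y
  · change deriv _ _ = deriv _ _
    congr 1; funext s; exact hf t x y θ s

lemma SmoothProf.continuous {f : Prof} (hf : SmoothProf f) :
    Continuous fun p : ℝ × ℝ × ℝ × ℝ × ℝ => f p.1 p.2.1 p.2.2.1 p.2.2.2.1 p.2.2.2.2 :=
  ContDiff.continuous hf

lemma SmoothProf.continuous_comp {f : Prof} (hf : SmoothProf f) {X : Type*} [TopologicalSpace X]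
    {a b c d e : X → ℝ} (ha : Continuous a) (hb : Continuous b) (hc : Continuous c)
    (hd : Continuous d) (he : Continuous e) :
    Continuous fun s => f (a s) (b s) (c s) (d s) (e s) :=
  hf.continuous.comp (ha.prodMk (hb.prodMk (hc.prodMk (hd.prodMk he))))

/-! ### The space `S*`: closure under derivatives and pointwise decay -/

/-- The definition of `S*` lists derivatives in the fixed order `t, x, θ, Y`. An extra derivative is
commuted into its slot; `y` has no slot and is excluded. -/
lemma exists_multiindex_pd {f : Prof} (hf : SmoothProf f) (i : Fin 5) (hi : i ≠ 2) (a b c d : ℕ) :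
    ∃ a' b' c' d' : ℕ, dt^[a] (dx^[b] (dθ^[c] (dY^[d] (pd i f))))
      = dt^[a'] (dx^[b'] (dθ^[c'] (dY^[d'] f))) := by
  simp only [← pd_zero, ← pd_one, ← pd_three, ← pd_four]
  have h4 := hf.iterate_pd 4 d
  have h3 := h4.iterate_pd 3 c
  have h1 := h3.iterate_pd 1 b
  fin_cases i
  · refine ⟨a + 1, b, c, d, ?_⟩
    dsimp only [Fin.zero_eta]
    rw [Function.iterate_succ_apply, iterate_pd_comm hf, iterate_pd_comm h4, iterate_pd_comm h3]
  · refine ⟨a, b + 1, c, d, ?_⟩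
    dsimp only [Fin.mk_one]
    rw [Function.iterate_succ_apply, iterate_pd_comm hf, iterate_pd_comm h4]
  · exact absurd rfl hi
  · refine ⟨a, b, c + 1, d, ?_⟩
    dsimp only [Fin.reduceFinMk]
    rw [Function.iterate_succ_apply, iterate_pd_comm hf]
  · refine ⟨a, b, c, d + 1, ?_⟩
    dsimp only [Fin.reduceFinMk]
    rw [Function.iterate_succ_apply]

lemma InSstar.pd {T : ℝ} {f : Prof} (hf : InSstar T f) (i : Fin 5) (hi : i ≠ 2) :
    InSstar T (pd i f) where
  smooth := hf.smooth.pd i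
  indep := pd_congr_indep_y hf.indep i
  periodic := IsPeriodic.pd hf.periodic i
  memLp a b c d := by
    obtain ⟨a', b', c', d', h⟩ := exists_multiindex_pd hf.smooth i hi a b c d
    rw [h]
    exact hf.memLp a' b' c' d'
  decay := by
    obtain ⟨δ, hδ, hd⟩ := hf.decay
    refine ⟨δ, hδ, fun a b c d => ?_⟩
    obtain ⟨a', b', c', d', h⟩ := exists_multiindex_pd hf.smooth i hi a b c d
    rw [h]
    exact hd a' b' c' d'

/-- A continuously differentiable function on the line is bounded by the `L²` norms of the function
and its derivative. -/
lemma sq_le_of_eLpNorm_le {g g' : ℝ → ℝ} (hg : ∀ x, HasDerivAt g (g' x) x) (hg' : Continuous g')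
    {A B : ℝ} (hA : 0 ≤ A) (hB : 0 ≤ B) (h : eLpNorm g 2 volume ≤ ENNReal.ofReal A)
    (h' : eLpNorm g' 2 volume ≤ ENNReal.ofReal B) (x : ℝ) :
    g x ^ 2 ≤ 2 * A ^ 2 + B ^ 2 := by
  have hgc : Continuous g := continuous_iff_continuousAt.2 fun x => (hg x).continuousAt
  have key : ∀ {k : ℝ → ℝ} (_ : Continuous k) {D : ℝ} (_ : 0 ≤ D)
      (_ : eLpNorm k 2 volume ≤ ENNReal.ofReal D), ∫ s in x..x + 1, k s ^ 2 ≤ D ^ 2 := by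
    intro k hk D hD hkD
    have hm : MemLp k 2 volume := ⟨hk.aestronglyMeasurable, hkD.trans_lt ENNReal.ofReal_lt_top⟩
    have hi : Integrable (fun s => k s ^ 2) volume := hm.integrable_sq
    have h1 : ∫ s in x..x + 1, k s ^ 2 ≤ ∫ s, k s ^ 2 := by
      rw [intervalIntegral.integral_of_le (by linarith)]
      exact setIntegral_le_integral hi (Eventually.of_forall fun s => sq_nonneg _)
    refine h1.trans ?_
    have h2 := hm.eLpNorm_eq_integral_rpow_norm (by norm_num) (by norm_num)
    rw [h2, ENNReal.ofReal_le_ofReal_iff hD] at hkD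
    simp only [ENNReal.toReal_ofNat, Real.rpow_ofNat, Real.norm_eq_abs, sq_abs] at hkD
    have h0 : 0 ≤ ∫ s, k s ^ 2 := integral_nonneg fun s => sq_nonneg _
    have h3 : ((∫ s, k s ^ 2) ^ (2⁻¹ : ℝ)) ^ 2 = ∫ s, k s ^ 2 := by
      rw [← Real.rpow_natCast, ← Real.rpow_mul h0]
      norm_num
    rw [← h3]
    exact pow_le_pow_left₀ (Real.rpow_nonneg h0 _) hkD 2
  have hI1 := key hgc hA h
  have hI2 := key hg' hB h'
  -- One-dimensional Sobolev embedding on the unit interval starting at `x`: `g(x)² = g(s)² - ∫ 2 g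
  -- g' ≤ g(s)² + I`. Averaging over `s` gives `g(x)² ≤ 2 ∫ g² + ∫ g'²`, whence the constant `2 A² +
  -- B²`.
  set I := ∫ s in x..x + 1, (g s ^ 2 + g' s ^ 2) with hI
  have hIsum : I = (∫ s in x..x + 1, g s ^ 2) + ∫ s in x..x + 1, g' s ^ 2 :=
    intervalIntegral.integral_add ((hgc.pow 2).intervalIntegrable _ _)
      ((hg'.pow 2).intervalIntegrable _ _)
  have hpt : ∀ s ∈ Set.Icc x (x + 1), g x ^ 2 ≤ g s ^ 2 + I := by
    intro s hs
    have h1 : ∫ u in x..s, 2 * g u * g' u = g s ^ 2 - g x ^ 2 := by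
      refine intervalIntegral.integral_eq_sub_of_hasDerivAt (f := fun u => g u ^ 2)
        (fun u _ => ?_) (Continuous.intervalIntegrable (by fun_prop) _ _)
      simpa [Pi.pow_def] using (hg u).pow 2
    have h2 : -(∫ u in x..s, 2 * g u * g' u) ≤ ∫ u in x..s, (g u ^ 2 + g' u ^ 2) := by
      rw [← intervalIntegral.integral_neg]
      refine intervalIntegral.integral_mono_on hs.1 (Continuous.intervalIntegrable (by fun_prop) _ _)
        (Continuous.intervalIntegrable (by fun_prop) _ _) fun u _ => ?_
      nlinarith [sq_nonneg (g u + g' u)]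
    have h3 : ∫ u in x..s, (g u ^ 2 + g' u ^ 2) ≤ I := by
      refine intervalIntegral.integral_mono_interval le_rfl hs.1 hs.2
        (Eventually.of_forall fun u => by positivity)
        (Continuous.intervalIntegrable (by fun_prop) _ _)
    linarith
  have h4 : ∫ _ in x..x + 1, g x ^ 2 ≤ ∫ s in x..x + 1, (g s ^ 2 + I) :=
    intervalIntegral.integral_mono_on (by linarith) (Continuous.intervalIntegrable (by fun_prop) _ _)
      (Continuous.intervalIntegrable (by fun_prop) _ _) hpt
  rw [intervalIntegral.integral_add (Continuous.intervalIntegrable (by fun_prop) _ _)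
    (Continuous.intervalIntegrable (by fun_prop) _ _)] at h4
  simp at h4
  linarith

/-- The decay in `S*` is already pointwise in `t, θ, Y`, so the Sobolev bound is needed in `x` only,
for `f` and `∂_x f`, which share the rate `δ`. -/
lemma InSstar.exists_bound {T : ℝ} {f : Prof} (hf : InSstar T f) :
    ∃ C δ : ℝ, 0 ≤ C ∧ 0 < δ ∧ ∀ t ∈ Set.Icc 0 T, ∀ x y θ Y, 0 ≤ Y →
      |f t x y θ Y| ≤ C * Real.exp (-(δ * Y)) := by
  obtain ⟨δ, hδ, hd⟩ := hf.decay
  obtain ⟨A, hA, hA'⟩ := hd 0 0 0 0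
  obtain ⟨B, hB, hB'⟩ := hd 0 1 0 0
  simp only [Function.iterate_zero, id, Function.iterate_one] at hA' hB'
  refine ⟨Real.sqrt (2 * A ^ 2 + B ^ 2), δ, Real.sqrt_nonneg _, hδ, fun t ht x y θ Y hY => ?_⟩
  have h := sq_le_of_eLpNorm_le (g := fun x => f t x 0 θ Y) (g' := fun x => dx f t x 0 θ Y)
    (fun x => hf.smooth.hasDerivAt_x t x 0 θ Y)
    (hf.smooth.dx.continuous_comp continuous_const continuous_id continuous_const continuous_const
      continuous_const) (A := A * Real.exp (-(δ * Y))) (B := B * Real.exp (-(δ * Y)))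
    (by positivity) (by positivity) (hA' t ht θ Y hY) (hB' t ht θ Y hY) x
  rw [hf.indep t x y θ Y 0]
  refine abs_le_of_sq_le_sq (h.trans_eq ?_) (by positivity)
  rw [mul_pow, mul_pow, mul_pow, Real.sq_sqrt (by positivity)]
  ring

/-! ### The algebra generated by slow profiles and `S*`, and its decaying ideal -/

/-- The algebra generated by smooth slow profiles and `S*`. -/
inductive IsBdd (T : ℝ) : Prof → Prop
  | slow {f : Prof} (hs : SmoothProf f) (hi : IsSlow f) : IsBdd T f
  | star {f : Prof} (hf : InSstar T f) : IsBdd T f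
  | add {f g : Prof} (hf : IsBdd T f) (hg : IsBdd T g) : IsBdd T (f + g)
  | mul {f g : Prof} (hf : IsBdd T f) (hg : IsBdd T g) : IsBdd T (f * g)

/-- The ideal generated by `S*` in that algebra. -/
inductive IsDec (T : ℝ) : Prof → Prop
  | star {f : Prof} (hf : InSstar T f) : IsDec T f
  | add {f g : Prof} (hf : IsDec T f) (hg : IsDec T g) : IsDec T (f + g)
  | mul {f g : Prof} (hf : IsBdd T f) (hg : IsDec T g) : IsDec T (f * g)

variable {T : ℝ} {f g : Prof}

lemma IsBdd.smooth (hf : IsBdd T f) : SmoothProf f := by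
  induction hf with
  | slow hs _ => exact hs
  | star hf => exact hf.smooth
  | add _ _ h1 h2 => exact h1.add h2
  | mul _ _ h1 h2 => exact h1.mul h2

lemma IsBdd.periodic (hf : IsBdd T f) : IsPeriodic f := by
  induction hf with
  | slow _ hi => exact fun t x y θ Y => hi t x y _ Y θ Y
  | star hf => exact hf.periodic
  | add _ _ h1 h2 => exact fun t x y θ Y => congrArg₂ (· + ·) (h1 t x y θ Y) (h2 t x y θ Y)
  | mul _ _ h1 h2 => exact fun t x y θ Y => congrArg₂ (· * ·) (h1 t x y θ Y) (h2 t x y θ Y)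

lemma IsDec.isBdd (hf : IsDec T f) : IsBdd T f := by
  induction hf with
  | star hf => exact .star hf
  | add _ _ h1 h2 => exact h1.add h2
  | mul h1 _ h2 => exact h1.mul h2

lemma isSlow_zero : IsSlow 0 := fun _ _ _ _ _ _ _ => rfl

lemma isBdd_const (a : ℝ) : IsBdd T (fun _ _ _ _ _ => a) :=
  .slow (smoothProf_const a) fun _ _ _ _ _ _ _ => rfl

lemma inSstar_zero : InSstar T 0 := by
  have h : ∀ a b c d : ℕ, dt^[a] (dx^[b] (dθ^[c] (dY^[d] 0))) = 0 := by
    intro a b c d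
    simp only [← pd_zero, ← pd_one, ← pd_three, ← pd_four]
    have : ∀ (i : Fin 5) n, (pd i)^[n] 0 = 0 := fun i n =>
      Function.iterate_fixed (pd_zero_fun i) n
    simp only [this]
  refine ⟨.zero, fun _ _ _ _ _ _ => rfl, fun _ _ _ _ _ => rfl, fun a b c d => ?_,
    1, one_pos, fun a b c d => ⟨1, one_pos, fun t _ θ Y _ => ?_⟩⟩
  · rw [h]; exact MemLp.zero
  · rw [h]
    have : (fun x => (0 : Prof) t x 0 θ Y) = (0 : ℝ → ℝ) := rfl
    rw [this, eLpNorm_zero]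
    exact zero_le

lemma isDec_zero : IsDec T 0 := .star inSstar_zero

lemma IsDec.smul (hf : IsDec T f) (a : ℝ) : IsDec T (a • f) := .mul (isBdd_const a) hf

lemma IsDec.neg (hf : IsDec T f) : IsDec T (-f) := by simpa using hf.smul (-1)

lemma IsDec.sub (hf : IsDec T f) (hg : IsDec T g) : IsDec T (f - g) := by
  rw [sub_eq_add_neg]; exact hf.add hg.neg

lemma IsDec.mul_right (hf : IsDec T f) (hg : IsBdd T g) : IsDec T (f * g) := by
  rw [mul_comm]; exact .mul hg hf

/-- For `i = 2` the derivative is zero, as elements of `S*` do not depend on `y`. -/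
lemma InSstar.isDec_pd (hf : InSstar T f) (i : Fin 5) : IsDec T (SVK.pd i f) := by
  by_cases hi : i = 2
  · subst hi
    rw [pd_two, dy_eq_zero hf.indep]
    exact isDec_zero
  · exact .star (hf.pd i hi)

lemma IsBdd.pd (hf : IsBdd T f) (i : Fin 5) : IsBdd T (pd i f) := by
  induction hf with
  | slow hs hi => exact .slow (hs.pd i) (hi.pd i)
  | star hf => exact (hf.isDec_pd i).isBdd
  | add h1 h2 ih1 ih2 => rw [pd_add h1.smooth h2.smooth]; exact ih1.add ih2
  | mul h1 h2 ih1 ih2 =>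
    rw [pd_mul h1.smooth h2.smooth]
    exact (ih1.mul h2).add (h1.mul ih2)

lemma IsDec.pd (hf : IsDec T f) (i : Fin 5) : IsDec T (pd i f) := by
  induction hf with
  | star hf => exact hf.isDec_pd i
  | add h1 h2 ih1 ih2 => rw [pd_add h1.isBdd.smooth h2.isBdd.smooth]; exact ih1.add ih2
  | mul h1 h2 ih2 =>
    rw [pd_mul h1.smooth h2.isBdd.smooth]
    exact (IsDec.mul (h1.pd i) h2).add (.mul h1 ih2)

/-- The constants may depend on the point `(t, x, y)`, because a slow factor is only assumed smooth.
Limits and integrals in `Y` at a fixed point need no more. -/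
lemma IsBdd.exists_bound (hf : IsBdd T f) {t : ℝ} (ht : t ∈ Set.Icc 0 T) (x y : ℝ) :
    ∃ C : ℝ, 0 ≤ C ∧ ∀ θ Y, 0 ≤ Y → |f t x y θ Y| ≤ C := by
  induction hf with
  | @slow f hs hi =>
    exact ⟨|f t x y 0 0|, abs_nonneg _, fun θ Y _ => by rw [hi t x y θ Y 0 0]⟩
  | star hf =>
    obtain ⟨C, δ, hC, hδ, h⟩ := hf.exists_bound
    refine ⟨C, hC, fun θ Y hY => (h t ht x y θ Y hY).trans ?_⟩
    exact mul_le_of_le_one_right hC (Real.exp_le_one_iff.2 (by nlinarith))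
  | add _ _ h1 h2 =>
    obtain ⟨C, hC, h⟩ := h1
    obtain ⟨C', hC', h'⟩ := h2
    exact ⟨C + C', add_nonneg hC hC', fun θ Y hY =>
      (abs_add_le _ _).trans (add_le_add (h θ Y hY) (h' θ Y hY))⟩
  | mul _ _ h1 h2 =>
    obtain ⟨C, hC, h⟩ := h1
    obtain ⟨C', hC', h'⟩ := h2
    refine ⟨C * C', mul_nonneg hC hC', fun θ Y hY => ?_⟩
    exact (abs_mul _ _).trans_le (mul_le_mul (h θ Y hY) (h' θ Y hY) (abs_nonneg _) hC)

lemma IsDec.exists_bound (hf : IsDec T f) {t : ℝ} (ht : t ∈ Set.Icc 0 T) (x y : ℝ) :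
    ∃ C δ : ℝ, 0 ≤ C ∧ 0 < δ ∧ ∀ θ Y, 0 ≤ Y → |f t x y θ Y| ≤ C * Real.exp (-(δ * Y)) := by
  induction hf with
  | star hf =>
    obtain ⟨C, δ, hC, hδ, h⟩ := hf.exists_bound
    exact ⟨C, δ, hC, hδ, fun θ Y hY => h t ht x y θ Y hY⟩
  | add _ _ h1 h2 =>
    obtain ⟨C, δ, hC, hδ, h⟩ := h1
    obtain ⟨C', δ', hC', hδ', h'⟩ := h2
    refine ⟨C + C', min δ δ', add_nonneg hC hC', lt_min hδ hδ', fun θ Y hY =>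
      (abs_add_le _ _).trans ?_⟩
    rw [add_mul]
    refine add_le_add ((h θ Y hY).trans ?_) ((h' θ Y hY).trans ?_)
    · gcongr
      exact min_le_left _ _
    · gcongr
      exact min_le_right _ _
  | mul h1 _ h2 =>
    obtain ⟨C, hC, h⟩ := h1.exists_bound ht x y
    obtain ⟨C', δ', hC', hδ', h'⟩ := h2
    refine ⟨C * C', δ', mul_nonneg hC hC', hδ', fun θ Y hY => ?_⟩
    rw [mul_assoc]
    exact (abs_mul _ _).trans_le (mul_le_mul (h θ Y hY) (h' θ Y hY) (abs_nonneg _) hC)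

lemma tendsto_const_mul_exp_neg {C δ : ℝ} (hδ : 0 < δ) :
    Tendsto (fun Y => C * Real.exp (-(δ * Y))) atTop (𝓝 0) := by
  have h : Tendsto (fun Y => Real.exp (-(δ * Y))) atTop (𝓝 0) :=
    Real.tendsto_exp_neg_atTop_nhds_zero.comp (tendsto_id.const_mul_atTop hδ)
  simpa using h.const_mul C

lemma IsDec.tendsto_zero (hf : IsDec T f) {t : ℝ} (ht : t ∈ Set.Icc 0 T) (x y θ : ℝ) :
    Tendsto (fun Y => f t x y θ Y) atTop (𝓝 0) := by
  obtain ⟨C, δ, hC, hδ, h⟩ := hf.exists_bound ht x y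
  refine squeeze_zero_norm' ?_ (tendsto_const_mul_exp_neg (C := C) hδ)
  filter_upwards [eventually_ge_atTop 0] with Y hY
  exact h θ Y hY

/-! ### Means and Fourier coefficients -/

lemma hasDerivAt_intervalIntegral_of_continuous {E : Type*} [NormedAddCommGroup E]
    [NormedSpace ℝ E] [CompleteSpace E] {F F' : ℝ → ℝ → E}
    (hF : Continuous fun p : ℝ × ℝ => F p.1 p.2) (hF' : Continuous fun p : ℝ × ℝ => F' p.1 p.2)
    (h : ∀ s θ, HasDerivAt (fun s => F s θ) (F' s θ) s) (a b s₀ : ℝ) :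
    HasDerivAt (fun s => ∫ θ in a..b, F s θ) (∫ θ in a..b, F' s₀ θ) s₀ := by
  -- The dominating function is the constant bound of `F'` on a compact product around `s₀`.
  obtain ⟨M, hM⟩ := ((isCompact_closedBall s₀ 1).prod (isCompact_uIcc (a := a) (b := b))).exists_bound_of_continuousOn
    hF'.continuousOn
  have hc : ∀ s, Continuous (F s) := fun s => hF.comp (continuous_const.prodMk continuous_id)
  have hc' : ∀ s, Continuous (F' s) := fun s => hF'.comp (continuous_const.prodMk continuous_id)
  refine (intervalIntegral.hasDerivAt_integral_of_dominated_loc_of_deriv_le (bound := fun _ => M)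
    (Metric.ball_mem_nhds s₀ one_pos) (Eventually.of_forall fun s => (hc s).aestronglyMeasurable)
    ((hc s₀).intervalIntegrable _ _) (hc' s₀).aestronglyMeasurable ?_
    intervalIntegrable_const ?_).2
  · refine Eventually.of_forall fun θ hθ s hs => hM (s, θ) ⟨Metric.ball_subset_closedBall hs, ?_⟩
    exact Set.uIoc_subset_uIcc hθ
  · exact Eventually.of_forall fun θ _ s _ => h s θ

lemma integral_deriv_eq_zero_of_periodic {g g' : ℝ → ℂ} (hg : ∀ θ, HasDerivAt g (g' θ) θ)
    (hg' : Continuous g') (hp : g (2 * Real.pi) = g 0) :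
    ∫ θ in (0 : ℝ)..(2 * Real.pi), g' θ = 0 := by
  rw [intervalIntegral.integral_eq_sub_of_hasDerivAt (fun θ _ => hg θ)
    (hg'.intervalIntegrable _ _), hp, sub_self]

section Mean

variable {f g : Prof}

lemma SmoothProf.continuous_θ (hf : SmoothProf f) (t x y Y : ℝ) :
    Continuous fun θ => f t x y θ Y :=
  hf.continuous_comp continuous_const continuous_const continuous_const continuous_id
    continuous_const

lemma mean_add (hf : SmoothProf f) (hg : SmoothProf g) : mean (f + g) = mean f + mean g := by
  funext t x y θ Y
  change _ = (1 / (2 * Real.pi)) * _ + (1 / (2 * Real.pi)) * _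
  rw [← mul_add, ← intervalIntegral.integral_add ((hf.continuous_θ t x y Y).intervalIntegrable _ _)
    ((hg.continuous_θ t x y Y).intervalIntegrable _ _)]
  rfl

lemma mean_smul (a : ℝ) : mean (a • f) = a • mean f := by
  funext t x y θ Y
  change (1 / (2 * Real.pi)) * (∫ θ in (0 : ℝ)..(2 * Real.pi), a * f t x y θ Y)
    = a * ((1 / (2 * Real.pi)) * _)
  rw [intervalIntegral.integral_const_mul]
  ring

lemma mean_neg : mean (-f) = -mean f := by
  simpa using mean_smul (f := f) (-1)

lemma mean_sub (hf : SmoothProf f) (hg : SmoothProf g) : mean (f - g) = mean f - mean g := by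
  rw [sub_eq_add_neg, mean_add hf hg.neg, mean_neg, sub_eq_add_neg]

lemma mean_congr {t x y Y : ℝ} (h : ∀ θ, f t x y θ Y = g t x y θ Y) (θ : ℝ) :
    mean f t x y θ Y = mean g t x y θ Y := by
  simp only [mean, h]

lemma mean_of_const {t x y Y : ℝ} (h : ∀ θ θ', f t x y θ Y = f t x y θ' Y) (θ : ℝ) :
    mean f t x y θ Y = f t x y θ Y := by
  have h2 : mean f t x y θ Y = 1 / (2 * Real.pi) * ∫ _ in (0 : ℝ)..(2 * Real.pi), f t x y θ Y := by
    simp only [mean, h _ θ]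
  rw [h2, intervalIntegral.integral_const]
  have := Real.pi_ne_zero
  simp
  field_simp

lemma mean_zero : mean 0 = 0 := by
  simpa using mean_smul (f := 0) 0

lemma osc_zero : osc 0 = 0 := by
  simp [osc, mean_zero]

lemma mean_dY (hf : SmoothProf f) (t x y θ Y : ℝ) :
    HasDerivAt (fun s => mean f t x y θ s) (mean (dY f) t x y θ Y) Y := by
  refine HasDerivAt.const_mul _ ?_
  exact hasDerivAt_intervalIntegral_of_continuous (F := fun s θ => f t x y θ s)
    (F' := fun s θ => dY f t x y θ s)
    (hf.continuous_comp continuous_const continuous_const continuous_const continuous_snd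
      continuous_fst)
    (hf.dY.continuous_comp continuous_const continuous_const continuous_const continuous_snd
      continuous_fst) (fun s θ => hf.hasDerivAt_Y t x y θ s) 0 (2 * Real.pi) Y

lemma mean_dx (hf : SmoothProf f) (t x y θ Y : ℝ) :
    HasDerivAt (fun s => mean f t s y θ Y) (mean (dx f) t x y θ Y) x := by
  refine HasDerivAt.const_mul _ ?_
  exact hasDerivAt_intervalIntegral_of_continuous (F := fun s θ => f t s y θ Y)
    (F' := fun s θ => dx f t s y θ Y)
    (hf.continuous_comp continuous_const continuous_fst continuous_const continuous_snd
      continuous_const)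
    (hf.dx.continuous_comp continuous_const continuous_fst continuous_const continuous_snd
      continuous_const) (fun s θ => hf.hasDerivAt_x t s y θ Y) 0 (2 * Real.pi) x

lemma mean_dθ (hf : SmoothProf f) (hp : IsPeriodic f) : mean (dθ f) = 0 := by
  funext t x y θ Y
  have h : ∫ θ in (0 : ℝ)..(2 * Real.pi), dθ f t x y θ Y = 0 := by
    rw [intervalIntegral.integral_eq_sub_of_hasDerivAt (fun θ _ => hf.hasDerivAt_θ t x y θ Y)
      ((hf.dθ.continuous_θ t x y Y).intervalIntegrable _ _)]
    have := hp t x y 0 Y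
    rw [zero_add] at this
    rw [this, sub_self]
  change (1 / (2 * Real.pi)) * (∫ θ in (0 : ℝ)..(2 * Real.pi), dθ f t x y θ Y) = 0
  rw [h, mul_zero]

lemma abs_mean_le {t x y Y C : ℝ} (h : ∀ θ, |f t x y θ Y| ≤ C) (θ : ℝ) :
    |mean f t x y θ Y| ≤ C := by
  have h1 : ‖∫ θ in (0 : ℝ)..(2 * Real.pi), f t x y θ Y‖ ≤ C * |2 * Real.pi - 0| :=
    intervalIntegral.norm_integral_le_of_norm_le_const fun θ _ => h θ
  have hpi := Real.pi_pos
  rw [sub_zero, abs_of_pos (by positivity), Real.norm_eq_abs] at h1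
  simp only [mean]
  rw [abs_mul, abs_of_pos (by positivity : 0 < 1 / (2 * Real.pi)), one_div, inv_mul_le_iff₀
    (by positivity)]
  linarith

end Mean

section Mode

variable {f g : Prof} (n : ℤ)

lemma continuous_exp_mode : Continuous fun θ : ℝ => Complex.exp (-(Complex.I * (n : ℂ) * (θ : ℂ))) := by
  fun_prop

lemma SmoothProf.continuous_mode (hf : SmoothProf f) (t x y Y : ℝ) :
    Continuous fun θ : ℝ => (f t x y θ Y : ℂ) * Complex.exp (-(Complex.I * (n : ℂ) * (θ : ℂ))) :=
  (Complex.continuous_ofReal.comp (hf.continuous_θ t x y Y)).mul (continuous_exp_mode n)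

lemma mode_add (hf : SmoothProf f) (hg : SmoothProf g) (t x y Y : ℝ) :
    mode n (f + g) t x y Y = mode n f t x y Y + mode n g t x y Y := by
  unfold mode
  rw [← mul_add, ← intervalIntegral.integral_add
    ((hf.continuous_mode n t x y Y).intervalIntegrable _ _)
    ((hg.continuous_mode n t x y Y).intervalIntegrable _ _)]
  congr 2
  funext θ
  rw [← add_mul]
  congr 1
  exact Complex.ofReal_add _ _

lemma mode_smul (a : ℝ) (t x y Y : ℝ) : mode n (a • f) t x y Y = a * mode n f t x y Y := by
  unfold mode
  rw [mul_left_comm]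
  congr 1
  rw [← intervalIntegral.integral_const_mul]
  congr 1
  funext θ
  rw [← mul_assoc]
  congr 1
  exact Complex.ofReal_mul _ _

lemma mode_neg_fun (t x y Y : ℝ) : mode n (-f) t x y Y = -mode n f t x y Y := by
  simpa using mode_smul (f := f) n (-1) t x y Y

lemma mode_sub (hf : SmoothProf f) (hg : SmoothProf g) (t x y Y : ℝ) :
    mode n (f - g) t x y Y = mode n f t x y Y - mode n g t x y Y := by
  rw [sub_eq_add_neg, mode_add n hf hg.neg, mode_neg_fun, sub_eq_add_neg]

lemma mode_congr {t x y Y y' Y' : ℝ} (h : ∀ θ, f t x y θ Y = g t x y' θ Y') :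
    mode n f t x y Y = mode n g t x y' Y' := by
  simp only [mode, h]

lemma mode_eq_zero {t x y Y : ℝ} (h : ∀ θ, f t x y θ Y = 0) : mode n f t x y Y = 0 := by
  simp [mode, h]

lemma mode_neg (t x y Y : ℝ) : mode (-n) f t x y Y = star (mode n f t x y Y) := by
  unfold mode
  rw [star_mul']
  congr 1
  · simp
  · rw [Complex.star_def, intervalIntegral.integral_of_le (by positivity),
      intervalIntegral.integral_of_le (by positivity), ← integral_conj]
    congr 1
    funext θ
    rw [map_mul, Complex.conj_ofReal, ← Complex.exp_conj]
    congr 2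
    simp

lemma hasDerivAt_mode_Y (hf : SmoothProf f) (t x y Y : ℝ) :
    HasDerivAt (fun s => mode n f t x y s) (mode n (dY f) t x y Y) Y := by
  refine HasDerivAt.const_mul _ ?_
  refine hasDerivAt_intervalIntegral_of_continuous
    (F := fun s (θ : ℝ) => (f t x y θ s : ℂ) * Complex.exp (-(Complex.I * (n : ℂ) * (θ : ℂ))))
    (F' := fun s (θ : ℝ) => (dY f t x y θ s : ℂ) * Complex.exp (-(Complex.I * (n : ℂ) * (θ : ℂ))))
    ?_ ?_ (fun s θ => ((hf.hasDerivAt_Y t x y θ s).ofReal_comp.mul_const _)) 0 (2 * Real.pi) Y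
  · exact (Complex.continuous_ofReal.comp (hf.continuous_comp continuous_const continuous_const
      continuous_const continuous_snd continuous_fst)).mul
      ((continuous_exp_mode n).comp continuous_snd)
  · exact (Complex.continuous_ofReal.comp (hf.dY.continuous_comp continuous_const continuous_const
      continuous_const continuous_snd continuous_fst)).mul
      ((continuous_exp_mode n).comp continuous_snd)

lemma mode_dθ (hf : SmoothProf f) (hp : IsPeriodic f) (t x y Y : ℝ) :
    mode n (dθ f) t x y Y = Complex.I * n * mode n f t x y Y := by
  have hd : ∀ θ : ℝ, HasDerivAt
      (fun θ : ℝ => (f t x y θ Y : ℂ) * Complex.exp (-(Complex.I * (n : ℂ) * (θ : ℂ))))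
      ((dθ f t x y θ Y : ℂ) * Complex.exp (-(Complex.I * (n : ℂ) * (θ : ℂ)))
        - Complex.I * n * ((f t x y θ Y : ℂ) * Complex.exp (-(Complex.I * (n : ℂ) * (θ : ℂ))))) θ := by
    intro θ
    have h1 := (hf.hasDerivAt_θ t x y θ Y).ofReal_comp
    have h2 : HasDerivAt (fun θ : ℝ => Complex.exp (-(Complex.I * (n : ℂ) * (θ : ℂ))))
        (Complex.exp (-(Complex.I * (n : ℂ) * (θ : ℂ))) * -(Complex.I * n * 1)) θ :=
      (((Complex.ofRealCLM.hasDerivAt (x := θ)).const_mul (Complex.I * (n : ℂ))).neg).cexp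
    convert! h1.mul h2 using 1
    ring
  -- Integration by parts over one period: the boundary terms cancel because `n` is an integer and
  -- `f` is periodic.
  have h0 := integral_deriv_eq_zero_of_periodic hd
    ((hf.dθ.continuous_mode n t x y Y).sub ((hf.continuous_mode n t x y Y).const_mul _)) (by
      have h1 := hp t x y 0 Y
      rw [zero_add] at h1
      have h2 : Complex.exp (-(Complex.I * n * ((2 * Real.pi : ℝ) : ℂ))) = 1 := by
        rw [Complex.exp_eq_one_iff]
        exact ⟨-n, by push_cast; ring⟩
      rw [h1, h2]
      simp)
  rw [intervalIntegral.integral_sub ((hf.dθ.continuous_mode n t x y Y).intervalIntegrable _ _)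
    (((hf.continuous_mode n t x y Y).const_mul _).intervalIntegrable _ _),
    intervalIntegral.integral_const_mul, sub_eq_zero] at h0
  unfold mode
  rw [h0]
  ring

lemma norm_mode_le {t x y Y C : ℝ} (h : ∀ θ, |f t x y θ Y| ≤ C) : ‖mode n f t x y Y‖ ≤ C := by
  have hpi := Real.pi_pos
  have h1 : ‖∫ θ in (0 : ℝ)..(2 * Real.pi),
      (f t x y θ Y : ℂ) * Complex.exp (-(Complex.I * (n : ℂ) * (θ : ℂ)))‖ ≤ C * |2 * Real.pi - 0| := by
    refine intervalIntegral.norm_integral_le_of_norm_le_const fun θ _ => ?_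
    have h2 : -(Complex.I * (n : ℂ) * (θ : ℂ)) = ((-(n * θ) : ℝ) : ℂ) * Complex.I := by
      push_cast; ring
    rw [norm_mul, h2, Complex.norm_exp_ofReal_mul_I, mul_one, Complex.norm_real]
    exact h θ
  rw [sub_zero, abs_of_pos (by positivity)] at h1
  unfold mode
  rw [norm_mul]
  have h3 : ‖(1 / (2 * Real.pi) : ℂ)‖ = 1 / (2 * Real.pi) := by
    simp [abs_of_pos hpi]
  rw [h3, one_div, inv_mul_le_iff₀ (by positivity)]
  linarith

lemma mode_zero_eq_mean (t x y θ Y : ℝ) : mode 0 f t x y Y = mean f t x y θ Y := by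
  simp [mode, mean, intervalIntegral.integral_ofReal]

/-- A smooth periodic profile all of whose Fourier coefficients vanish is zero. -/
lemma eq_zero_of_mode_eq_zero (hf : SmoothProf f) (hp : IsPeriodic f) {t x y Y : ℝ}
    (h : ∀ n, mode n f t x y Y = 0) (θ : ℝ) : f t x y θ Y = 0 := by
  have hpi := Real.pi_pos
  have : Fact (0 < 2 * Real.pi) := ⟨by positivity⟩
  have hper : Function.Periodic (fun θ => (f t x y θ Y : ℂ)) (2 * Real.pi) := fun θ => by
    simp only [hp t x y θ Y]
  have hcont : Continuous fun θ => (f t x y θ Y : ℂ) :=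
    Complex.continuous_ofReal.comp (hf.continuous_θ t x y Y)
  -- The profile at fixed `(t, x, y, Y)` descends to a continuous function on the circle. Its
  -- coefficients vanish, hence are summable, so its Fourier series converges to it pointwise, and
  -- the sum is zero.
  let F : C(AddCircle (2 * Real.pi), ℂ) :=
    ⟨hper.lift, continuous_coinduced_dom.2 hcont⟩
  have hco : ∀ n, fourierCoeff F n = 0 := by
    intro n
    rw [fourierCoeff_eq_intervalIntegral _ n 0, ← h n, zero_add]
    unfold mode
    rw [← Complex.coe_smul]
    congr 1
    · push_cast; rfl
    · refine intervalIntegral.integral_congr fun θ _ => ?_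
      have e : F (θ : AddCircle (2 * Real.pi)) = (f t x y θ Y : ℂ) := rfl
      simp only [e, fourier_coe_apply, smul_eq_mul]
      rw [mul_comm]
      congr 2
      have : (Real.pi : ℂ) ≠ 0 := by exact_mod_cast hpi.ne'
      push_cast
      field_simp
  have hz : fourierCoeff F = 0 := funext hco
  have hs : Summable (fourierCoeff F) := by rw [hz]; exact summable_zero
  have h1 := has_pointwise_sum_fourier_series_of_summable hs (θ : AddCircle (2 * Real.pi))
  simp only [hz, Pi.zero_apply, zero_smul] at h1
  have h2 : F (θ : AddCircle (2 * Real.pi)) = 0 := h1.unique hasSum_zero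
  have e : F (θ : AddCircle (2 * Real.pi)) = (f t x y θ Y : ℂ) := rfl
  rw [e] at h2
  exact_mod_cast h2

/-- Profiles are real, so negative frequencies are conjugates of positive ones, and frequency zero
is the mean. -/
lemma eq_zero_of_mode_pos_eq_zero (hf : SmoothProf f) (hp : IsPeriodic f) {t x y Y : ℝ}
    (hm : mean f t x y 0 Y = 0) (h : ∀ n : ℤ, 0 < n → mode n f t x y Y = 0) (θ : ℝ) :
    f t x y θ Y = 0 := by
  refine eq_zero_of_mode_eq_zero hf hp (fun n => ?_) θ
  rcases lt_trichotomy n 0 with hn | rfl | hn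
  · have := mode_neg (f := f) (-n) t x y Y
    rw [neg_neg, h (-n) (by omega), star_zero] at this
    exact this
  · rw [mode_zero_eq_mean t x y 0 Y, hm, Complex.ofReal_zero]
  · exact h n hn

end Mode

/-! ### Passing equations to the boundary -/

/-- Continuity along the diagonal approach `(y + s, Y + s)`, `s → 0+`, reaches both boundaries at
once. -/
lemma EqInt.eqDom {T : ℝ} {f g : Prof} (h : EqInt T f g) (hf : SmoothProf f) (hg : SmoothProf g) :
    EqDom T f g := by
  intro t ht x y θ Y hy hY
  have hc : ∀ {k : Prof}, SmoothProf k → Tendsto (fun s => k t x (y + s) θ (Y + s)) (𝓝[>] 0)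
      (𝓝 (k t x y θ Y)) := by
    intro k hk
    have : Continuous fun s => k t x (y + s) θ (Y + s) :=
      hk.continuous_comp continuous_const continuous_const (continuous_const.add continuous_id)
        continuous_const (continuous_const.add continuous_id)
    have h2 := (this.tendsto 0).mono_left (nhdsWithin_le_nhds (s := Set.Ioi 0))
    simpa using h2
  refine tendsto_nhds_unique ((hc hf).congr' ?_) (hc hg)
  filter_upwards [self_mem_nhdsWithin] with s hs
  have hs : 0 < s := hs
  exact h t ht x _ θ _ (by linarith) (by linarith)

/-- Identities are known on the closed half line only, while `deriv` is two-sided. At the endpoint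
the one-sided derivative determines the two-sided one. -/
lemma hasDerivAt_eq_zero_of_eq_zero_on_Ici {E : Type*} [NormedAddCommGroup E] [NormedSpace ℝ E]
    {f : ℝ → E} {f' : E} {Y : ℝ} (h : ∀ Y, 0 ≤ Y → f Y = 0) (hd : HasDerivAt f f' Y) (hY : 0 ≤ Y) :
    f' = 0 := by
  have h1 : HasDerivWithinAt f f' (Set.Ici 0) Y := hd.hasDerivWithinAt
  have h2 : HasDerivWithinAt f 0 (Set.Ici 0) Y :=
    (hasDerivWithinAt_const Y (Set.Ici 0) (0 : E)).congr (fun z hz => h z hz) (h Y hY)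
  exact (uniqueDiffOn_Ici (0 : ℝ) Y hY).eq_deriv _ h1 h2

/-! ### Bounded solutions of the mode equations -/

lemma eq_of_hasDerivAt_zero_on_Ici {g : ℝ → ℂ} (h : ∀ Y, 0 ≤ Y → HasDerivAt g 0 Y) {Y : ℝ}
    (hY : 0 ≤ Y) : g Y = g 0 :=
  constant_of_has_deriv_right_zero (fun z hz => (h z hz.1).continuousAt.continuousWithinAt)
    (fun z hz => (h z hz.1).hasDerivWithinAt) Y ⟨hY, le_rfl⟩

lemma hasDerivAt_cexp_ofReal_mul (k : ℝ) (Y : ℝ) :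
    HasDerivAt (fun Y : ℝ => Complex.exp ((k * Y : ℝ) : ℂ))
      (Complex.exp ((k * Y : ℝ) : ℂ) * k) Y := by
  have h : HasDerivAt (fun Y : ℝ => ((k * Y : ℝ) : ℂ)) ((k : ℝ) : ℂ) Y := by
    simpa using ((hasDerivAt_id Y).const_mul k).ofReal_comp
  exact h.cexp

/-- Bounded solutions of `w'' = k² w` on the half line. -/
lemma eq_exp_of_bounded {w w₁ : ℝ → ℂ} {k C : ℝ} (hk : 0 < k)
    (h : ∀ Y, 0 ≤ Y → HasDerivAt w (w₁ Y) Y) (h₁ : ∀ Y, 0 ≤ Y → HasDerivAt w₁ (k ^ 2 * w Y) Y)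
    (hb : ∀ Y, 0 ≤ Y → ‖w Y‖ ≤ C) (hb₁ : ∀ Y, 0 ≤ Y → ‖w₁ Y‖ ≤ C) {Y : ℝ} (hY : 0 ≤ Y) :
    w Y = w 0 * Complex.exp ((-k * Y : ℝ) : ℂ) ∧ w₁ Y = -k * w Y := by
  -- The combination `w' + k w` satisfies `z' = k z`, so it is a multiple of `e^{kY}`; boundedness
  -- forces the multiple to be zero. What remains is the first-order equation `w' = -k w`.
  have hA : ∀ Y, 0 ≤ Y → w₁ Y + k * w Y = 0 := by
    have hd : ∀ Y, 0 ≤ Y →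
        HasDerivAt (fun Y : ℝ => (w₁ Y + k * w Y) * Complex.exp ((-k * Y : ℝ) : ℂ)) 0 Y := by
      intro Y hY
      convert! ((h₁ Y hY).add ((h Y hY).const_mul (k : ℂ))).mul
        (hasDerivAt_cexp_ofReal_mul (-k) Y) using 1
      simp only [Pi.add_apply]
      push_cast
      ring
    have hconst := fun Y hY => eq_of_hasDerivAt_zero_on_Ici (Y := Y) hd hY
    simp only [mul_zero, Complex.ofReal_zero, Complex.exp_zero, mul_one] at hconst
    have hlim : Tendsto (fun Y : ℝ => ((C + k * C) * Real.exp (-(k * Y)))) atTop (𝓝 0) :=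
      tendsto_const_mul_exp_neg hk
    have h0 : ‖w₁ 0 + k * w 0‖ ≤ 0 := by
      refine ge_of_tendsto hlim ?_
      filter_upwards [eventually_ge_atTop 0] with Y hY
      rw [← hconst Y hY, norm_mul, Complex.norm_exp_ofReal, neg_mul]
      gcongr
      refine (norm_add_le _ _).trans (add_le_add (hb₁ Y hY) ?_)
      rw [norm_mul, Complex.norm_real, Real.norm_eq_abs, abs_of_pos hk]
      exact mul_le_mul_of_nonneg_left (hb Y hY) hk.le
    intro Y hY
    have h1 := hconst Y hY
    rw [norm_le_zero_iff.1 h0] at h1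
    exact (mul_eq_zero.1 h1).resolve_right (Complex.exp_ne_zero _)
  have hd : ∀ Y, 0 ≤ Y → HasDerivAt (fun Y : ℝ => w Y * Complex.exp ((k * Y : ℝ) : ℂ)) 0 Y := by
    intro Y hY
    convert! (h Y hY).mul (hasDerivAt_cexp_ofReal_mul k Y) using 1
    linear_combination -Complex.exp ((k * Y : ℝ) : ℂ) * hA Y hY
  have hconst := eq_of_hasDerivAt_zero_on_Ici hd hY
  simp only [mul_zero, Complex.ofReal_zero, Complex.exp_zero, mul_one] at hconst
  refine ⟨?_, by linear_combination hA Y hY⟩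
  rw [← hconst, mul_assoc, ← Complex.exp_add, ← Complex.ofReal_add]
  simp

/-! ### Rayleigh modes -/

section Rayleigh

variable {r c : ℝ}

lemma IsRayleighSpeed.sqrt₁_pos (hc : IsRayleighSpeed r c) : 0 < Real.sqrt (1 - c ^ 2) :=
  Real.sqrt_pos.2 (by nlinarith [hc.1, hc.2.1])

lemma IsRayleighSpeed.arg₂_pos (hr : 1 < r) (hc : IsRayleighSpeed r c) : 0 < 1 - c ^ 2 / r := by
  rw [sub_pos, div_lt_one (by linarith)]
  nlinarith [hc.1, hc.2.1]

lemma IsRayleighSpeed.sqrt₂_pos (hr : 1 < r) (hc : IsRayleighSpeed r c) :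
    0 < Real.sqrt (1 - c ^ 2 / r) :=
  Real.sqrt_pos.2 (hc.arg₂_pos hr)

lemma IsRayleighSpeed.q_pos (hr : 1 < r) (hc : IsRayleighSpeed r c) : 0 < q r c :=
  Real.sqrt_pos.2 (mul_pos hc.sqrt₁_pos (hc.sqrt₂_pos hr))

/-- The square root of the secular equation; both sides are positive, so the sign is determined. -/
lemma IsRayleighSpeed.two_q (hr : 1 < r) (hc : IsRayleighSpeed r c) : 2 - c ^ 2 = 2 * q r c := by
  have h1 := hc.q_pos hr
  have h2 : 0 < 2 - c ^ 2 := by nlinarith [hc.1, hc.2.1]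
  have h3 := hc.2.2
  nlinarith

lemma IsRayleighSpeed.ω₂_ne_zero (hr : 1 < r) (hc : IsRayleighSpeed r c) : ω₂ r c ≠ 0 := by
  have := (hc.sqrt₂_pos hr).ne'
  simp [ω₂, this]

lemma star_ω₂ : star (ω₂ r c) = -ω₂ r c := by
  simp [ω₂]

lemma ω₂_sq (hr : 1 < r) (hc : IsRayleighSpeed r c) :
    ω₂ r c ^ 2 = -((1 - c ^ 2 / r : ℝ) : ℂ) := by
  rw [ω₂, mul_pow, Complex.I_sq, ← Complex.ofReal_pow, Real.sq_sqrt (hc.arg₂_pos hr).le]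
  ring

lemma expo_I_mul (n : ℤ) (κ Y : ℝ) :
    expo n (Complex.I * κ) Y = Complex.exp ((-(n * κ) * Y : ℝ) : ℂ) := by
  unfold expo
  congr 1
  push_cast
  linear_combination (n * κ * Y : ℂ) * Complex.I_mul_I

/-- The only vector in the kernel of the Lopatinski matrix orthogonal to that kernel is zero. -/
lemma BLop_kernel_trivial (hr : 1 < r) (hc : IsRayleighSpeed r c) {σ : Fin 2 → ℂ}
    (h : star (ω₂ r c) * σ 0 - (q r c : ℂ) * σ 1 = 0) (hB : BLop r c *ᵥ σ = 0) : σ = 0 := by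
  have h0 : (2 - (c : ℂ) ^ 2) * σ 0 + 2 * ω₂ r c * σ 1 = 0 := by
    have := congrFun hB 0
    simpa [BLop, Matrix.mulVec, dotProduct, Fin.sum_univ_two] using this
  have hq : (2 - (c : ℂ) ^ 2) = 2 * (q r c : ℂ) := by exact_mod_cast hc.two_q hr
  rw [star_ω₂] at h
  rw [hq] at h0
  have hpos : (0 : ℝ) < q r c ^ 2 + (1 - c ^ 2 / r) :=
    add_pos (pow_pos (hc.q_pos hr) 2) (hc.arg₂_pos hr)
  have hne : ((q r c ^ 2 + (1 - c ^ 2 / r) : ℝ) : ℂ) ≠ 0 := by exact_mod_cast hpos.ne'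
  have hw := ω₂_sq hr hc
  -- Eliminating `σ 0` between orthogonality and the first row gives `(q² - ω₂²) σ 1 = 0`. As `ω₂`
  -- is purely imaginary, the factor is `q² + (1 - c²/r) > 0`.
  have h1 : σ 1 = 0 := by
    refine (mul_eq_zero.1 (?_ : ((q r c ^ 2 + (1 - c ^ 2 / r) : ℝ) : ℂ) * σ 1 = 0)).resolve_left hne
    push_cast at hw ⊢
    linear_combination (-(q r c : ℂ)) * h - ω₂ r c / 2 * h0 + σ 1 * hw
  have h2 : σ 0 = 0 := by
    rw [h1, mul_zero, sub_zero] at h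
    exact (mul_eq_zero.1 h).resolve_left (neg_ne_zero.2 (hc.ω₂_ne_zero hr))
  funext i
  fin_cases i
  · exact h2
  · exact h1

end Rayleigh

/-! ### Modes of decaying solutions of the homogeneous fast problem -/

lemma Lff_smooth {r c : ℝ} {V : VProf} (h : ∀ i, SmoothProf (V i)) (i : Fin 2) :
    SmoothProf (Lff r c V i) := by
  fin_cases i
  · exact (((h 0).dθ.dθ.smul _).sub ((h 1).dY.dθ.smul _)).sub (h 0).dY.dY
  · exact (((h 1).dθ.dθ.smul _).sub ((h 0).dY.dθ.smul _)).sub ((h 1).dY.dY.smul _)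

lemma InSstar.mode_bound {T : ℝ} {f : Prof} (hf : InSstar T f) (n : ℤ) {t : ℝ}
    (ht : t ∈ Set.Icc 0 T) (x y : ℝ) : ∃ C : ℝ, 0 ≤ C ∧ ∀ Y, 0 ≤ Y → ‖mode n f t x y Y‖ ≤ C := by
  obtain ⟨C, hC, h⟩ := (IsBdd.star hf).exists_bound ht x y
  exact ⟨C, hC, fun Y hY => norm_mode_le n fun θ => h θ Y hY⟩

/-- The Fourier coefficients of decaying solutions of the homogeneous fast problem are multiples of
the Rayleigh mode. -/
lemma exists_amplitude {r c T : ℝ} (hr : 1 < r) (hc : IsRayleighSpeed r c) {V : VProf}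
    (hV : ∀ i, InSstar T (V i)) (heq : ∀ i, EqInt T (Lff r c V i) 0)
    (hbd : ∀ i, EqBdy T (lf r V i) 0) {n : ℤ} (hn : 0 < n) {t : ℝ} (ht : t ∈ Set.Icc 0 T) (x : ℝ) :
    ∃ α : ℂ, ∀ Y, 0 ≤ Y → ∀ i, mode n (V i) t x 0 Y = α * rhat r c n Y i := by
  have hS : ∀ i, SmoothProf (V i) := fun i => (hV i).smooth
  have hP : ∀ i, IsPeriodic (V i) := fun i => (hV i).periodic
  have hn' : (0 : ℝ) < n := by exact_mod_cast hn
  set ι : ℂ := Complex.I * n with hι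
  have hι0 : ι ≠ 0 := mul_ne_zero Complex.I_ne_zero (by exact_mod_cast hn.ne')
  have hιsq : ι ^ 2 = -(n : ℂ) ^ 2 := by rw [hι, mul_pow, Complex.I_sq]; ring
  set u : ℝ → ℂ := mode n (V 0) t x 0 with hu
  set u₁ : ℝ → ℂ := mode n (dY (V 0)) t x 0 with hu₁
  set u₂ : ℝ → ℂ := mode n (dY (dY (V 0))) t x 0 with hu₂
  set u₃ : ℝ → ℂ := mode n (dY (dY (dY (V 0)))) t x 0 with hu₃
  set v : ℝ → ℂ := mode n (V 1) t x 0 with hv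
  set v₁ : ℝ → ℂ := mode n (dY (V 1)) t x 0 with hv₁
  set v₂ : ℝ → ℂ := mode n (dY (dY (V 1))) t x 0 with hv₂
  set v₃ : ℝ → ℂ := mode n (dY (dY (dY (V 1)))) t x 0 with hv₃
  have du : ∀ Y, HasDerivAt u (u₁ Y) Y := fun Y => hasDerivAt_mode_Y n (hS 0) t x 0 Y
  have du₁ : ∀ Y, HasDerivAt u₁ (u₂ Y) Y := fun Y => hasDerivAt_mode_Y n (hS 0).dY t x 0 Y
  have du₂ : ∀ Y, HasDerivAt u₂ (u₃ Y) Y := fun Y => hasDerivAt_mode_Y n (hS 0).dY.dY t x 0 Y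
  have dv : ∀ Y, HasDerivAt v (v₁ Y) Y := fun Y => hasDerivAt_mode_Y n (hS 1) t x 0 Y
  have dv₁ : ∀ Y, HasDerivAt v₁ (v₂ Y) Y := fun Y => hasDerivAt_mode_Y n (hS 1).dY t x 0 Y
  have dv₂ : ∀ Y, HasDerivAt v₂ (v₃ Y) Y := fun Y => hasDerivAt_mode_Y n (hS 1).dY.dY t x 0 Y
  have hdom : ∀ i, EqDom T (Lff r c V i) 0 := fun i => (heq i).eqDom (Lff_smooth hS i) .zero
  have pθ : ∀ {f : Prof}, IsPeriodic f → IsPeriodic (dθ f) := fun h => IsPeriodic.pd h 3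
  have pY : ∀ {f : Prof}, IsPeriodic f → IsPeriodic (dY f) := fun h => IsPeriodic.pd h 4
  have E1 : ∀ Y, 0 ≤ Y →
      ((c : ℂ) ^ 2 - r) * ι ^ 2 * u Y - (r - 1) * ι * v₁ Y - u₂ Y = 0 := by
    intro Y hY
    have h0 : mode n (Lff r c V 0) t x 0 Y = 0 :=
      mode_eq_zero n fun θ => hdom 0 t ht x 0 θ Y le_rfl hY
    simp only [Lff, Matrix.cons_val_zero] at h0
    rw [mode_sub n (((hS 0).dθ.dθ.smul _).sub ((hS 1).dY.dθ.smul _)) (hS 0).dY.dY,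
      mode_sub n ((hS 0).dθ.dθ.smul _) ((hS 1).dY.dθ.smul _), mode_smul, mode_smul,
      mode_dθ n (hS 0).dθ (pθ (hP 0)), mode_dθ n (hS 0) (hP 0),
      mode_dθ n (hS 1).dY (pY (hP 1))] at h0
    push_cast at h0
    linear_combination h0
  have E2 : ∀ Y, 0 ≤ Y →
      ((c : ℂ) ^ 2 - 1) * ι ^ 2 * v Y - (r - 1) * ι * u₁ Y - r * v₂ Y = 0 := by
    intro Y hY
    have h0 : mode n (Lff r c V 1) t x 0 Y = 0 :=
      mode_eq_zero n fun θ => hdom 1 t ht x 0 θ Y le_rfl hY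
    simp only [Lff, Matrix.cons_val_one, Matrix.cons_val_fin_one] at h0
    rw [mode_sub n (((hS 1).dθ.dθ.smul _).sub ((hS 0).dY.dθ.smul _)) ((hS 1).dY.dY.smul _),
      mode_sub n ((hS 1).dθ.dθ.smul _) ((hS 0).dY.dθ.smul _), mode_smul, mode_smul, mode_smul,
      mode_dθ n (hS 1).dθ (pθ (hP 1)), mode_dθ n (hS 1) (hP 1),
      mode_dθ n (hS 0).dY (pY (hP 0))] at h0
    push_cast at h0
    linear_combination h0
  -- The equations differentiated in `Y`: the second derivatives of the divergence and rotation
  -- contain third derivatives of `u` and `v`.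
  have E1' : ∀ Y, 0 ≤ Y →
      ((c : ℂ) ^ 2 - r) * ι ^ 2 * u₁ Y - (r - 1) * ι * v₂ Y - u₃ Y = 0 := fun Y hY =>
    hasDerivAt_eq_zero_of_eq_zero_on_Ici E1
      ((((du Y).const_mul _).sub ((dv₁ Y).const_mul _)).sub (du₂ Y)) hY
  have E2' : ∀ Y, 0 ≤ Y →
      ((c : ℂ) ^ 2 - 1) * ι ^ 2 * v₁ Y - (r - 1) * ι * u₂ Y - r * v₃ Y = 0 := fun Y hY =>
    hasDerivAt_eq_zero_of_eq_zero_on_Ici E2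
      ((((dv Y).const_mul _).sub ((du₁ Y).const_mul _)).sub ((dv₂ Y).const_mul _)) hY
  have hr0 : (r : ℂ) ≠ 0 := by exact_mod_cast (by linarith : r ≠ 0)
  have hc0 : (c : ℂ) ≠ 0 := by exact_mod_cast hc.1.ne'
  set κ₁ : ℝ := Real.sqrt (1 - c ^ 2) with hκ₁
  set κ₂ : ℝ := Real.sqrt (1 - c ^ 2 / r) with hκ₂
  have hκ₁pos : 0 < κ₁ := hc.sqrt₁_pos
  have hκ₂pos : 0 < κ₂ := hc.sqrt₂_pos hr
  have hκ₁sq : (κ₁ : ℂ) ^ 2 = 1 - (c : ℂ) ^ 2 := by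
    have : κ₁ ^ 2 = 1 - c ^ 2 := Real.sq_sqrt (by nlinarith [hc.1, hc.2.1])
    exact_mod_cast this
  have hκ₂sq : (r : ℂ) * (κ₂ : ℂ) ^ 2 = r - (c : ℂ) ^ 2 := by
    have h1 : κ₂ ^ 2 = 1 - c ^ 2 / r := Real.sq_sqrt (hc.arg₂_pos hr).le
    have h2 : r * κ₂ ^ 2 = r - c ^ 2 := by
      rw [h1]
      have : r ≠ 0 := by linarith
      field_simp
    exact_mod_cast h2
  obtain ⟨Cu, hCu0, hCu⟩ := (hV 0).mode_bound n ht x 0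
  obtain ⟨Cu₁, hCu₁0, hCu₁⟩ := ((hV 0).pd 4 (by decide)).mode_bound n ht x 0
  obtain ⟨Cu₂, hCu₂0, hCu₂⟩ := (((hV 0).pd 4 (by decide)).pd 4 (by decide)).mode_bound n ht x 0
  obtain ⟨Cv, hCv0, hCv⟩ := (hV 1).mode_bound n ht x 0
  obtain ⟨Cv₁, hCv₁0, hCv₁⟩ := ((hV 1).pd 4 (by decide)).mode_bound n ht x 0
  obtain ⟨Cv₂, hCv₂0, hCv₂⟩ := (((hV 1).pd 4 (by decide)).pd 4 (by decide)).mode_bound n ht x 0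
  have hιn : ‖ι‖ = n := by
    rw [hι, norm_mul, Complex.norm_I, one_mul, Complex.norm_intCast, abs_of_pos hn']
  set M : ℝ := n * (Cu + Cu₁ + Cv + Cv₁) + (Cu₁ + Cu₂ + Cv₁ + Cv₂) with hM
  have bnd : ∀ {a b : ℂ} {A B : ℝ}, ‖a‖ ≤ A → ‖b‖ ≤ B → ‖ι * a + b‖ ≤ n * A + B ∧
      ‖ι * a - b‖ ≤ n * A + B := by
    intro a b A B ha hb
    have h1 : ‖ι * a‖ ≤ n * A := by rw [norm_mul, hιn]; gcongr
    exact ⟨(norm_add_le _ _).trans (add_le_add h1 hb), (norm_sub_le _ _).trans (add_le_add h1 hb)⟩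
  -- With the rotation `w = ι v - u'` and the divergence `d = ι u + v'`, the equations read `c² ι² u
  -- = r ι d - w'` and `c² ι² v = ι w + r d'`. Differentiating and recombining them decouples `w`
  -- (decay rate `nκ₁`) from `d` (decay rate `nκ₂`).
  have W := fun (Y : ℝ) (hY : 0 ≤ Y) => eq_exp_of_bounded (w := fun Y => ι * v Y - u₁ Y)
    (w₁ := fun Y => ι * v₁ Y - u₂ Y) (k := n * κ₁) (C := M) (by positivity)
    (fun Y _ => ((dv Y).const_mul ι).sub (du₁ Y))
    (fun Y hY => by
      convert! ((dv₁ Y).const_mul ι).sub (du₂ Y) using 1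
      push_cast
      linear_combination -E1' Y hY + ι * E2 Y hY + n ^ 2 * (ι * v Y - u₁ Y) * hκ₁sq
        + (1 - (c : ℂ) ^ 2) * (ι * v Y - u₁ Y) * hιsq)
    (fun Y hY => ((bnd (hCv Y hY) (hCu₁ Y hY)).2).trans (by
      have : (0 : ℝ) ≤ n * (Cu + Cu₁ + Cv₁) := by positivity
      rw [hM]; nlinarith))
    (fun Y hY => ((bnd (hCv₁ Y hY) (hCu₂ Y hY)).2).trans (by
      have : (0 : ℝ) ≤ n * (Cu + Cu₁ + Cv) := by positivity
      rw [hM]; nlinarith)) hY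
  have D := fun (Y : ℝ) (hY : 0 ≤ Y) => eq_exp_of_bounded (w := fun Y => ι * u Y + v₁ Y)
    (w₁ := fun Y => ι * u₁ Y + v₂ Y) (k := n * κ₂) (C := M) (by positivity)
    (fun Y _ => ((du Y).const_mul ι).add (dv₁ Y))
    (fun Y hY => by
      convert! ((du₁ Y).const_mul ι).add (dv₂ Y) using 1
      refine mul_left_cancel₀ hr0 ?_
      push_cast
      linear_combination E2' Y hY + ι * E1 Y hY + n ^ 2 * (ι * u Y + v₁ Y) * hκ₂sq
        + (r - (c : ℂ) ^ 2) * (ι * u Y + v₁ Y) * hιsq)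
    (fun Y hY => ((bnd (hCu Y hY) (hCv₁ Y hY)).1).trans (by
      have : (0 : ℝ) ≤ n * (Cu₁ + Cv + Cv₁) := by positivity
      rw [hM]; nlinarith))
    (fun Y hY => ((bnd (hCu₁ Y hY) (hCv₂ Y hY)).1).trans (by
      have : (0 : ℝ) ≤ n * (Cu + Cv + Cv₁) := by positivity
      rw [hM]; nlinarith)) hY
  -- The first traction condition suffices: `w(0)` and `d(0)` are the only free constants, so one
  -- nontrivial relation leaves a line.
  have hB : ι * v 0 + u₁ 0 = 0 := by
    have h0 : mode n (lf r V 0) t x 0 0 = 0 := mode_eq_zero n fun θ => hbd 0 t ht x θ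
    simp only [lf, Matrix.cons_val_zero] at h0
    rw [mode_add n (hS 1).dθ (hS 0).dY, mode_dθ n (hS 1) (hP 1)] at h0
    exact h0
  have hw₁ : ω₁ c = Complex.I * κ₁ := rfl
  have hw₂ : ω₂ r c = Complex.I * κ₂ := rfl
  have hw₂0 : ω₂ r c ≠ 0 := hc.ω₂_ne_zero hr
  have hq : (2 - (c : ℂ) ^ 2) = 2 * (q r c : ℂ) := by exact_mod_cast hc.two_q hr
  set w0 : ℂ := ι * v 0 - u₁ 0 with hw0
  set d0 : ℂ := ι * u 0 + v₁ 0 with hd0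
  have k₁ : ((n * κ₁ : ℝ) : ℂ) = -(ι * ω₁ c) := by
    rw [hw₁, hι]; push_cast; linear_combination ((n : ℂ) * κ₁) * Complex.I_mul_I
  have k₂ : ((n * κ₂ : ℝ) : ℂ) = -(ι * ω₂ r c) := by
    rw [hw₂, hι]; push_cast; linear_combination ((n : ℂ) * κ₂) * Complex.I_mul_I
  have rel : (q r c : ℂ) * w0 = -(r * ω₂ r c) * d0 := by
    have h1 := (D 0 le_rfl).2
    rw [k₂] at h1
    have h2 := E2 0 le_rfl
    -- By the boundary condition `w(0) = 2 ι v(0)`, and `d' = ι ω₂ d`. Inserting both in the second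
    -- equation at `Y = 0` gives `(c² - 2) w(0) = 2 r ω₂ d(0)`, and `2 - c² = 2q`.
    have h3 : ι * (2 * (q r c : ℂ) * w0 + 2 * (r * ω₂ r c) * d0) = 0 := by
      rw [← hq]
      linear_combination -2 * h2 - 2 * r * h1 + (c : ℂ) ^ 2 * ι * hB
    have h4 := (mul_eq_zero.1 h3).resolve_left hι0
    linear_combination h4 / 2
  -- The witness is read off from `rhat`: since `1 + ω₁² = c²`, its rotation at `Y = 0` is `ω₂ ι
  -- c²`. Its divergence there is `-q ι c² / r`, in accordance with `rel`.
  refine ⟨w0 / (ω₂ r c * ι * (c : ℂ) ^ 2), fun Y hY => ?_⟩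
  set α := w0 / (ω₂ r c * ι * (c : ℂ) ^ 2) with hα
  have hw0α : w0 = α * (ω₂ r c * ι * (c : ℂ) ^ 2) := by
    rw [hα, div_mul_cancel₀ _ (mul_ne_zero (mul_ne_zero hw₂0 hι0) (pow_ne_zero 2 hc0))]
  have hd0α : r * d0 = -((q r c : ℂ) * α * ι * (c : ℂ) ^ 2) := by
    refine mul_left_cancel₀ hw₂0 ?_
    linear_combination rel - (q r c : ℂ) * hw0α
  clear_value α
  have hW := W Y hY
  have hD := D Y hY
  have e₁ : expo n (ω₁ c) Y = Complex.exp ((-(n * κ₁) * Y : ℝ) : ℂ) := by rw [hw₁, expo_I_mul]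
  have e₂ : expo n (ω₂ r c) Y = Complex.exp ((-(n * κ₂) * Y : ℝ) : ℂ) := by rw [hw₂, expo_I_mul]
  rw [← e₁, k₁] at hW
  rw [← e₂, k₂] at hD
  have hrhat : ∀ i, rhat r c n Y i = ω₂ r c * expo n (ω₁ c) Y * r₁ c i
      - q r c * expo n (ω₂ r c) Y * r₂ r c i := by
    intro i
    simp [rhat, hn]
  -- The displacement is recovered algebraically from `c² ι² u = r ι d - w'` and `c² ι² v = ι w + r
  -- d'`, after cancelling this factor.
  have hne : (c : ℂ) ^ 2 * ι ^ 2 ≠ 0 := mul_ne_zero (pow_ne_zero 2 hc0) (pow_ne_zero 2 hι0)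
  intro i
  rw [hrhat]
  fin_cases i
  · refine mul_left_cancel₀ hne ?_
    simp only [r₁, r₂, Fin.zero_eta, Matrix.cons_val_zero]
    change (c : ℂ) ^ 2 * ι ^ 2 * u Y = _
    linear_combination E1 Y hY - hW.2 - ι * ω₁ c * hW.1 + r * ι * hD.1
      - ι * ω₁ c * expo n (ω₁ c) Y * hw0α + ι * expo n (ω₂ r c) Y * hd0α
  · refine mul_left_cancel₀ hne ?_
    simp only [r₁, r₂, Fin.mk_one, Matrix.cons_val_one, Matrix.cons_val_fin_one]
    change (c : ℂ) ^ 2 * ι ^ 2 * v Y = _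
    linear_combination E2 Y hY + r * hD.2 + ι * hW.1 + r * ι * ω₂ r c * hD.1
      + ι * expo n (ω₁ c) Y * hw0α + ι * ω₂ r c * expo n (ω₂ r c) Y * hd0α

/-! ### Energy estimate on the half plane -/

lemma continuous_integral_snd {X : Type*} [TopologicalSpace X] {g : X → ℝ → ℝ}
    (hg : Continuous fun p : X × ℝ => g p.1 p.2) (a b : ℝ) :
    Continuous fun x => ∫ y in a..b, g x y :=
  intervalIntegral.continuous_parametric_intervalIntegral_of_continuous' hg a b

/-- Localized energy identity: the balance law `∂ₜ e = ∂ₓ F₁ + ∂_y F₂` tested with the product weight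
`a(x) b(y)` on the box `[-R, R] × [0, R]`, where `a` vanishes at `± R` and `b` at `R`. -/
lemma weighted_energy_identity {T : ℝ} {e e' F₁ F₁' F₂ F₂' : ℝ → ℝ → ℝ → ℝ}
    (he : Continuous fun p : ℝ × ℝ × ℝ => e p.1 p.2.1 p.2.2)
    (he' : Continuous fun p : ℝ × ℝ × ℝ => e' p.1 p.2.1 p.2.2)
    (hF₁ : Continuous fun p : ℝ × ℝ × ℝ => F₁ p.1 p.2.1 p.2.2)
    (hF₁' : Continuous fun p : ℝ × ℝ × ℝ => F₁' p.1 p.2.1 p.2.2)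
    (hF₂ : Continuous fun p : ℝ × ℝ × ℝ => F₂ p.1 p.2.1 p.2.2)
    (hF₂' : Continuous fun p : ℝ × ℝ × ℝ => F₂' p.1 p.2.1 p.2.2)
    (de : ∀ t x y, HasDerivAt (fun s => e s x y) (e' t x y) t)
    (dF₁ : ∀ t x y, HasDerivAt (fun s => F₁ t s y) (F₁' t x y) x)
    (dF₂ : ∀ t x y, HasDerivAt (fun s => F₂ t x s) (F₂' t x y) y)
    (hbal : ∀ t ∈ Set.Icc 0 T, ∀ x y, 0 ≤ y → e' t x y = F₁' t x y + F₂' t x y)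
    (hbd : ∀ t ∈ Set.Icc 0 T, ∀ x, F₂ t x 0 = 0)
    (h0 : ∀ x y, 0 ≤ y → e 0 x y = 0)
    {a a' b b' : ℝ → ℝ} (ha : ∀ x, HasDerivAt a (a' x) x) (hb : ∀ x, HasDerivAt b (b' x) x)
    (ha' : Continuous a') (hb' : Continuous b') {R : ℝ} (hR : 0 ≤ R)
    (haR : a R = 0) (haR' : a (-R) = 0) (hbR : b R = 0) {t : ℝ} (ht : t ∈ Set.Icc 0 T) :
    ∫ x in (-R)..R, ∫ y in (0 : ℝ)..R, a x * b y * e t x y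
      = -∫ s in (0 : ℝ)..t, ∫ x in (-R)..R, ∫ y in (0 : ℝ)..R,
          (a' x * b y * F₁ s x y + a x * b' y * F₂ s x y) := by
  have hac : Continuous a := continuous_iff_continuousAt.2 fun x => (ha x).continuousAt
  have hbc : Continuous b := continuous_iff_continuousAt.2 fun x => (hb x).continuousAt
  have c3 : ∀ {k : ℝ → ℝ → ℝ → ℝ}, (Continuous fun p : ℝ × ℝ × ℝ => k p.1 p.2.1 p.2.2) →
      Continuous fun p : (ℝ × ℝ) × ℝ => k p.1.1 p.1.2 p.2 := fun hk =>
    hk.comp (by fun_prop : Continuous fun p : (ℝ × ℝ) × ℝ => (p.1.1, p.1.2, p.2))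
  have c2 : ∀ {k : ℝ → ℝ → ℝ → ℝ}, (Continuous fun p : ℝ × ℝ × ℝ => k p.1 p.2.1 p.2.2) →
      ∀ s, Continuous fun p : ℝ × ℝ => k s p.1 p.2 := fun hk s =>
    hk.comp (by fun_prop : Continuous fun p : ℝ × ℝ => (s, p.1, p.2))
  have c1 : ∀ {k : ℝ → ℝ → ℝ → ℝ}, (Continuous fun p : ℝ × ℝ × ℝ => k p.1 p.2.1 p.2.2) →
      ∀ s x, Continuous fun y => k s x y := fun hk s x =>
    hk.comp (by fun_prop : Continuous fun y : ℝ => (s, x, y))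
  have w1 : Continuous fun p : ℝ × ℝ × ℝ => a p.2.1 * b p.2.2 * e p.1 p.2.1 p.2.2 := by fun_prop
  have w2 : Continuous fun p : ℝ × ℝ × ℝ => a p.2.1 * b p.2.2 * e' p.1 p.2.1 p.2.2 := by fun_prop
  have w3 : Continuous fun p : ℝ × ℝ × ℝ => a' p.2.1 * b p.2.2 * F₁ p.1 p.2.1 p.2.2
    + a p.2.1 * b' p.2.2 * F₂ p.1 p.2.1 p.2.2 := by fun_prop
  -- The weighted energy is differentiated under both integrals. It starts from zero, so it is the
  -- time integral of this derivative, and the identity can be checked at each time separately.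
  have hE : ∀ s, HasDerivAt (fun s => ∫ x in (-R)..R, ∫ y in (0 : ℝ)..R, a x * b y * e s x y)
      (∫ x in (-R)..R, ∫ y in (0 : ℝ)..R, a x * b y * e' s x y) s := by
    intro s
    refine hasDerivAt_intervalIntegral_of_continuous
      (F := fun s x => ∫ y in (0 : ℝ)..R, a x * b y * e s x y)
      (F' := fun s x => ∫ y in (0 : ℝ)..R, a x * b y * e' s x y)
      (continuous_integral_snd (X := ℝ × ℝ) (g := fun p y => a p.2 * b y * e p.1 p.2 y)
        (c3 (k := fun s x y => a x * b y * e s x y) w1) 0 R)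
      (continuous_integral_snd (X := ℝ × ℝ) (g := fun p y => a p.2 * b y * e' p.1 p.2 y)
        (c3 (k := fun s x y => a x * b y * e' s x y) w2) 0 R) (fun s x => ?_) _ _ _
    refine hasDerivAt_intervalIntegral_of_continuous (F := fun s y => a x * b y * e s x y)
      (F' := fun s y => a x * b y * e' s x y) ?_ ?_ (fun s y => (de s x y).const_mul _) _ _ _
    · exact w1.comp (by fun_prop : Continuous fun p : ℝ × ℝ => (p.1, x, p.2))
    · exact w2.comp (by fun_prop : Continuous fun p : ℝ × ℝ => (p.1, x, p.2))
  have hEc : Continuous fun s => ∫ x in (-R)..R, ∫ y in (0 : ℝ)..R, a x * b y * e' s x y :=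
    continuous_integral_snd (continuous_integral_snd (X := ℝ × ℝ)
      (g := fun p y => a p.2 * b y * e' p.1 p.2 y)
        (c3 (k := fun s x y => a x * b y * e' s x y) w2) 0 R) _ _
  have hE0 : ∫ x in (-R)..R, ∫ y in (0 : ℝ)..R, a x * b y * e 0 x y = 0 := by
    have h : ∀ x, ∫ y in (0 : ℝ)..R, a x * b y * e 0 x y = 0 := fun x => by
      refine (intervalIntegral.integral_congr fun y hy => ?_).trans
        (intervalIntegral.integral_zero (E := ℝ) (a := 0) (b := R))
      rw [Set.uIcc_of_le hR] at hy
      simp only [h0 x y hy.1, mul_zero]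
    simp only [h, intervalIntegral.integral_zero]
  have hFTC := intervalIntegral.integral_eq_sub_of_hasDerivAt (a := 0) (b := t)
    (fun s _ => hE s) (hEc.intervalIntegrable _ _)
  rw [hE0, sub_zero] at hFTC
  rw [← hFTC, ← intervalIntegral.integral_neg]
  refine intervalIntegral.integral_congr fun s hs => ?_
  rw [Set.uIcc_of_le ht.1] at hs
  have hsT : s ∈ Set.Icc 0 T := ⟨hs.1, hs.2.trans ht.2⟩
  change (∫ x in (-R)..R, ∫ y in (0 : ℝ)..R, a x * b y * e' s x y)
    = -∫ x in (-R)..R, ∫ y in (0 : ℝ)..R, (a' x * b y * F₁ s x y + a x * b' y * F₂ s x y)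
  rw [← add_eq_zero_iff_eq_neg, ← intervalIntegral.integral_add
    ((continuous_integral_snd (c2 (k := fun s x y => a x * b y * e' s x y) w2 s)
      0 R).intervalIntegrable _ _)
    ((continuous_integral_snd (c2 (k := fun s x y => a' x * b y * F₁ s x y + a x * b' y * F₂ s x y)
      w3 s) 0 R).intervalIntegrable _ _)]
  have w4 : Continuous fun p : ℝ × ℝ × ℝ =>
      (a' p.2.1 * F₁ p.1 p.2.1 p.2.2 + a p.2.1 * F₁' p.1 p.2.1 p.2.2) * b p.2.2 := by fun_prop
  have w5 : Continuous fun p : ℝ × ℝ × ℝ =>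
      a p.2.1 * (b' p.2.2 * F₂ p.1 p.2.1 p.2.2 + b p.2.2 * F₂' p.1 p.2.1 p.2.2) := by fun_prop
  -- After the balance law is inserted, the integrand is `∂ₓ(a F₁) b + a ∂_y(b F₂)`, a sum of exact
  -- derivatives with vanishing boundary values: `a(±R) = 0`, `b(R) = 0`, and `F₂ = 0` at `y = 0`.
  have hsplit : ∀ x, (∫ y in (0 : ℝ)..R, a x * b y * e' s x y)
      + ∫ y in (0 : ℝ)..R, (a' x * b y * F₁ s x y + a x * b' y * F₂ s x y)
      = (∫ y in (0 : ℝ)..R, (a' x * F₁ s x y + a x * F₁' s x y) * b y)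
        + ∫ y in (0 : ℝ)..R, a x * (b' y * F₂ s x y + b y * F₂' s x y) := by
    intro x
    rw [← intervalIntegral.integral_add
      ((c1 (k := fun s x y => a x * b y * e' s x y) w2 s x).intervalIntegrable _ _)
      ((c1 (k := fun s x y => a' x * b y * F₁ s x y + a x * b' y * F₂ s x y)
        w3 s x).intervalIntegrable _ _),
      ← intervalIntegral.integral_add
      ((c1 (k := fun s x y => (a' x * F₁ s x y + a x * F₁' s x y) * b y) w4 s x).intervalIntegrable
        _ _)
      ((c1 (k := fun s x y => a x * (b' y * F₂ s x y + b y * F₂' s x y))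
        w5 s x).intervalIntegrable _ _)]
    refine intervalIntegral.integral_congr fun y hy => ?_
    rw [Set.uIcc_of_le hR] at hy
    simp only [hbal s hsT x y hy.1]
    ring
  have hz2 : ∀ x, ∫ y in (0 : ℝ)..R, a x * (b' y * F₂ s x y + b y * F₂' s x y) = 0 := by
    intro x
    rw [intervalIntegral.integral_const_mul, intervalIntegral.integral_eq_sub_of_hasDerivAt
      (f := fun y => b y * F₂ s x y) (fun y _ => (hb y).mul (dF₂ s x y))
      (((hb'.mul (c1 hF₂ s x)).add (hbc.mul (c1 hF₂' s x))).intervalIntegrable _ _), hbR,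
      hbd s hsT x]
    ring
  have hz1 : ∀ y, ∫ x in (-R)..R, (a' x * F₁ s x y + a x * F₁' s x y) * b y = 0 := by
    intro y
    have k1 : Continuous fun x => F₁ s x y :=
      hF₁.comp (by fun_prop : Continuous fun x : ℝ => (s, x, y))
    have k2 : Continuous fun x => F₁' s x y :=
      hF₁'.comp (by fun_prop : Continuous fun x : ℝ => (s, x, y))
    rw [intervalIntegral.integral_mul_const, intervalIntegral.integral_eq_sub_of_hasDerivAt
      (f := fun x => a x * F₁ s x y) (fun x _ => (ha x).mul (dF₁ s x y))
      (((ha'.mul k1).add (hac.mul k2)).intervalIntegrable _ _), haR, haR']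
    ring
  -- The remaining term is exact in `x`, which is the outer variable, so the order of integration
  -- has to be exchanged.
  simp only [hsplit, hz2, add_zero]
  rw [intervalIntegral.integral_of_le (by linarith)]
  simp only [intervalIntegral.integral_of_le hR]
  rw [integral_integral_swap]
  · simp only [← intervalIntegral.integral_of_le (show -R ≤ R by linarith), hz1, integral_zero]
  · rw [Measure.prod_restrict]
    exact ((c2 (k := fun s x y => (a' x * F₁ s x y + a x * F₁' s x y) * b y) w4
      s).continuousOn.integrableOn_compact (isCompact_Icc.prod isCompact_Icc)).mono_set
      (Set.prod_mono (Set.Ioc_subset_Icc_self (a := -R) (b := R))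
        (Set.Ioc_subset_Icc_self (a := 0) (b := R)))

/-- Bounds the flux over a growing box by a quantity independent of `R`, which the factor `2 / R`
from the weight then sends to zero. -/
lemma iterated_integral_le {T R t : ℝ} (hR : 0 ≤ R) (ht : t ∈ Set.Icc 0 T)
    {g G : ℝ × ℝ × ℝ → ℝ} (hg : Continuous g) (hgG : ∀ p, g p ≤ G p) (hG0 : ∀ p, 0 ≤ G p)
    (hG : IntegrableOn G (Set.Icc 0 T ×ˢ (Set.univ : Set ℝ) ×ˢ Set.Ici (0 : ℝ))) :
    ∫ s in (0 : ℝ)..t, ∫ x in (-R)..R, ∫ y in (0 : ℝ)..R, g (s, x, y)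
      ≤ ∫ p in Set.Icc 0 T ×ˢ (Set.univ : Set ℝ) ×ˢ Set.Ici (0 : ℝ), G p := by
  have hsub : Set.Ioc 0 t ×ˢ Set.Ioc (-R) R ×ˢ Set.Ioc 0 R
      ⊆ Set.Icc 0 T ×ˢ (Set.univ : Set ℝ) ×ˢ Set.Ici (0 : ℝ) :=
    Set.prod_mono (fun s hs => ⟨hs.1.le, hs.2.trans ht.2⟩)
      (Set.prod_mono (Set.subset_univ _) fun y hy => hy.1.le)
  have hint : ∀ s, IntegrableOn (fun p : ℝ × ℝ => g (s, p)) (Set.Ioc (-R) R ×ˢ Set.Ioc 0 R)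
      (volume.prod volume) := fun s =>
    ((hg.comp (Continuous.prodMk_right s)).continuousOn.integrableOn_compact
      (isCompact_Icc.prod isCompact_Icc)).mono_set
      (Set.prod_mono (Set.Ioc_subset_Icc_self (a := -R) (b := R))
        (Set.Ioc_subset_Icc_self (a := 0) (b := R)))
  have hint3 : IntegrableOn g (Set.Ioc 0 t ×ˢ Set.Ioc (-R) R ×ˢ Set.Ioc 0 R)
      (volume.prod volume) :=
    (hg.continuousOn.integrableOn_compact
      (isCompact_Icc.prod (isCompact_Icc.prod isCompact_Icc))).mono_set
      (Set.prod_mono (Set.Ioc_subset_Icc_self (a := 0) (b := t))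
        (Set.prod_mono (Set.Ioc_subset_Icc_self (a := -R) (b := R))
        (Set.Ioc_subset_Icc_self (a := 0) (b := R))))
  have h1 : ∫ s in (0 : ℝ)..t, ∫ x in (-R)..R, ∫ y in (0 : ℝ)..R, g (s, x, y)
      = ∫ p in Set.Ioc 0 t ×ˢ Set.Ioc (-R) R ×ˢ Set.Ioc 0 R, g p := by
    rw [Measure.volume_eq_prod, setIntegral_prod _ hint3, intervalIntegral.integral_of_le ht.1]
    congr 1
    funext s
    rw [Measure.volume_eq_prod, setIntegral_prod _ (hint s),
      intervalIntegral.integral_of_le (by linarith)]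
    simp only [intervalIntegral.integral_of_le hR]
  rw [h1]
  refine (setIntegral_mono hint3 (hG.mono_set hsub) hgG).trans ?_
  exact setIntegral_mono_set hG (Eventually.of_forall hG0) hsub.eventuallyLE

/-- A nonnegative energy density with integrable flux that vanishes initially vanishes. -/
lemma energy_density_eq_zero {T : ℝ} {e e' F₁ F₁' F₂ F₂' : ℝ → ℝ → ℝ → ℝ}
    (he : Continuous fun p : ℝ × ℝ × ℝ => e p.1 p.2.1 p.2.2)
    (he' : Continuous fun p : ℝ × ℝ × ℝ => e' p.1 p.2.1 p.2.2)
    (hF₁ : Continuous fun p : ℝ × ℝ × ℝ => F₁ p.1 p.2.1 p.2.2)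
    (hF₁' : Continuous fun p : ℝ × ℝ × ℝ => F₁' p.1 p.2.1 p.2.2)
    (hF₂ : Continuous fun p : ℝ × ℝ × ℝ => F₂ p.1 p.2.1 p.2.2)
    (hF₂' : Continuous fun p : ℝ × ℝ × ℝ => F₂' p.1 p.2.1 p.2.2)
    (de : ∀ t x y, HasDerivAt (fun s => e s x y) (e' t x y) t)
    (dF₁ : ∀ t x y, HasDerivAt (fun s => F₁ t s y) (F₁' t x y) x)
    (dF₂ : ∀ t x y, HasDerivAt (fun s => F₂ t x s) (F₂' t x y) y)
    (hbal : ∀ t ∈ Set.Icc 0 T, ∀ x y, 0 ≤ y → e' t x y = F₁' t x y + F₂' t x y)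
    (hbd : ∀ t ∈ Set.Icc 0 T, ∀ x, F₂ t x 0 = 0)
    (h0 : ∀ x y, 0 ≤ y → e 0 x y = 0) (hnonneg : ∀ t x y, 0 ≤ e t x y)
    {G : ℝ × ℝ × ℝ → ℝ}
    (hG : IntegrableOn G (Set.Icc 0 T ×ˢ (Set.univ : Set ℝ) ×ˢ Set.Ici (0 : ℝ)))
    (hFG : ∀ t x y, |F₁ t x y| + |F₂ t x y| ≤ G (t, x, y))
    {t : ℝ} (ht : t ∈ Set.Icc 0 T) (x : ℝ) {y : ℝ} (hy : 0 ≤ y) : e t x y = 0 := by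
  by_contra hne
  have hpos : 0 < e t x y := lt_of_le_of_ne (hnonneg t x y) (Ne.symm hne)
  set ρ : ℝ := |x| + y + 1 with hρ
  have hρ0 : 0 < ρ := by positivity
  have hec : Continuous fun p : ℝ × ℝ => e t p.1 p.2 :=
    he.comp (by fun_prop : Continuous fun p : ℝ × ℝ => (t, p.1, p.2))
  have hec1 : ∀ x, Continuous fun y => e t x y := fun x =>
    he.comp (by fun_prop : Continuous fun y : ℝ => (t, x, y))
  have hI : 0 < ∫ x in (-ρ)..ρ, ∫ y in (0 : ℝ)..ρ, e t x y := by
    refine intervalIntegral.integral_pos (by linarith)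
      (continuous_integral_snd hec 0 ρ).continuousOn
      (fun x _ => intervalIntegral.integral_nonneg hρ0.le fun y _ => hnonneg t x y) ⟨x, ?_, ?_⟩
    · have h1 := neg_abs_le x
      have h2 := le_abs_self x
      constructor <;> linarith
    · refine intervalIntegral.integral_pos hρ0 (hec1 x).continuousOn (fun y _ => hnonneg t x y)
        ⟨y, ⟨hy, ?_⟩, hpos⟩
      have := abs_nonneg x
      linarith
  set I := ∫ x in (-ρ)..ρ, ∫ y in (0 : ℝ)..ρ, e t x y with hIdef
  set M := ∫ p in Set.Icc 0 T ×ˢ (Set.univ : Set ℝ) ×ˢ Set.Ici (0 : ℝ), G p with hM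
  have hG0 : ∀ p, 0 ≤ G p := fun p => le_trans (by positivity) (hFG p.1 p.2.1 p.2.2)
  -- The weights are `1 - x²/R²` and `1 - y²/R²`. For `R ≥ 2ρ` each is at least `3/4` on the inner
  -- box, whence `9/16`; on the large box their slopes are at most `2/R`. The flux is integrable, so
  -- `R → ∞` forces `I ≤ 0`, against `hI`.
  have key : ∀ R, 2 * ρ ≤ R → (9 / 16) * I ≤ 2 / R * M := by
    intro R hRρ
    have hR : 0 < R := by linarith
    have hw : ∀ x, HasDerivAt (fun x : ℝ => 1 - x ^ 2 / R ^ 2) (-(2 * x / R ^ 2)) x := by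
      intro x
      have := (((hasDerivAt_id x).pow 2).div_const (R ^ 2)).const_sub 1
      simpa using this
    have hwc : Continuous fun x : ℝ => -(2 * x / R ^ 2) := by fun_prop
    have hid := weighted_energy_identity he he' hF₁ hF₁' hF₂ hF₂' de dF₁ dF₂ hbal hbd h0 hw hw hwc
      hwc hR.le (by simp [hR.ne']) (by simp [hR.ne']) (by simp [hR.ne']) ht
    have hR2 : 0 < R ^ 2 := by positivity
    have hwle : ∀ x, |x| ≤ R → 0 ≤ 1 - x ^ 2 / R ^ 2 ∧ 1 - x ^ 2 / R ^ 2 ≤ 1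
        ∧ |-(2 * x / R ^ 2)| ≤ 2 / R := by
      intro x hx
      have h1 : x ^ 2 ≤ R ^ 2 := by
        rw [← sq_abs]; exact pow_le_pow_left₀ (abs_nonneg _) hx 2
      refine ⟨sub_nonneg.2 ((div_le_one hR2).2 h1), by
        have : 0 ≤ x ^ 2 / R ^ 2 := by positivity
        linarith, ?_⟩
      rw [abs_neg, abs_div, abs_mul, abs_two, abs_of_pos hR2, div_le_div_iff₀ hR2 hR]
      nlinarith
    have hlow : (9 / 16) * I ≤ ∫ x in (-R)..R, ∫ y in (0 : ℝ)..R,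
        (1 - x ^ 2 / R ^ 2) * (1 - y ^ 2 / R ^ 2) * e t x y := by
      have kc : Continuous fun p : ℝ × ℝ =>
          (1 - p.1 ^ 2 / R ^ 2) * (1 - p.2 ^ 2 / R ^ 2) * e t p.1 p.2 := by fun_prop
      have kc1 : ∀ x, Continuous fun y : ℝ =>
          (1 - x ^ 2 / R ^ 2) * (1 - y ^ 2 / R ^ 2) * e t x y := fun x =>
        kc.comp (Continuous.prodMk_right x)
      have hnn : ∀ x ∈ Set.Icc (-R) R, ∀ y ∈ Set.Icc 0 R,
          0 ≤ (1 - x ^ 2 / R ^ 2) * (1 - y ^ 2 / R ^ 2) * e t x y := by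
        intro x hx y hy
        exact mul_nonneg (mul_nonneg (hwle x (abs_le.2 hx)).1
          (hwle y (abs_le.2 ⟨by linarith [hy.1], hy.2⟩)).1) (hnonneg t x y)
      have h34 : ∀ x, |x| ≤ ρ → 3 / 4 ≤ 1 - x ^ 2 / R ^ 2 := by
        intro x hx
        have h1 : x ^ 2 ≤ ρ ^ 2 := by
          rw [← sq_abs]; exact pow_le_pow_left₀ (abs_nonneg _) hx 2
        have h2 : x ^ 2 / R ^ 2 ≤ 1 / 4 := by
          rw [div_le_div_iff₀ hR2 (by norm_num)]
          nlinarith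
        linarith
      calc (9 / 16) * I = ∫ x in (-ρ)..ρ, ∫ y in (0 : ℝ)..ρ, (9 / 16) * e t x y := by
            simp only [intervalIntegral.integral_const_mul, hIdef]
        _ ≤ ∫ x in (-ρ)..ρ, ∫ y in (0 : ℝ)..R,
            (1 - x ^ 2 / R ^ 2) * (1 - y ^ 2 / R ^ 2) * e t x y := by
          refine intervalIntegral.integral_mono_on (by linarith)
            ((continuous_integral_snd (hec.const_mul (9 / 16)) 0 ρ).intervalIntegrable _ _)
            ((continuous_integral_snd kc 0 R).intervalIntegrable _ _) fun x hx => ?_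
          have hx' : x ∈ Set.Icc (-R) R := ⟨by linarith [hx.1], by linarith [hx.2]⟩
          refine (intervalIntegral.integral_mono_on hρ0.le
            (((hec1 x).const_mul (9 / 16)).intervalIntegrable _ _)
            ((kc1 x).intervalIntegrable _ _) fun y hy => ?_).trans
            (intervalIntegral.integral_mono_interval le_rfl hρ0.le (by linarith)
              ((ae_restrict_mem measurableSet_Ioc).mono fun y hy => hnn x hx' y ⟨hy.1.le, hy.2⟩)
              ((kc1 x).intervalIntegrable _ _))
          refine mul_le_mul_of_nonneg_right ?_ (hnonneg t x y)
          have h1 := h34 x (abs_le.2 hx)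
          have h2 := h34 y (abs_le.2 ⟨by linarith [hy.1], hy.2⟩)
          nlinarith
        _ ≤ _ := by
          refine intervalIntegral.integral_mono_interval (by linarith) (by linarith) (by linarith)
            ((ae_restrict_mem measurableSet_Ioc).mono fun x hx => ?_)
            ((continuous_integral_snd kc 0 R).intervalIntegrable _ _)
          exact intervalIntegral.integral_nonneg hR.le fun y hy => hnn x ⟨hx.1.le, hx.2⟩ y hy
    refine hlow.trans ?_
    rw [hid]
    have gc : Continuous fun p : ℝ × ℝ × ℝ => |F₁ p.1 p.2.1 p.2.2| + |F₂ p.1 p.2.1 p.2.2| := by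
      fun_prop
    have hup := iterated_integral_le hR.le ht gc (fun p => hFG p.1 p.2.1 p.2.2) hG0 hG
    refine le_trans ?_ (mul_le_mul_of_nonneg_left hup (by positivity : 0 ≤ 2 / R))
    rw [← intervalIntegral.integral_neg, ← intervalIntegral.integral_const_mul]
    have lc : Continuous fun p : ℝ × ℝ × ℝ =>
        -(2 * p.2.1 / R ^ 2) * (1 - p.2.2 ^ 2 / R ^ 2) * F₁ p.1 p.2.1 p.2.2
        + (1 - p.2.1 ^ 2 / R ^ 2) * -(2 * p.2.2 / R ^ 2) * F₂ p.1 p.2.1 p.2.2 := by fun_prop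
    have c3 : ∀ {k : ℝ × ℝ × ℝ → ℝ}, Continuous k →
        Continuous fun p : (ℝ × ℝ) × ℝ => k (p.1.1, p.1.2, p.2) := fun hk =>
      hk.comp (by fun_prop)
    have c2 : ∀ {k : ℝ × ℝ × ℝ → ℝ}, Continuous k → ∀ s,
        Continuous fun p : ℝ × ℝ => k (s, p.1, p.2) := fun hk s => hk.comp (by fun_prop)
    have c1 : ∀ {k : ℝ × ℝ × ℝ → ℝ}, Continuous k → ∀ s x,
        Continuous fun y : ℝ => k (s, x, y) := fun hk s x => hk.comp (by fun_prop)
    have i3 : ∀ {k : ℝ × ℝ × ℝ → ℝ}, Continuous k → Continuous fun s : ℝ =>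
        ∫ x in (-R)..R, ∫ y in (0 : ℝ)..R, k (s, x, y) := fun hk =>
      continuous_integral_snd (continuous_integral_snd (X := ℝ × ℝ) (c3 hk) _ _) _ _
    have i2 : ∀ {k : ℝ × ℝ × ℝ → ℝ}, Continuous k → ∀ s, Continuous fun x : ℝ =>
        ∫ y in (0 : ℝ)..R, k (s, x, y) := fun hk s => continuous_integral_snd (c2 hk s) _ _
    refine intervalIntegral.integral_mono_on ht.1 ((i3 lc).neg.intervalIntegrable _ _)
      (((i3 gc).const_mul _).intervalIntegrable _ _) fun s _ => ?_
    rw [← intervalIntegral.integral_neg, ← intervalIntegral.integral_const_mul]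
    refine intervalIntegral.integral_mono_on (by linarith) ((i2 lc s).neg.intervalIntegrable _ _)
      (((i2 gc s).const_mul _).intervalIntegrable _ _) fun x hx => ?_
    rw [← intervalIntegral.integral_neg, ← intervalIntegral.integral_const_mul]
    refine intervalIntegral.integral_mono_on hR.le ((c1 lc s x).neg.intervalIntegrable _ _)
      (((c1 gc s x).const_mul _).intervalIntegrable _ _) fun y hy => ?_
    obtain ⟨ax0, ax1, axd⟩ := hwle x (abs_le.2 hx)
    obtain ⟨by0, by1, byd⟩ := hwle y (abs_le.2 ⟨by linarith [hy.1], hy.2⟩)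
    refine (neg_le_abs _).trans ((abs_add_le _ _).trans ?_)
    rw [mul_add, abs_mul, abs_mul, abs_mul, abs_mul, abs_of_nonneg ax0, abs_of_nonneg by0]
    have h2R : 0 ≤ 2 / R := by positivity
    refine add_le_add (mul_le_mul_of_nonneg_right ?_ (abs_nonneg _))
      (mul_le_mul_of_nonneg_right ?_ (abs_nonneg _))
    · calc _ ≤ 2 / R * 1 := mul_le_mul axd by1 by0 h2R
        _ = 2 / R := mul_one _
    · calc _ ≤ 1 * (2 / R) := mul_le_mul ax1 byd (abs_nonneg _) zero_le_one
        _ = 2 / R := one_mul _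
  have hlim : Tendsto (fun R : ℝ => 2 / R * M) atTop (𝓝 0) := by
    have h1 : Tendsto (fun R : ℝ => 2 / R) atTop (𝓝 0) := tendsto_const_nhds.div_atTop tendsto_id
    simpa using h1.mul_const M
  have := ge_of_tendsto hlim ((eventually_ge_atTop (2 * ρ)).mono key)
  linarith

/-- Uniqueness for the linear traction problem on the half plane. -/
theorem traction_uniqueness {r T : ℝ} (hr : 1 < r) {V : VProf} (hV : ∀ i, InSbar T (V i))
    (heq : ∀ i, ∀ t ∈ Set.Icc 0 T, ∀ x y, 0 ≤ y → Lss r V i t x y 0 0 = 0)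
    (hbd : ∀ i, ∀ t ∈ Set.Icc 0 T, ∀ x, ls r V i t x 0 0 0 = 0)
    (h0 : ∀ i x y, 0 ≤ y → V i 0 x y 0 0 = 0) (h1 : ∀ i x y, 0 ≤ y → dt (V i) 0 x y 0 0 = 0)
    (i : Fin 2) {t : ℝ} (ht : t ∈ Set.Icc 0 T) (x : ℝ) {y : ℝ} (hy : 0 ≤ y) :
    V i t x y 0 0 = 0 := by
  have hS : ∀ i, SmoothProf (V i) := fun i => (hV i).smooth
  have cont : ∀ {f : Prof}, SmoothProf f →
      Continuous fun p : ℝ × ℝ × ℝ => f p.1 p.2.1 p.2.2 0 0 := fun hf =>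
    hf.continuous_comp (by fun_prop) (by fun_prop) (by fun_prop) continuous_const continuous_const
  have ctx : ∀ i, dx (dt (V i)) = dt (dx (V i)) := fun i => pd_comm (hS i) 1 0
  have cty : ∀ i, dy (dt (V i)) = dt (dy (V i)) := fun i => pd_comm (hS i) 2 0
  have cyx : ∀ i, dy (dx (V i)) = dx (dy (V i)) := fun i => pd_comm (hS i) 2 1
  have ct := fun i => cont (hS i).dt
  have cx := fun i => cont (hS i).dx
  have cy := fun i => cont (hS i).dy
  have ctt := fun i => cont (hS i).dt.dt
  have cxx := fun i => cont (hS i).dx.dx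
  have cyy := fun i => cont (hS i).dy.dy
  have cxy := fun i => cont (hS i).dy.dx
  have cxt := fun i => cont (hS i).dx.dt
  have cyt := fun i => cont (hS i).dy.dt
  have mt : ∀ i, MemLp (fun p : ℝ × ℝ × ℝ => dt (V i) p.1 p.2.1 p.2.2 0 0) 2
      (volume.restrict (Set.Icc 0 T ×ˢ (Set.univ : Set ℝ) ×ˢ Set.Ici (0 : ℝ))) := fun i => by
    simpa using (hV i).memLp 1 0 0
  have mx : ∀ i, MemLp (fun p : ℝ × ℝ × ℝ => dx (V i) p.1 p.2.1 p.2.2 0 0) 2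
      (volume.restrict (Set.Icc 0 T ×ˢ (Set.univ : Set ℝ) ×ˢ Set.Ici (0 : ℝ))) := fun i => by
    simpa using (hV i).memLp 0 1 0
  have my : ∀ i, MemLp (fun p : ℝ × ℝ × ℝ => dy (V i) p.1 p.2.1 p.2.2 0 0) 2
      (volume.restrict (Set.Icc 0 T ×ˢ (Set.univ : Set ℝ) ×ˢ Set.Ici (0 : ℝ))) := fun i => by
    simpa using (hV i).memLp 0 0 1
  have hr1 : 0 ≤ r - 1 := by linarith
  have hx0 : ∀ i x y, 0 ≤ y → dx (V i) 0 x y 0 0 = 0 := by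
    intro i x y hy
    have h : (fun s => V i 0 s y 0 0) = fun _ => 0 := funext fun s => h0 i s y hy
    change deriv (fun s => V i 0 s y 0 0) x = 0
    rw [h]
    exact deriv_const _ _
  have hy0 : ∀ i x y, 0 ≤ y → dy (V i) 0 x y 0 0 = 0 := fun i x y hy =>
    hasDerivAt_eq_zero_of_eq_zero_on_Ici (fun y hy => h0 i x y hy)
      ((hS i).hasDerivAt_y 0 x y 0 0) hy
  -- Kinetic plus elastic energy density for `μ = 1`, `λ = r - 2`. Splitting the diagonal strains
  -- into sum and difference writes the elastic part as squares with coefficients `r - 1`, `1`, `1`,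
  -- so it is nonnegative for `r > 1`. The fluxes `F₁`, `F₂` are the velocity paired with the two
  -- stress columns.
  have key : ∀ t ∈ Set.Icc 0 T, ∀ x y, 0 ≤ y →
      (dt (V 0) t x y 0 0 ^ 2 + dt (V 1) t x y 0 0 ^ 2
        + ((r - 1) * (dx (V 0) t x y 0 0 + dy (V 1) t x y 0 0) ^ 2
          + (dx (V 0) t x y 0 0 - dy (V 1) t x y 0 0) ^ 2
          + (dy (V 0) t x y 0 0 + dx (V 1) t x y 0 0) ^ 2)) / 2 = 0 := by
    intro t ht x y hy
    refine energy_density_eq_zero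
      (e := fun t x y => (dt (V 0) t x y 0 0 ^ 2 + dt (V 1) t x y 0 0 ^ 2
        + ((r - 1) * (dx (V 0) t x y 0 0 + dy (V 1) t x y 0 0) ^ 2
          + (dx (V 0) t x y 0 0 - dy (V 1) t x y 0 0) ^ 2
          + (dy (V 0) t x y 0 0 + dx (V 1) t x y 0 0) ^ 2)) / 2)
      (e' := fun t x y => dt (V 0) t x y 0 0 * dt (dt (V 0)) t x y 0 0
        + dt (V 1) t x y 0 0 * dt (dt (V 1)) t x y 0 0
        + ((r - 1) * (dx (V 0) t x y 0 0 + dy (V 1) t x y 0 0)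
            * (dt (dx (V 0)) t x y 0 0 + dt (dy (V 1)) t x y 0 0)
          + (dx (V 0) t x y 0 0 - dy (V 1) t x y 0 0)
            * (dt (dx (V 0)) t x y 0 0 - dt (dy (V 1)) t x y 0 0)
          + (dy (V 0) t x y 0 0 + dx (V 1) t x y 0 0)
            * (dt (dy (V 0)) t x y 0 0 + dt (dx (V 1)) t x y 0 0)))
      (F₁ := fun t x y => dt (V 0) t x y 0 0 * (r * dx (V 0) t x y 0 0 + (r - 2) * dy (V 1) t x y 0 0)
        + dt (V 1) t x y 0 0 * (dx (V 1) t x y 0 0 + dy (V 0) t x y 0 0))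
      (F₁' := fun t x y =>
        dt (dx (V 0)) t x y 0 0 * (r * dx (V 0) t x y 0 0 + (r - 2) * dy (V 1) t x y 0 0)
        + dt (V 0) t x y 0 0 * (r * dx (dx (V 0)) t x y 0 0 + (r - 2) * dx (dy (V 1)) t x y 0 0)
        + (dt (dx (V 1)) t x y 0 0 * (dx (V 1) t x y 0 0 + dy (V 0) t x y 0 0)
        + dt (V 1) t x y 0 0 * (dx (dx (V 1)) t x y 0 0 + dx (dy (V 0)) t x y 0 0)))
      (F₂ := fun t x y => dt (V 0) t x y 0 0 * (dx (V 1) t x y 0 0 + dy (V 0) t x y 0 0)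
        + dt (V 1) t x y 0 0 * ((r - 2) * dx (V 0) t x y 0 0 + r * dy (V 1) t x y 0 0))
      (F₂' := fun t x y => dt (dy (V 0)) t x y 0 0 * (dx (V 1) t x y 0 0 + dy (V 0) t x y 0 0)
        + dt (V 0) t x y 0 0 * (dx (dy (V 1)) t x y 0 0 + dy (dy (V 0)) t x y 0 0)
        + (dt (dy (V 1)) t x y 0 0 * ((r - 2) * dx (V 0) t x y 0 0 + r * dy (V 1) t x y 0 0)
        + dt (V 1) t x y 0 0 * ((r - 2) * dx (dy (V 0)) t x y 0 0 + r * dy (dy (V 1)) t x y 0 0)))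
      -- By the arithmetic-geometric inequality the fluxes are controlled by squares of velocities
      -- and stresses, integrable because first derivatives are in `L²`.
      (G := fun p => dt (V 0) p.1 p.2.1 p.2.2 0 0 ^ 2 + dt (V 1) p.1 p.2.1 p.2.2 0 0 ^ 2
        + (r * dx (V 0) p.1 p.2.1 p.2.2 0 0 + (r - 2) * dy (V 1) p.1 p.2.1 p.2.2 0 0) ^ 2
        + (dx (V 1) p.1 p.2.1 p.2.2 0 0 + dy (V 0) p.1 p.2.1 p.2.2 0 0) ^ 2
        + ((r - 2) * dx (V 0) p.1 p.2.1 p.2.2 0 0 + r * dy (V 1) p.1 p.2.1 p.2.2 0 0) ^ 2)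
      ?_ ?_ ?_ ?_ ?_ ?_ ?_ ?_ ?_ ?_ ?_ ?_ ?_ ?_ ?_ ht x hy
    · have := ct 0; have := ct 1; have := cx 0; have := cx 1; have := cy 0; have := cy 1
      fun_prop
    · have := ct 0; have := ct 1; have := cx 0; have := cx 1; have := cy 0; have := cy 1
      have := ctt 0; have := ctt 1; have := cxt 0; have := cxt 1; have := cyt 0; have := cyt 1
      fun_prop
    · have := ct 0; have := ct 1; have := cx 0; have := cx 1; have := cy 0; have := cy 1
      fun_prop
    · have := ct 0; have := ct 1; have := cx 0; have := cx 1; have := cy 0; have := cy 1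
      have := cxt 0; have := cxt 1; have := cxx 0; have := cxx 1; have := cxy 0; have := cxy 1
      fun_prop
    · have := ct 0; have := ct 1; have := cx 0; have := cx 1; have := cy 0; have := cy 1
      fun_prop
    · have := ct 0; have := ct 1; have := cx 0; have := cx 1; have := cy 0; have := cy 1
      have := cyt 0; have := cyt 1; have := cyy 0; have := cyy 1; have := cxy 0; have := cxy 1
      fun_prop
    · intro t x y
      have a0 := (hS 0).dt.hasDerivAt_t t x y 0 0
      have a1 := (hS 1).dt.hasDerivAt_t t x y 0 0
      have b0 := (hS 0).dx.hasDerivAt_t t x y 0 0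
      have b1 := (hS 1).dx.hasDerivAt_t t x y 0 0
      have c0 := (hS 0).dy.hasDerivAt_t t x y 0 0
      have c1 := (hS 1).dy.hasDerivAt_t t x y 0 0
      have := (((a0.fun_pow 2).fun_add (a1.fun_pow 2)).fun_add
        (((((b0.fun_add c1).fun_pow 2).const_mul (r - 1)).fun_add ((b0.fun_sub c1).fun_pow 2)).fun_add
          ((c0.fun_add b1).fun_pow 2))).div_const 2
      refine this.congr_deriv ?_
      push_cast
      ring
    · intro t x y
      have a0 := (hS 0).dt.hasDerivAt_x t x y 0 0
      have a1 := (hS 1).dt.hasDerivAt_x t x y 0 0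
      rw [ctx] at a0 a1
      have b0 := (hS 0).dx.hasDerivAt_x t x y 0 0
      have b1 := (hS 1).dx.hasDerivAt_x t x y 0 0
      have c0 := (hS 0).dy.hasDerivAt_x t x y 0 0
      have c1 := (hS 1).dy.hasDerivAt_x t x y 0 0
      exact (a0.fun_mul ((b0.const_mul r).fun_add (c1.const_mul (r - 2)))).fun_add
        (a1.fun_mul (b1.fun_add c0))
    · intro t x y
      have a0 := (hS 0).dt.hasDerivAt_y t x y 0 0
      have a1 := (hS 1).dt.hasDerivAt_y t x y 0 0
      rw [cty] at a0 a1
      have b0 := (hS 0).dx.hasDerivAt_y t x y 0 0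
      have b1 := (hS 1).dx.hasDerivAt_y t x y 0 0
      rw [cyx] at b0 b1
      have c0 := (hS 0).dy.hasDerivAt_y t x y 0 0
      have c1 := (hS 1).dy.hasDerivAt_y t x y 0 0
      exact (a0.fun_mul (b1.fun_add c0)).fun_add
        (a1.fun_mul ((b0.const_mul (r - 2)).fun_add (c1.const_mul r)))
    · intro t ht x y hy
      -- The balance law is the equations of motion multiplied by the velocity.
      have e0 : dt (dt (V 0)) t x y 0 0 - r * dx (dx (V 0)) t x y 0 0
        - (r - 1) * dx (dy (V 1)) t x y 0 0 - dy (dy (V 0)) t x y 0 0 = 0 := heq 0 t ht x y hy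
      have e1 : dt (dt (V 1)) t x y 0 0 - dx (dx (V 1)) t x y 0 0
        - (r - 1) * dx (dy (V 0)) t x y 0 0 - r * dy (dy (V 1)) t x y 0 0 = 0 := heq 1 t ht x y hy
      linear_combination dt (V 0) t x y 0 0 * e0 + dt (V 1) t x y 0 0 * e1
    · intro t ht x
      have e0 : dx (V 1) t x 0 0 0 + dy (V 0) t x 0 0 0 = 0 := hbd 0 t ht x
      have e1 : (r - 2) * dx (V 0) t x 0 0 0 + r * dy (V 1) t x 0 0 0 = 0 := hbd 1 t ht x
      rw [e0, e1]
      ring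
    · intro x y hy
      simp only [h1 _ x y hy, hx0 _ x y hy, hy0 _ x y hy]
      ring
    · intro t x y
      positivity
    · exact ((((mt 0).integrable_sq.add (mt 1).integrable_sq).add
        (((mx 0).const_mul r).add ((my 1).const_mul (r - 2))).integrable_sq).add
        ((mx 1).add (my 0)).integrable_sq).add
        (((mx 0).const_mul (r - 2)).add ((my 1).const_mul r)).integrable_sq
    · intro t x y
      dsimp only
      generalize dt (V 0) t x y 0 0 = a
      generalize dt (V 1) t x y 0 0 = b
      generalize r * dx (V 0) t x y 0 0 + (r - 2) * dy (V 1) t x y 0 0 = k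
      generalize dx (V 1) t x y 0 0 + dy (V 0) t x y 0 0 = l
      generalize (r - 2) * dx (V 0) t x y 0 0 + r * dy (V 1) t x y 0 0 = m
      have p : ∀ a b : ℝ, |a * b| ≤ (a ^ 2 + b ^ 2) / 2 := fun a b =>
        abs_le.2 ⟨by nlinarith [sq_nonneg (a + b)], by nlinarith [sq_nonneg (a - b)]⟩
      have q1 := (abs_add_le (a * k) (b * l)).trans (add_le_add (p a k) (p b l))
      have q2 := (abs_add_le (a * l) (b * m)).trans (add_le_add (p a l) (p b m))
      nlinarith [sq_nonneg k, sq_nonneg m]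
  -- Zero energy gives zero velocity, so `V` keeps its initial value zero.
  have hdt : ∀ s ∈ Set.Icc 0 T, dt (V i) s x y 0 0 = 0 := by
    intro s hs
    have h := key s hs x y hy
    have n1 : 0 ≤ (r - 1) * (dx (V 0) s x y 0 0 + dy (V 1) s x y 0 0) ^ 2 := by positivity
    have n2 := sq_nonneg (dx (V 0) s x y 0 0 - dy (V 1) s x y 0 0)
    have n3 := sq_nonneg (dy (V 0) s x y 0 0 + dx (V 1) s x y 0 0)
    have n4 := sq_nonneg (dt (V 0) s x y 0 0)
    have n5 := sq_nonneg (dt (V 1) s x y 0 0)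
    have : dt (V i) s x y 0 0 ^ 2 = 0 := by
      fin_cases i
      · change dt (V 0) s x y 0 0 ^ 2 = 0
        linarith
      · change dt (V 1) s x y 0 0 ^ 2 = 0
        linarith
    exact pow_eq_zero_iff (two_ne_zero) |>.1 this
  have hconst := constant_of_has_deriv_right_zero (f := fun s => V i s x y 0 0) (a := 0) (b := t)
    (fun s _ => ((hS i).hasDerivAt_t s x y 0 0).continuousAt.continuousWithinAt)
    (fun s hs => by
      have h := (hS i).hasDerivAt_t s x y 0 0
      rw [hdt s ⟨hs.1, hs.2.le.trans ht.2⟩] at h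
      exact h.hasDerivWithinAt) t ⟨ht.1, le_rfl⟩
  rw [hconst]
  exact h0 i x y hy

/-! ### The first right sides of the cascade -/

lemma grad_zero (s : Scale) : grad s 0 = 0 := by
  cases s
  · funext i j
    fin_cases j
    · exact pd_zero_fun 3
    · exact pd_zero_fun 4
  · funext i j
    fin_cases j
    · exact pd_zero_fun 1
    · exact pd_zero_fun 2

lemma divg_zero (s : Scale) : divg s 0 = 0 := by
  cases s
  · funext i
    change pd 3 0 + pd 4 0 = 0
    rw [pd_zero_fun, pd_zero_fun, add_zero]
  · funext i
    change pd 1 0 + pd 2 0 = 0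
    rw [pd_zero_fun, pd_zero_fun, add_zero]

lemma Lfs_zero (r c : ℝ) : Lfs r c 0 = 0 := by
  have h : ∀ i : Fin 2, (0 : VProf) i = 0 := fun _ => rfl
  simp only [Lfs, ← pd_zero, ← pd_one, ← pd_two, ← pd_three, ← pd_four, h, pd_zero_fun]
  funext i
  fin_cases i <;> simp

lemma Lss_zero (r : ℝ) : Lss r 0 = 0 := by
  have h : ∀ i : Fin 2, (0 : VProf) i = 0 := fun _ => rfl
  simp only [Lss, ← pd_zero, ← pd_one, ← pd_two, h, pd_zero_fun]
  funext i
  fin_cases i <;> simp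

lemma ls_zero (r : ℝ) : ls r 0 = 0 := by
  have h : ∀ i : Fin 2, (0 : VProf) i = 0 := fun _ => rfl
  simp only [ls, ← pd_one, ← pd_two, h, pd_zero_fun]
  funext i
  fin_cases i <;> simp

/-- Binary operations that vanish as soon as one argument does. -/
def Annihilates₂ (F : VProf → VProf → VProf) : Prop :=
  (∀ V, F 0 V = 0) ∧ ∀ V, F V 0 = 0

/-- Ternary operations that vanish as soon as one argument does. -/
def Annihilates₃ (F : VProf → VProf → VProf → VProf) : Prop :=
  (∀ V W, F 0 V W = 0) ∧ (∀ V W, F V 0 W = 0) ∧ ∀ V W, F V W 0 = 0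

lemma Q_zero_left (r : ℝ) (a b : Scale) (V : VProf) : Q r a b 0 V = 0 := by
  simp [Q, quad, grad_zero]

lemma Q_zero_right (r : ℝ) (a b : Scale) (V : VProf) : Q r a b V 0 = 0 := by
  simp [Q, quad, grad_zero]

lemma C_zero₁ (r : ℝ) (a b d : Scale) (V W : VProf) : C r a b d 0 V W = 0 := by
  simp [C, cub, grad_zero]

lemma C_zero₂ (r : ℝ) (a b d : Scale) (V W : VProf) : C r a b d V 0 W = 0 := by
  simp [C, cub, grad_zero]

lemma C_zero₃ (r : ℝ) (a b d : Scale) (V W : VProf) : C r a b d V W 0 = 0 := by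
  simp [C, cub, grad_zero]

section Annihilates

variable (r : ℝ)

lemma annihilates₂_Afff : Annihilates₂ (Afff r) :=
  ⟨fun V => by simp [Afff, Q_zero_left, divg_zero], fun V => by simp [Afff, Q_zero_right, divg_zero]⟩

lemma annihilates₂_Affs : Annihilates₂ (Affs r) :=
  ⟨fun V => by simp [Affs, Q_zero_left, divg_zero], fun V => by simp [Affs, Q_zero_right, divg_zero]⟩

lemma annihilates₂_Afss : Annihilates₂ (Afss r) :=
  ⟨fun V => by simp [Afss, Q_zero_left, divg_zero], fun V => by simp [Afss, Q_zero_right, divg_zero]⟩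

lemma annihilates₂_Asss : Annihilates₂ (Asss r) :=
  ⟨fun V => by simp [Asss, Q_zero_left, divg_zero], fun V => by simp [Asss, Q_zero_right, divg_zero]⟩

lemma annihilates₂_Q₂ (a b : Scale) : Annihilates₂ (Q₂ r a b) :=
  ⟨fun V => by funext i; simp [Q₂, Q_zero_left], fun V => by funext i; simp [Q₂, Q_zero_right]⟩

lemma annihilates₃_C₂ (a b d : Scale) : Annihilates₃ (C₂ r a b d) :=
  ⟨fun V W => by funext i; simp [C₂, C_zero₁], fun V W => by funext i; simp [C₂, C_zero₂],
    fun V W => by funext i; simp [C₂, C_zero₃]⟩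

lemma annihilates₃_Bffff : Annihilates₃ (Bffff r) :=
  ⟨fun V W => by simp [Bffff, C_zero₁, divg_zero], fun V W => by simp [Bffff, C_zero₂, divg_zero],
    fun V W => by simp [Bffff, C_zero₃, divg_zero]⟩

lemma annihilates₃_Bfffs : Annihilates₃ (Bfffs r) :=
  ⟨fun V W => by simp [Bfffs, C_zero₁, divg_zero], fun V W => by simp [Bfffs, C_zero₂, divg_zero],
    fun V W => by simp [Bfffs, C_zero₃, divg_zero]⟩

lemma annihilates₃_Bffss : Annihilates₃ (Bffss r) :=
  ⟨fun V W => by simp [Bffss, C_zero₁, divg_zero], fun V W => by simp [Bffss, C_zero₂, divg_zero],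
    fun V W => by simp [Bffss, C_zero₃, divg_zero]⟩

lemma annihilates₃_Bfsss : Annihilates₃ (Bfsss r) :=
  ⟨fun V W => by simp [Bfsss, C_zero₁, divg_zero], fun V W => by simp [Bfsss, C_zero₂, divg_zero],
    fun V W => by simp [Bfsss, C_zero₃, divg_zero]⟩

lemma annihilates₃_Bssss : Annihilates₃ (Bssss r) :=
  ⟨fun V W => by simp [Bssss, C_zero₁, divg_zero], fun V W => by simp [Bssss, C_zero₂, divg_zero],
    fun V W => by simp [Bssss, C_zero₃, divg_zero]⟩

end Annihilates

section Cascade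

variable {U : ℕ → VProf}

lemma eq_zero_of_le_one (h0 : U 0 = 0) (h1 : U 1 = 0) {j : ℕ} (hj : j ≤ 1) : U j = 0 := by
  interval_cases j
  · exact h0
  · exact h1

/-- If two indices have sum below `2 + 2`, one is at most `1` and its profile vanishes. The cubic
threshold is `2 + 2 + 2`; just at the thresholds only the terms in `U 2` alone survive. -/
lemma sum₂_eq_zero (h0 : U 0 = 0) (h1 : U 1 = 0) {F : VProf → VProf → VProf}
    (hF : Annihilates₂ F) {m : ℕ} (hm : m < 4) : sum₂ U m F = 0 := by
  refine Finset.sum_eq_zero fun p hp => ?_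
  have hp : p.1 + p.2 = m := Finset.HasAntidiagonal.mem_antidiagonal.1 hp
  by_cases h : p.1 ≤ 1
  · rw [eq_zero_of_le_one h0 h1 h, hF.1]
  · rw [eq_zero_of_le_one h0 h1 (show p.2 ≤ 1 by omega), hF.2]

lemma sum₂_four (h0 : U 0 = 0) (h1 : U 1 = 0) {F : VProf → VProf → VProf}
    (hF : Annihilates₂ F) : sum₂ U 4 F = F (U 2) (U 2) := by
  refine Finset.sum_eq_single_of_mem (2, 2) (Finset.HasAntidiagonal.mem_antidiagonal.2 rfl) fun p hp hne => ?_
  have hp : p.1 + p.2 = 4 := Finset.HasAntidiagonal.mem_antidiagonal.1 hp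
  by_cases h : p.1 ≤ 1
  · rw [eq_zero_of_le_one h0 h1 h, hF.1]
  · have h2 : p.2 ≤ 1 := by
      by_contra h2
      exact hne (Prod.ext (by dsimp only; omega) (by dsimp only; omega))
    rw [eq_zero_of_le_one h0 h1 h2, hF.2]

lemma sum₂_five (h0 : U 0 = 0) (h1 : U 1 = 0) {F : VProf → VProf → VProf}
    (hF : Annihilates₂ F) : sum₂ U 5 F = F (U 2) (U 3) + F (U 3) (U 2) := by
  have h := Finset.sum_subset (s₁ := {(2, 3), (3, 2)})
    (s₂ := Finset.HasAntidiagonal.antidiagonal 5) (f := fun p : ℕ × ℕ => F (U p.1) (U p.2))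
    (by intro p hp; simp at hp; rcases hp with rfl | rfl <;> simp) (fun p hp hne => ?_)
  · rw [sum₂, ← h, Finset.sum_pair (by simp)]
  · have hp : p.1 + p.2 = 5 := Finset.HasAntidiagonal.mem_antidiagonal.1 hp
    by_cases h : p.1 ≤ 1
    · rw [eq_zero_of_le_one h0 h1 h, hF.1]
    · have h2 : p.2 ≤ 1 := by
        by_contra h2
        refine hne ?_
        obtain ⟨a, b⟩ := p
        simp only [Finset.mem_insert, Finset.mem_singleton, Prod.mk.injEq]
        dsimp only at *
        omega
      rw [eq_zero_of_le_one h0 h1 h2, hF.2]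

lemma sum₃_eq_zero (h0 : U 0 = 0) (h1 : U 1 = 0) {F : VProf → VProf → VProf → VProf}
    (hF : Annihilates₃ F) {m : ℕ} (hm : m < 6) : sum₃ U m F = 0 := by
  refine Finset.sum_eq_zero fun p hp => Finset.sum_eq_zero fun p' hp' => ?_
  have hp : p.1 + p.2 = m := Finset.HasAntidiagonal.mem_antidiagonal.1 hp
  have hp' : p'.1 + p'.2 = p.2 := Finset.HasAntidiagonal.mem_antidiagonal.1 hp'
  by_cases h : p.1 ≤ 1
  · rw [eq_zero_of_le_one h0 h1 h, hF.1]
  by_cases h' : p'.1 ≤ 1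
  · rw [eq_zero_of_le_one h0 h1 h', hF.2.1]
  rw [eq_zero_of_le_one h0 h1 (show p'.2 ≤ 1 by omega), hF.2.2]

lemma sum₃_six (h0 : U 0 = 0) (h1 : U 1 = 0) {F : VProf → VProf → VProf → VProf}
    (hF : Annihilates₃ F) : sum₃ U 6 F = F (U 2) (U 2) (U 2) := by
  have key : ∀ p : ℕ × ℕ, p.1 + p.2 = 6 → ∀ p' : ℕ × ℕ, p'.1 + p'.2 = p.2 →
      (p.1 ≠ 2 ∨ p'.1 ≠ 2) → F (U p.1) (U p'.1) (U p'.2) = 0 := by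
    intro p hp p' hp' hne
    by_cases h : p.1 ≤ 1
    · rw [eq_zero_of_le_one h0 h1 h, hF.1]
    by_cases h' : p'.1 ≤ 1
    · rw [eq_zero_of_le_one h0 h1 h', hF.2.1]
    rw [eq_zero_of_le_one h0 h1 (show p'.2 ≤ 1 by omega), hF.2.2]
  refine (Finset.sum_eq_single_of_mem (2, 4) (Finset.HasAntidiagonal.mem_antidiagonal.2 rfl)
    fun p hp hne => Finset.sum_eq_zero fun p' hp' => ?_).trans
    (Finset.sum_eq_single_of_mem (2, 2) (Finset.HasAntidiagonal.mem_antidiagonal.2 rfl) fun p' hp' hne => ?_)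
  · have hp : p.1 + p.2 = 6 := Finset.HasAntidiagonal.mem_antidiagonal.1 hp
    refine key p hp p' (Finset.HasAntidiagonal.mem_antidiagonal.1 hp') (Or.inl fun h => hne ?_)
    exact Prod.ext h (by dsimp only; omega)
  · have hp' : p'.1 + p'.2 = 4 := Finset.HasAntidiagonal.mem_antidiagonal.1 hp'
    refine key (2, 4) rfl p' hp' (Or.inr fun h => hne ?_)
    exact Prod.ext h (by dsimp only; omega)

lemma intRHS_one (r c : ℝ) (h0 : U 0 = 0) (h1 : U 1 = 0) : intRHS r c U 1 = 0 := by
  unfold intRHS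
  rw [sum₂_eq_zero h0 h1 (annihilates₂_Asss r) (by norm_num),
    sum₂_eq_zero h0 h1 (annihilates₂_Afss r) (by norm_num),
    sum₂_eq_zero h0 h1 (annihilates₂_Affs r) (by norm_num),
    sum₂_eq_zero h0 h1 (annihilates₂_Afff r) (by norm_num),
    sum₃_eq_zero h0 h1 (annihilates₃_Bssss r) (by norm_num),
    sum₃_eq_zero h0 h1 (annihilates₃_Bfsss r) (by norm_num),
    sum₃_eq_zero h0 h1 (annihilates₃_Bffss r) (by norm_num),
    sum₃_eq_zero h0 h1 (annihilates₃_Bfffs r) (by norm_num),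
    sum₃_eq_zero h0 h1 (annihilates₃_Bffff r) (by norm_num), h1, h0, Lfs_zero, Lss_zero]
  simp

lemma intRHS_two (r c : ℝ) (h0 : U 0 = 0) (h1 : U 1 = 0) : intRHS r c U 2 = -Lfs r c (U 2) + Afff r (U 2) (U 2) := by
  unfold intRHS
  rw [sum₂_eq_zero h0 h1 (annihilates₂_Asss r) (by norm_num),
    sum₂_eq_zero h0 h1 (annihilates₂_Afss r) (by norm_num),
    sum₂_eq_zero h0 h1 (annihilates₂_Affs r) (by norm_num),
    sum₂_four h0 h1 (annihilates₂_Afff r),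
    sum₃_eq_zero h0 h1 (annihilates₃_Bssss r) (by norm_num),
    sum₃_eq_zero h0 h1 (annihilates₃_Bfsss r) (by norm_num),
    sum₃_eq_zero h0 h1 (annihilates₃_Bffss r) (by norm_num),
    sum₃_eq_zero h0 h1 (annihilates₃_Bfffs r) (by norm_num),
    sum₃_eq_zero h0 h1 (annihilates₃_Bffff r) (by norm_num), h1, Lss_zero]
  simp

lemma intRHS_three (r c : ℝ) (h0 : U 0 = 0) (h1 : U 1 = 0) :
    intRHS r c U 3 = -Lfs r c (U 3) - Lss r (U 2) + Affs r (U 2) (U 2)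
      + (Afff r (U 2) (U 3) + Afff r (U 3) (U 2)) + Bffff r (U 2) (U 2) (U 2) := by
  unfold intRHS
  rw [sum₂_eq_zero h0 h1 (annihilates₂_Asss r) (by norm_num),
    sum₂_eq_zero h0 h1 (annihilates₂_Afss r) (by norm_num),
    sum₂_four h0 h1 (annihilates₂_Affs r),
    sum₂_five h0 h1 (annihilates₂_Afff r),
    sum₃_eq_zero h0 h1 (annihilates₃_Bssss r) (by norm_num),
    sum₃_eq_zero h0 h1 (annihilates₃_Bfsss r) (by norm_num),
    sum₃_eq_zero h0 h1 (annihilates₃_Bffss r) (by norm_num),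
    sum₃_eq_zero h0 h1 (annihilates₃_Bfffs r) (by norm_num),
    sum₃_six h0 h1 (annihilates₃_Bffff r)]
  simp

lemma bdyRHS_one (r : ℝ) (G : VProf) (h0 : U 0 = 0) (h1 : U 1 = 0) : bdyRHS r G U 1 = 0 := by
  unfold bdyRHS
  simp only [fun a b => sum₂_eq_zero h0 h1 (annihilates₂_Q₂ r a b) (show 1 + 2 < 4 by norm_num),
    fun a b => sum₂_eq_zero h0 h1 (annihilates₂_Q₂ r a b) (show 1 + 1 < 4 by norm_num),
    fun a b => sum₂_eq_zero h0 h1 (annihilates₂_Q₂ r a b) (show 1 < 4 by norm_num),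
    fun a b d => sum₃_eq_zero h0 h1 (annihilates₃_C₂ r a b d) (show 1 + 3 < 6 by norm_num),
    fun a b d => sum₃_eq_zero h0 h1 (annihilates₃_C₂ r a b d) (show 1 + 2 < 6 by norm_num),
    fun a b d => sum₃_eq_zero h0 h1 (annihilates₃_C₂ r a b d) (show 1 + 1 < 6 by norm_num),
    fun a b d => sum₃_eq_zero h0 h1 (annihilates₃_C₂ r a b d) (show 1 < 6 by norm_num),
    h1, ls_zero]
  simp

lemma bdyRHS_two (r : ℝ) (G : VProf) (h0 : U 0 = 0) (h1 : U 1 = 0) :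
    bdyRHS r G U 2 = -ls r (U 2) - Q₂ r Scale.fast Scale.fast (U 2) (U 2) + G := by
  unfold bdyRHS
  simp only [show sum₂ U (2 + 2) (Q₂ r Scale.fast Scale.fast) = _ from
      sum₂_four h0 h1 (annihilates₂_Q₂ r _ _),
    fun a b => sum₂_eq_zero h0 h1 (annihilates₂_Q₂ r a b) (show 2 + 1 < 4 by norm_num),
    fun a b => sum₂_eq_zero h0 h1 (annihilates₂_Q₂ r a b) (show 2 < 4 by norm_num),
    fun a b d => sum₃_eq_zero h0 h1 (annihilates₃_C₂ r a b d) (show 2 + 3 < 6 by norm_num),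
    fun a b d => sum₃_eq_zero h0 h1 (annihilates₃_C₂ r a b d) (show 2 + 2 < 6 by norm_num),
    fun a b d => sum₃_eq_zero h0 h1 (annihilates₃_C₂ r a b d) (show 2 + 1 < 6 by norm_num),
    fun a b d => sum₃_eq_zero h0 h1 (annihilates₃_C₂ r a b d) (show 2 < 6 by norm_num)]
  simp

end Cascade

/-! ### Components of profiles -/

/-- `barPart` is a `limUnder`, meaningful only if the limit exists; the decaying remainder
guarantees this and contributes nothing. -/
lemma IsDec.barPart_add {T : ℝ} {f g : Prof} (hf : IsSlow f) (hg : IsDec T g) {t : ℝ}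
    (ht : t ∈ Set.Icc 0 T) (x y θ Y : ℝ) : barPart (f + g) t x y θ Y = f t x y 0 0 := by
  refine Tendsto.limUnder_eq ?_
  have h1 : Tendsto (fun Y => f t x y 0 Y) atTop (𝓝 (f t x y 0 0)) := by
    simp only [fun Y => hf t x y 0 Y 0 0]
    exact tendsto_const_nhds
  simpa using h1.add (hg.tendsto_zero ht x y 0)

/-- If the right side does not depend on `y`, then it has no mixed component. -/
lemma barPart_add_starPart {f : Prof} (hf : ∀ t x y θ Y y', f t x y θ Y = f t x y' θ Y) :
    barPart f + starPart f = f := by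
  funext t x y θ Y
  have hb : ∀ y', barPart f t x y' θ Y = barPart f t x y θ Y := by
    intro y'
    simp only [barPart, fun Y => hf t x y' 0 Y y]
  have h2 : starPart f t x y θ Y = f t x y θ Y - barPart f t x y θ Y := by
    refine Tendsto.limUnder_eq ?_
    simp only [hb, fun y' => hf t x y' θ Y y]
    exact tendsto_const_nhds
  change barPart f t x y θ Y + starPart f t x y θ Y = f t x y θ Y
  rw [h2]
  ring

/-! ### The multilinear maps on decaying profiles -/

/-- The decaying profiles as a submodule. -/
def decSubmodule (T : ℝ) : Submodule ℝ Prof where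
  carrier := {f | IsDec T f}
  add_mem' hf hg := hf.add hg
  zero_mem' := isDec_zero
  smul_mem' a _ hf := hf.smul a

/-- The profiles that do not depend on `y`, as a submodule. -/
def indepSubmodule : Submodule ℝ Prof where
  carrier := {f | ∀ t x y θ Y y', f t x y θ Y = f t x y' θ Y}
  add_mem' hf hg := fun t x y θ Y y' => congrArg₂ (· + ·) (hf t x y θ Y y') (hg t x y θ Y y')
  zero_mem' := fun _ _ _ _ _ _ => rfl
  smul_mem' a _ hf := fun t x y θ Y y' => congrArg (a * ·) (hf t x y θ Y y')

lemma mul_mem_indepSubmodule {f g : Prof} (hf : f ∈ indepSubmodule) (hg : g ∈ indepSubmodule) :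
    f * g ∈ indepSubmodule :=
  fun t x y θ Y y' => congrArg₂ (· * ·) (hf t x y θ Y y') (hg t x y θ Y y')

/-- Entries of `quad` are real linear combinations of products of an entry of `M` and an entry of
`N`. Stating this for any submodule covers both decay and independence of `y`. -/
lemma quad_mem (P : Submodule ℝ Prof) (r : ℝ) {M N : Matrix (Fin 2) (Fin 2) Prof}
    (h : ∀ i j k l, M i j * N k l ∈ P) (i j : Fin 2) : quad r M N i j ∈ P := by
  have hMN : ∀ i j, (Mᵀ * N) i j ∈ P := fun i j => by
    rw [Matrix.mul_apply, Fin.sum_univ_two]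
    exact P.add_mem (h _ _ _ _) (h _ _ _ _)
  have h1 : (Mᵀ * N).trace * (1 : Matrix (Fin 2) (Fin 2) Prof) i j ∈ P := by
    rw [Matrix.one_apply]
    split_ifs
    · rw [mul_one, Matrix.trace_fin_two]
      exact P.add_mem (hMN _ _) (hMN _ _)
    · rw [mul_zero]
      exact P.zero_mem
  have h3 : N.trace * M i j ∈ P := by
    rw [Matrix.trace_fin_two, mul_comm, mul_add]
    exact P.add_mem (h _ _ _ _) (h _ _ _ _)
  have h4 : (M * (N + Nᵀ)) i j ∈ P := by
    rw [Matrix.mul_add, Matrix.add_apply, Matrix.mul_apply, Matrix.mul_apply, Fin.sum_univ_two,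
      Fin.sum_univ_two]
    exact P.add_mem (P.add_mem (h _ _ _ _) (h _ _ _ _)) (P.add_mem (h _ _ _ _) (h _ _ _ _))
  exact P.add_mem (P.add_mem (P.add_mem (P.smul_mem _ h1) (hMN i j)) (P.smul_mem _ h3)) h4

lemma cub_mem (P : Submodule ℝ Prof) (r : ℝ) {M N K : Matrix (Fin 2) (Fin 2) Prof}
    (h : ∀ i j k l m n, M i j * (N k l * K m n) ∈ P) (i j : Fin 2) : cub r M N K i j ∈ P := by
  have h1 : (Nᵀ * K).trace * M i j ∈ P := by
    rw [Matrix.trace_fin_two, mul_comm, mul_add, Matrix.mul_apply, Matrix.mul_apply,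
      Fin.sum_univ_two, Fin.sum_univ_two, mul_add, mul_add]
    exact P.add_mem (P.add_mem (h _ _ _ _ _ _) (h _ _ _ _ _ _))
      (P.add_mem (h _ _ _ _ _ _) (h _ _ _ _ _ _))
  have h2 : (M * (Nᵀ * K)) i j ∈ P := by
    rw [Matrix.mul_apply, Fin.sum_univ_two, Matrix.mul_apply, Matrix.mul_apply, Fin.sum_univ_two,
      Fin.sum_univ_two, mul_add, mul_add]
    exact P.add_mem (P.add_mem (h _ _ _ _ _ _) (h _ _ _ _ _ _))
      (P.add_mem (h _ _ _ _ _ _) (h _ _ _ _ _ _))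
  exact P.add_mem (P.smul_mem _ h1) h2

/-- Sums of a smooth slow profile and a decaying profile. -/
def IsSlowAddDec (T : ℝ) (f : Prof) : Prop :=
  ∃ a b : Prof, SmoothProf a ∧ IsSlow a ∧ IsDec T b ∧ f = a + b

section SlowAddDec

variable {T : ℝ}

lemma InS.isSlowAddDec {f : Prof} (hf : InS T f) : IsSlowAddDec T f := by
  obtain ⟨a, b, ha, hb, h⟩ := hf
  exact ⟨a, b, ha.smooth, ha.indep, .star hb, h⟩

lemma IsSlowAddDec.isBdd {f : Prof} (hf : IsSlowAddDec T f) : IsBdd T f := by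
  obtain ⟨a, b, ha, ha', hb, rfl⟩ := hf
  exact .add (.slow ha ha') hb.isBdd

/-- A fast derivative kills the slow summand. This is why a single fast derivative puts a term of
the cascade in the decaying ideal. -/
lemma IsSlowAddDec.dθ {f : Prof} (hf : IsSlowAddDec T f) : IsDec T (dθ f) := by
  obtain ⟨a, b, ha, ha', hb, rfl⟩ := hf
  rw [← pd_three, pd_add ha hb.isBdd.smooth, pd_three, ha'.dθ_eq_zero, zero_add]
  exact hb.pd 3

lemma IsSlowAddDec.dY {f : Prof} (hf : IsSlowAddDec T f) : IsDec T (dY f) := by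
  obtain ⟨a, b, ha, ha', hb, rfl⟩ := hf
  rw [← pd_four, pd_add ha hb.isBdd.smooth, pd_four, ha'.dY_eq_zero, zero_add]
  exact hb.pd 4

variable {U V W : VProf}

lemma isDec_grad_fast (hU : ∀ i, IsSlowAddDec T (U i)) (i j : Fin 2) :
    IsDec T (grad Scale.fast U i j) := by
  fin_cases j
  · exact (hU i).dθ
  · exact (hU i).dY

lemma isBdd_grad (hU : ∀ i, IsSlowAddDec T (U i)) (s : Scale) (i j : Fin 2) :
    IsBdd T (grad s U i j) := by
  cases s
  · exact (isDec_grad_fast hU i j).isBdd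
  · fin_cases j
    · exact (hU i).isBdd.pd 1
    · exact (hU i).isBdd.pd 2

lemma isDec_Q_fast_left (r : ℝ) (s : Scale) (hU : ∀ i, IsSlowAddDec T (U i))
    (hV : ∀ i, IsSlowAddDec T (V i)) (i j : Fin 2) : IsDec T (Q r Scale.fast s U V i j) :=
  quad_mem (decSubmodule T) r
    (fun i j k l => (isDec_grad_fast hU i j).mul_right (isBdd_grad hV s k l)) i j

lemma isDec_Q_fast_right (r : ℝ) (s : Scale) (hU : ∀ i, IsSlowAddDec T (U i))
    (hV : ∀ i, IsSlowAddDec T (V i)) (i j : Fin 2) : IsDec T (Q r s Scale.fast U V i j) :=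
  quad_mem (decSubmodule T) r
    (fun i j k l => .mul (isBdd_grad hU s i j) (isDec_grad_fast hV k l)) i j

lemma isDec_divg (s : Scale) {M : Matrix (Fin 2) (Fin 2) Prof} (hM : ∀ i j, IsDec T (M i j))
    (i : Fin 2) : IsDec T (divg s M i) := by
  cases s
  · exact ((hM i 0).pd 3).add ((hM i 1).pd 4)
  · exact ((hM i 0).pd 1).add ((hM i 1).pd 2)

lemma isDec_Afff (r : ℝ) (hU : ∀ i, IsSlowAddDec T (U i))
    (hV : ∀ i, IsSlowAddDec T (V i)) (i : Fin 2) : IsDec T (Afff r U V i) :=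
  isDec_divg _ (isDec_Q_fast_left r _ hU hV) i

lemma isDec_Affs (r : ℝ) (hU : ∀ i, IsSlowAddDec T (U i))
    (hV : ∀ i, IsSlowAddDec T (V i)) (i : Fin 2) : IsDec T (Affs r U V i) :=
  ((isDec_divg _ (isDec_Q_fast_left r _ hU hV) i).add
    (isDec_divg _ (isDec_Q_fast_right r _ hU hV) i)).add
    (isDec_divg _ (isDec_Q_fast_left r _ hU hV) i)

lemma isDec_Bffff (r : ℝ) (hU : ∀ i, IsSlowAddDec T (U i))
    (hV : ∀ i, IsSlowAddDec T (V i)) (hW : ∀ i, IsSlowAddDec T (W i)) (i : Fin 2) :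
    IsDec T (Bffff r U V W i) :=
  isDec_divg _ (cub_mem (decSubmodule T) r fun i j k l m n => .mul (isBdd_grad hU _ i j)
    (.mul (isBdd_grad hV _ k l) (isDec_grad_fast hW m n))) i

lemma isDec_Lfs (r c : ℝ) (hU : ∀ i, IsSlowAddDec T (U i)) (i : Fin 2) :
    IsDec T (Lfs r c U i) := by
  have hθ := fun i => (hU i).dθ
  have hY := fun i => (hU i).dY
  fin_cases i
  · exact ((((((hθ 0).pd 0).smul _).neg).sub (((hθ 0).pd 1).smul _)).sub
      ((((hY 1).pd 1).add ((hθ 1).pd 2)).smul _)).sub (((hY 0).pd 2).smul _)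
  · exact ((((((hθ 1).pd 0).smul _).neg).sub (((hθ 1).pd 1).smul _)).sub
      ((((hY 0).pd 1).add ((hθ 0).pd 2)).smul _)).sub (((hY 1).pd 2).smul _)

lemma isDec_Lss (r : ℝ) (hU : ∀ i, IsDec T (U i)) (i : Fin 2) : IsDec T (Lss r U i) := by
  fin_cases i
  · exact (((((hU 0).pd 0).pd 0).sub ((((hU 0).pd 1).pd 1).smul _)).sub
      ((((hU 1).pd 2).pd 1).smul _)).sub (((hU 0).pd 2).pd 2)
  · exact (((((hU 1).pd 0).pd 0).sub (((hU 1).pd 1).pd 1)).sub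
      ((((hU 0).pd 2).pd 1).smul _)).sub ((((hU 1).pd 2).pd 2).smul _)

end SlowAddDec

/-! ### Additivity and regularity of the slow operators -/

lemma pd_pd_add {f g : Prof} (hf : SmoothProf f) (hg : SmoothProf g) (i j : Fin 5) :
    pd i (pd j (f + g)) = pd i (pd j f) + pd i (pd j g) := by
  rw [pd_add hf hg, pd_add (hf.pd j) (hg.pd j)]

lemma Lss_add (r : ℝ) {U V : VProf} (hU : ∀ i, SmoothProf (U i)) (hV : ∀ i, SmoothProf (V i)) :
    Lss r (U + V) = Lss r U + Lss r V := by
  have h : ∀ i, (U + V) i = U i + V i := fun _ => rfl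
  simp only [Lss, ← pd_zero, ← pd_one, ← pd_two, h, fun i j k => pd_pd_add (hU i) (hV i) j k]
  funext i
  fin_cases i
  · simp [smul_add]; abel
  · simp [smul_add]; abel

lemma Lss_smooth {r : ℝ} {V : VProf} (h : ∀ i, SmoothProf (V i)) (i : Fin 2) :
    SmoothProf (Lss r V i) := by
  fin_cases i
  · exact (((h 0).dt.dt.sub ((h 0).dx.dx.smul _)).sub ((h 1).dy.dx.smul _)).sub (h 0).dy.dy
  · exact (((h 1).dt.dt.sub (h 1).dx.dx).sub ((h 0).dy.dx.smul _)).sub ((h 1).dy.dy.smul _)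

lemma Lss_slow {r : ℝ} {V : VProf} (h : ∀ i, IsSlow (V i)) (i : Fin 2) : IsSlow (Lss r V i) := by
  have h2 := fun i j k => ((h i).pd j).pd k
  simp only [Lss, ← pd_zero, ← pd_one, ← pd_two]
  intro t x y θ Y θ' Y'
  fin_cases i
  · simp [fun i j k => h2 i j k t x y θ Y θ' Y']
  · simp [fun i j k => h2 i j k t x y θ Y θ' Y']

lemma ls_slow {r : ℝ} {V : VProf} (h : ∀ i, IsSlow (V i)) (i : Fin 2) : IsSlow (ls r V i) := by
  have h2 := fun i j => (h i).pd j
  simp only [ls, ← pd_one, ← pd_two]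
  intro t x y θ Y θ' Y'
  fin_cases i
  · simp [fun i j => h2 i j t x y θ Y θ' Y']
  · simp [fun i j => h2 i j t x y θ Y θ' Y']

lemma ls_smooth {r : ℝ} {V : VProf} (h : ∀ i, SmoothProf (V i)) (i : Fin 2) :
    SmoothProf (ls r V i) := by
  fin_cases i
  · exact (h 1).dx.add (h 0).dy
  · exact ((h 0).dx.smul _).add ((h 1).dy.smul _)

lemma ls_add (r : ℝ) {U V : VProf} (hU : ∀ i, SmoothProf (U i)) (hV : ∀ i, SmoothProf (V i)) :
    ls r (U + V) = ls r U + ls r V := by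
  have h : ∀ i, (U + V) i = U i + V i := fun _ => rfl
  simp only [ls, ← pd_one, ← pd_two, h, fun i j => pd_add (hU i) (hV i) j]
  funext i
  fin_cases i
  · simp; abel
  · simp [smul_add]; abel

/-! ### Amplitudes at all frequencies; uniqueness of the unforced pieces -/

lemma rhat_neg {r c : ℝ} {n : ℤ} (hn : 0 < n) (Y : ℝ) :
    rhat r c (-n) Y = star (rhat r c n Y) := by
  have h : ¬ 0 < -n := by omega
  simp only [rhat, if_pos hn, if_neg h, neg_neg]

/-- Amplitudes for all frequencies from those for positive frequencies. -/
lemma exists_amplitudes {r c T : ℝ} (hr : 1 < r) (hc : IsRayleighSpeed r c) {V : VProf}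
    (hV : ∀ i, InSstar T (V i)) (heq : ∀ i, EqInt T (Lff r c V i) 0)
    (hbd : ∀ i, EqBdy T (lf r V i) 0) :
    ∃ α : ℝ → ℝ → ℤ → ℂ, (∀ t x n, α t x (-n) = star (α t x n)) ∧
      ∀ n : ℤ, n ≠ 0 → ∀ t ∈ Set.Icc 0 T, ∀ x Y, 0 ≤ Y → ∀ i,
        mode n (V i) t x 0 Y = α t x n * rhat r c n Y i := by
  have h : ∀ (t x : ℝ) (n : ℤ), ∃ a : ℂ, 0 < n → t ∈ Set.Icc 0 T →
      ∀ Y, 0 ≤ Y → ∀ i, mode n (V i) t x 0 Y = a * rhat r c n Y i := by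
    intro t x n
    by_cases hnt : 0 < n ∧ t ∈ Set.Icc 0 T
    · obtain ⟨a, ha⟩ := exists_amplitude hr hc hV heq hbd hnt.1 hnt.2 x
      exact ⟨a, fun _ _ => ha⟩
    · exact ⟨0, fun h1 h2 => absurd ⟨h1, h2⟩ hnt⟩
  choose A hA using h
  -- Negative frequencies are defined by conjugation. Frequency zero carries no amplitude; its
  -- default `0` is self-conjugate, so the symmetry holds for every `n`.
  refine ⟨fun t x n => if 0 < n then A t x n else if n < 0 then star (A t x (-n)) else 0, ?_, ?_⟩
  · intro t x n
    rcases lt_trichotomy n 0 with hn | rfl | hn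
    · simp [hn, not_lt.2 hn.le]
    · simp
    · simp [hn, not_lt.2 hn.le]
  · intro n hn t ht x Y hY i
    rcases lt_or_gt_of_ne hn with hn | hn
    · have h1 := hA t x (-n) (by omega) ht Y hY i
      have h2 := mode_neg (f := V i) (-n) t x 0 Y
      have h3 := rhat_neg (r := r) (c := c) (n := -n) (by omega) Y
      rw [neg_neg] at h2 h3
      simp only [if_neg (not_lt.2 hn.le), if_pos hn]
      rw [h2, h1, h3, star_mul', Pi.star_apply]
    · simp only [if_pos hn]
      exact hA t x n hn ht Y hY i

lemma InSstar.eqDom_zero_of_modes {T : ℝ} {f : Prof} (hf : InSstar T f)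
    (hm : EqDom T (mean f) 0)
    (h : ∀ n : ℤ, 0 < n → ∀ t ∈ Set.Icc 0 T, ∀ x Y, 0 ≤ Y → mode n f t x 0 Y = 0) :
    EqDom T f 0 := by
  intro t ht x y θ Y hy hY
  rw [hf.indep t x y θ Y 0]
  exact eq_zero_of_mode_pos_eq_zero hf.smooth hf.periodic (hm t ht x 0 0 Y le_rfl hY)
    (fun n hn => h n hn t ht x Y hY) θ

lemma mode_zero_fun (n : ℤ) : mode n 0 = 0 := by
  funext t x y Y
  exact mode_eq_zero n fun _ => rfl

lemma particularMode_zero {r c : ℝ} {F : VProf} (hF : F = 0) (n : ℤ) (t x Y : ℝ) :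
    particularMode r c F n t x Y = 0 := by
  funext i
  simp [particularMode, hF, mode_zero_fun]

lemma IsParticular.eq_zero {r c T : ℝ} {F V : VProf} (h : IsParticular r c T F V) (hF : F = 0)
    (i : Fin 2) : EqDom T (V i) 0 := by
  refine (h.memS i).eqDom_zero_of_modes (h.mean_zero i) fun n hn t ht x Y hY => ?_
  rw [h.formula n hn t ht x Y hY i, particularMode_zero hF]
  rfl

lemma lf_eq_zero_of_eqDom {r T : ℝ} {V : VProf} (hV : ∀ i, SmoothProf (V i))
    (h : ∀ i, EqDom T (V i) 0) (i : Fin 2) : EqBdy T (lf r V i) 0 := by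
  intro t ht x θ
  have hθ : ∀ i, dθ (V i) t x 0 θ 0 = 0 := by
    intro i
    have e : (fun s => V i t x 0 s 0) = fun _ => 0 := funext fun s => h i t ht x 0 s 0 le_rfl le_rfl
    change deriv (fun s => V i t x 0 s 0) θ = 0
    rw [e]
    exact deriv_const _ _
  have hY : ∀ i, dY (V i) t x 0 θ 0 = 0 := fun i =>
    hasDerivAt_eq_zero_of_eq_zero_on_Ici (fun Y hY => h i t ht x 0 θ Y le_rfl hY)
      ((hV i).hasDerivAt_Y t x 0 θ 0) le_rfl
  fin_cases i
  · simp [lf, hθ, hY]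
  · simp [lf, hθ, hY]

/-- The Lopatinski matrix is singular at the Rayleigh speed, so zero boundary data alone would leave
a Rayleigh wave; the orthogonality normalization removes it. -/
lemma IsHomogeneous.eq_zero {r c T : ℝ} (hr : 1 < r) (hc : IsRayleighSpeed r c) {g V : VProf}
    (h : IsHomogeneous r c T g V) (hg : ∀ i, EqBdy T (g i) 0) (i : Fin 2) : EqDom T (V i) 0 := by
  refine (h.memS i).eqDom_zero_of_modes (h.mean_zero i) fun n hn t ht x Y hY => ?_
  obtain ⟨σ, hσ, hB, hV⟩ := h.formula n hn t ht x
  have hg0 : (fun i => mode n (g i) t x 0 0) = 0 := by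
    funext i
    exact mode_eq_zero n fun θ => hg i t ht x θ
  have hn0 : Complex.I * (n : ℂ) ≠ 0 :=
    mul_ne_zero Complex.I_ne_zero (by exact_mod_cast hn.ne')
  rw [hg0] at hB
  have hσ0 := BLop_kernel_trivial hr hc hσ ((smul_eq_zero.1 hB).resolve_left hn0)
  rw [hV Y hY i, hσ0]
  simp

/-- A mean-type profile in `S*` that is affine in `Y` vanishes. -/
lemma InSstar.eq_zero_of_dY_dY {T : ℝ} {f : Prof} (hf : InSstar T f)
    (h : EqDom T (dY (dY f)) 0) : EqDom T f 0 := by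
  -- A decaying profile that is constant in `Y` is zero. This is applied to `∂_Y f` and then to `f`.
  have key : ∀ {g : Prof}, IsDec T g → EqDom T (dY g) 0 → EqDom T g 0 := by
    intro g hg hd t ht x y θ Y hy hY
    have hc : ∀ Y, 0 ≤ Y → g t x y θ Y = g t x y θ 0 := fun Y hY =>
      constant_of_has_deriv_right_zero (f := fun Y => g t x y θ Y) (a := 0) (b := Y)
        (fun s _ => (hg.isBdd.smooth.hasDerivAt_Y t x y θ s).continuousAt.continuousWithinAt)
        (fun s hs => by
          have h1 := hg.isBdd.smooth.hasDerivAt_Y t x y θ s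
          rw [hd t ht x y θ s hy hs.1] at h1
          exact h1.hasDerivWithinAt) Y ⟨hY, le_rfl⟩
    have h2 : Tendsto (fun Y => g t x y θ Y) atTop (𝓝 (g t x y θ 0)) :=
      tendsto_const_nhds.congr' ((eventually_ge_atTop 0).mono fun Y hY => (hc Y hY).symm)
    rw [hc Y hY]
    exact tendsto_nhds_unique h2 (hg.tendsto_zero ht x y θ)
  exact key (.star hf) (key ((IsDec.star hf).pd 4) h)

/-- Decaying profiles satisfy the fundamental theorem of calculus in `Y`, in the mean. -/
lemma IsDec.integral_mean_dY {T : ℝ} {f : Prof} (hf : IsDec T f) {t : ℝ} (ht : t ∈ Set.Icc 0 T)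
    (x y θ : ℝ) : ∫ Y in Set.Ioi (0 : ℝ), mean (dY f) t x y θ Y = -mean f t x y θ 0 := by
  have hs := hf.isBdd.smooth
  obtain ⟨C, δ, hC, hδ, hb⟩ := hf.exists_bound ht x y
  obtain ⟨C', δ', hC', hδ', hb'⟩ := (hf.pd 4).exists_bound ht x y
  have hcont : Continuous fun Y => mean (dY f) t x y θ Y :=
    continuous_iff_continuousAt.2 fun Y => (mean_dY hs.dY t x y θ Y).continuousAt
  have hint : IntegrableOn (fun Y => mean (dY f) t x y θ Y) (Set.Ioi 0) := by
    refine Integrable.mono' ((exp_neg_integrableOn_Ioi 0 hδ').const_mul C')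
      hcont.aestronglyMeasurable ?_
    refine (ae_restrict_mem measurableSet_Ioi).mono fun Y hY => ?_
    rw [neg_mul]
    exact abs_mean_le (fun θ => hb' θ Y (le_of_lt hY)) θ
  have hlim : Tendsto (fun Y => mean f t x y θ Y) atTop (𝓝 0) := by
    refine squeeze_zero_norm' ?_ (tendsto_const_mul_exp_neg (C := C) hδ)
    filter_upwards [eventually_ge_atTop 0] with Y hY
    exact abs_mean_le (fun θ => hb θ Y hY) θ
  rw [integral_Ioi_of_hasDerivAt_of_tendsto' (fun Y _ => mean_dY hs t x y θ Y) hint hlim, zero_sub]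

/-! ### Consequences of the equations for the leading profile -/

/-- The mean commutes with `∂_Y` and `∂_x`, and `mean w` vanishes on the domain up to `Y = 0`. -/
lemma mean_dx_dY_eq_zero {T : ℝ} {w : Prof} (hw : SmoothProf w) (hm : EqDom T (mean w) 0)
    {t : ℝ} (ht : t ∈ Set.Icc 0 T) (x θ : ℝ) {y Y : ℝ} (hy : 0 ≤ y) (hY : 0 ≤ Y) :
    mean (dx (dY w)) t x y θ Y = 0 := by
  have h1 : ∀ x, mean (dY w) t x y θ Y = 0 := fun x =>
    hasDerivAt_eq_zero_of_eq_zero_on_Ici (fun Y hY => hm t ht x y θ Y hy hY)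
      (mean_dY hw t x y θ Y) hY
  have h2 := mean_dx hw.dY t x y θ Y
  simp only [h1] at h2
  exact h2.unique (hasDerivAt_const x 0)

lemma mean_dx_eq_zero {T : ℝ} {w : Prof} (hw : SmoothProf w) (hm : EqDom T (mean w) 0)
    {t : ℝ} (ht : t ∈ Set.Icc 0 T) (x θ : ℝ) {y Y : ℝ} (hy : 0 ≤ y) (hY : 0 ≤ Y) :
    mean (dx w) t x y θ Y = 0 := by
  have h2 := mean_dx hw t x y θ Y
  have h1 : ∀ x, mean w t x y θ Y = 0 := fun x => hm t ht x y θ Y hy hY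
  simp only [h1] at h2
  exact h2.unique (hasDerivAt_const x 0)

/-- The quadratic interior right side, up to `θ`-derivatives and one term that is linear in `W`. -/
lemma exists_divergence_form {r c T : ℝ} {W : VProf} (hW : ∀ i, IsDec T (W i))
    (hWy : ∀ i, W i ∈ indepSubmodule) (hWf : ∀ i, IsSlowAddDec T (W i)) (i : Fin 2) :
    ∃ (A : Prof) (j : Fin 2), IsDec T A ∧ (-Lfs r c W + Afff r W W) i
      = dθ A + (r - 1) • dx (dY (W j)) + dY (Q r Scale.fast Scale.fast W W i 1) := by
  have hS : ∀ i, SmoothProf (W i) := fun i => (hW i).isBdd.smooth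
  have hdy : ∀ i, dy (dθ (W i)) = 0 := fun i => dy_eq_zero (pd_congr_indep_y (hWy i) 3)
  have hdy' : ∀ i, dy (dY (W i)) = 0 := fun i => dy_eq_zero (pd_congr_indep_y (hWy i) 4)
  have htθ : ∀ i, dt (dθ (W i)) = dθ (dt (W i)) := fun i => pd_comm (hS i) 0 3
  have hxθ : ∀ i, dx (dθ (W i)) = dθ (dx (W i)) := fun i => pd_comm (hS i) 1 3
  have hQ := isDec_Q_fast_left r Scale.fast hWf hWf
  have hlin : ∀ (a b : ℝ) (i : Fin 2),
      dθ (a • dt (W i) + b • dx (W i) + Q r Scale.fast Scale.fast W W i 0)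
      = a • dθ (dt (W i)) + b • dθ (dx (W i)) + dθ (Q r Scale.fast Scale.fast W W i 0) := by
    intro a b i
    simp only [← pd_three]
    rw [pd_add (((hS i).dt.smul a).add ((hS i).dx.smul b)) (hQ i 0).isBdd.smooth,
      pd_add ((hS i).dt.smul a) ((hS i).dx.smul b), pd_smul (hS i).dt, pd_smul (hS i).dx]
  have hA : ∀ (a b : ℝ) (i : Fin 2),
      IsDec T (a • dt (W i) + b • dx (W i) + Q r Scale.fast Scale.fast W W i 0) := fun a b i =>
    ((((hW i).pd 0).smul a).add (((hW i).pd 1).smul b)).add (hQ i 0)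
  -- The `y`-derivatives in `L_fs` drop since `W` does not depend on `y`. The `tθ` and `xθ` terms
  -- and the first column of `Q` go into `A`; the coupling `(r - 1) ∂_x ∂_Y` acts on the other
  -- component, whence the choice of `j`.
  fin_cases i
  · refine ⟨_, 1, hA (2 * c) (2 * r) 0, ?_⟩
    rw [hlin, ← htθ, ← hxθ]
    change -(-((2 * c) • dt (dθ (W 0))) - (2 * r) • dx (dθ (W 0))
      - (r - 1) • (dx (dY (W 1)) + dy (dθ (W 1))) - (2 : ℝ) • dy (dY (W 0)))
      + (dθ (Q r Scale.fast Scale.fast W W 0 0) + dY (Q r Scale.fast Scale.fast W W 0 1)) = _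
    rw [hdy, hdy', smul_zero, add_zero]
    abel
  · refine ⟨_, 0, hA (2 * c) 2 1, ?_⟩
    rw [hlin, ← htθ, ← hxθ]
    change -(-((2 * c) • dt (dθ (W 1))) - (2 : ℝ) • dx (dθ (W 1))
      - (r - 1) • (dx (dY (W 0)) + dy (dθ (W 0))) - (2 * r) • dy (dY (W 1)))
      + (dθ (Q r Scale.fast Scale.fast W W 1 0) + dY (Q r Scale.fast Scale.fast W W 1 1)) = _
    rw [hdy, hdy', smul_zero, add_zero]
    abel

/-- Independence of `y` makes the limit in `starPart` trivial, so the modified right side of index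
two is the full one. -/
lemma indep_rhs {r c : ℝ} {W : VProf} (hWy : ∀ i, W i ∈ indepSubmodule) (i : Fin 2) :
    (-Lfs r c W + Afff r W W) i ∈ indepSubmodule := by
  have hp : ∀ {f : Prof}, f ∈ indepSubmodule → ∀ k, pd k f ∈ indepSubmodule := fun hf k =>
    pd_congr_indep_y hf k
  have hg : ∀ i j, grad Scale.fast W i j ∈ indepSubmodule := by
    intro i j
    fin_cases j
    · exact hp (hWy i) 3
    · exact hp (hWy i) 4
  have hQ : ∀ i j, Q r Scale.fast Scale.fast W W i j ∈ indepSubmodule :=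
    quad_mem indepSubmodule r fun i j k l => mul_mem_indepSubmodule (hg i j) (hg k l)
  have hA : Afff r W W i ∈ indepSubmodule :=
    indepSubmodule.add_mem (hp (hQ i 0) 3) (hp (hQ i 1) 4)
  have h2 : ∀ i j k, pd j (pd k (W i)) ∈ indepSubmodule := fun i j k => hp (hp (hWy i) k) j
  refine indepSubmodule.add_mem (indepSubmodule.neg_mem ?_) hA
  have sm := fun (a : ℝ) {f : Prof} (hf : f ∈ indepSubmodule) => indepSubmodule.smul_mem a hf
  fin_cases i
  · exact indepSubmodule.sub_mem (indepSubmodule.sub_mem (indepSubmodule.sub_mem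
      (indepSubmodule.neg_mem (sm _ (h2 0 0 3))) (sm _ (h2 0 1 3)))
      (sm _ (indepSubmodule.add_mem (h2 1 1 4) (h2 1 2 3)))) (sm _ (h2 0 2 4))
  · exact indepSubmodule.sub_mem (indepSubmodule.sub_mem (indepSubmodule.sub_mem
      (indepSubmodule.neg_mem (sm _ (h2 1 0 3))) (sm _ (h2 1 1 3)))
      (sm _ (indepSubmodule.add_mem (h2 0 1 4) (h2 0 2 3)))) (sm _ (h2 1 2 4))

/-! ### The pieces of a leading profile, one at a time -/

section Leading

variable {r c T : ℝ} {G : VProf} {U : ℕ → VProf} {Ubar U0 Uh Up Uα Up3 : VProf}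

lemma IsLeadingProfile.modRHS_one (hU : IsLeadingProfile r c T G U Ubar U0 Uh Up Uα Up3) :
    modRHS r c U 1 = 0 := by
  funext i
  have h : modRHS r c U 1 i = barPart (0 : Prof) + starPart 0 := by
    change barPart (intRHS r c U 1 i) + starPart (intRHS r c U 1 i) = _
    rw [intRHS_one r c hU.zero hU.one]
    rfl
  rw [h, barPart_add_starPart fun _ _ _ _ _ _ => rfl]
  rfl

lemma IsLeadingProfile.Up_eq_zero (hU : IsLeadingProfile r c T G U Ubar U0 Uh Up Uα Up3)
    (i : Fin 2) : EqDom T (Up i) 0 :=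
  hU.particular.eq_zero hU.modRHS_one i

lemma IsLeadingProfile.Uh_eq_zero (hr : 1 < r) (hc : IsRayleighSpeed r c)
    (hU : IsLeadingProfile r c T G U Ubar U0 Uh Up Uα Up3) (i : Fin 2) : EqDom T (Uh i) 0 := by
  refine hU.homogeneous.eq_zero hr hc (fun i t ht x θ => ?_) i
  have h := lf_eq_zero_of_eqDom (r := r) (fun i => (hU.particular.memS i).smooth) hU.Up_eq_zero i
    t ht x θ
  have h2 : osc (bdyRHS r G U 1 i) = 0 := by
    rw [bdyRHS_one r G hU.zero hU.one]
    exact osc_zero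
  change osc (bdyRHS r G U 1 i) t x 0 θ 0 - lf r Up i t x 0 θ 0 = 0
  rw [h, h2]
  simp

lemma IsLeadingProfile.U0_eq_zero (hr : 1 < r)
    (hU : IsLeadingProfile r c T G U Ubar U0 Uh Up Uα Up3) (i : Fin 2) : EqDom T (U0 i) 0 := by
  have hS : ∀ i, SmoothProf (U0 i) := fun i => (hU.star0_mem i).smooth
  have hθ : ∀ {f : Prof}, (∀ t x y θ Y θ', f t x y θ Y = f t x y θ' Y) → dθ f = 0 := by
    intro f hf
    funext t x y θ Y
    have h : (fun s => f t x y s Y) = fun _ => f t x y 0 Y := funext fun s => hf t x y s Y 0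
    change deriv (fun s => f t x y s Y) θ = 0
    rw [h]
    exact deriv_const _ _
  have h1 : ∀ i, dθ (U0 i) = 0 := fun i => hθ (hU.star0_indep i)
  have h2 : ∀ i, dθ (dY (U0 i)) = 0 := fun i => by
    rw [show dθ (dY (U0 i)) = dY (dθ (U0 i)) from pd_comm (hS i) 3 4, h1]
    exact pd_zero_fun 4
  have h3 : dθ (0 : Prof) = 0 := pd_zero_fun 3
  have hmod : mean (modRHS r c U 1 i) = 0 := by
    rw [hU.modRHS_one]
    exact mean_zero
  have heq := (hU.star0_eqn i).eqDom (Lff_smooth hS i) (by rw [hmod]; exact .zero)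
  rw [hmod] at heq
  -- Without `θ`-dependence `L_ff` is `-diag(1, r) ∂_YY`, so `U0` is affine in `Y`.
  refine (hU.star0_mem i).eq_zero_of_dY_dY fun t ht x y θ Y hy hY => ?_
  have h := heq t ht x y θ Y hy hY
  fin_cases i
  · simpa [Lff, h1, h2, h3] using h
  · have hr0 : r ≠ 0 := by linarith
    simpa [Lff, h1, h2, h3, hr0] using h

/-- The part in `S*` of the leading profile. -/
def fastPart (U0 Uh Up Uα : VProf) : VProf := U0 + Uh + Up + Uα

lemma IsLeadingProfile.split' (hU : IsLeadingProfile r c T G U Ubar U0 Uh Up Uα Up3) :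
    U 2 = Ubar + fastPart U0 Uh Up Uα := by
  rw [hU.split, fastPart]
  abel

lemma IsLeadingProfile.isDec_fastPart (hU : IsLeadingProfile r c T G U Ubar U0 Uh Up Uα Up3)
    (i : Fin 2) : IsDec T (fastPart U0 Uh Up Uα i) :=
  (((IsDec.star (hU.star0_mem i)).add (.star (hU.homogeneous.memS i))).add
    (.star (hU.particular.memS i))).add (.star (hU.alpha_mem i))

lemma IsLeadingProfile.indep_fastPart (hU : IsLeadingProfile r c T G U Ubar U0 Uh Up Uα Up3)
    (i : Fin 2) : fastPart U0 Uh Up Uα i ∈ indepSubmodule :=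
  indepSubmodule.add_mem (indepSubmodule.add_mem (indepSubmodule.add_mem (hU.star0_mem i).indep
    (hU.homogeneous.memS i).indep) (hU.particular.memS i).indep) (hU.alpha_mem i).indep

lemma IsLeadingProfile.fastPart_eq (hr : 1 < r) (hc : IsRayleighSpeed r c)
    (hU : IsLeadingProfile r c T G U Ubar U0 Uh Up Uα Up3) (i : Fin 2) :
    EqDom T (fastPart U0 Uh Up Uα i) (Uα i) := by
  intro t ht x y θ Y hy hY
  change U0 i t x y θ Y + Uh i t x y θ Y + Up i t x y θ Y + Uα i t x y θ Y = Uα i t x y θ Y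
  rw [hU.U0_eq_zero hr i t ht x y θ Y hy hY, hU.Uh_eq_zero hr hc i t ht x y θ Y hy hY,
    hU.Up_eq_zero i t ht x y θ Y hy hY]
  simp

lemma IsLeadingProfile.mean_fastPart (hr : 1 < r) (hc : IsRayleighSpeed r c)
    (hU : IsLeadingProfile r c T G U Ubar U0 Uh Up Uα Up3) (i : Fin 2) :
    EqDom T (mean (fastPart U0 Uh Up Uα i)) 0 := by
  intro t ht x y θ Y hy hY
  rw [mean_congr (fun θ => hU.fastPart_eq hr hc i t ht x y θ Y hy hY) θ]
  exact hU.alpha_mean i t ht x y θ Y hy hY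

lemma IsLeadingProfile.isSlowAddDec (hU : IsLeadingProfile r c T G U Ubar U0 Uh Up Uα Up3)
    (j : ℕ) (i : Fin 2) : IsSlowAddDec T (U j i) :=
  (hU.memS j i).isSlowAddDec

/-- In `(H₃, K₃)` every nonlinear term and every term of `L_fs` contains a fast derivative, and
`L_ss` preserves decay of the part in `S*`. Hence `-L_ss Ubar` is all that survives `Y → ∞`. -/
lemma IsLeadingProfile.Lss_eq_zero (hU : IsLeadingProfile r c T G U Ubar U0 Uh Up Uα Up3)
    (i : Fin 2) : EqDom T (Lss r Ubar i) 0 := by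
  have hS : ∀ i, SmoothProf (Ubar i) := fun i => (hU.bar_mem i).smooth
  have hI : ∀ i, IsSlow (Ubar i) := fun i => (hU.bar_mem i).indep
  have hD := hU.isDec_fastPart
  refine EqInt.eqDom (fun t ht x y θ Y hy hY => ?_) (Lss_smooth hS i) .zero
  have h := hU.bar_eqn i t ht x y θ Y hy hY
  have hsplit : intRHS r c U 3 i = -Lss r Ubar i + (-Lfs r c (U 3) i
      - Lss r (fastPart U0 Uh Up Uα) i + Affs r (U 2) (U 2) i
      + (Afff r (U 2) (U 3) i + Afff r (U 3) (U 2) i) + Bffff r (U 2) (U 2) (U 2) i) := by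
    rw [intRHS_three r c hU.zero hU.one]
    have h2 : Lss r (U 2) = Lss r Ubar + Lss r (fastPart U0 Uh Up Uα) := by
      rw [hU.split', Lss_add r hS fun i => (hD i).isBdd.smooth]
    change -Lfs r c (U 3) i - Lss r (U 2) i + Affs r (U 2) (U 2) i
      + (Afff r (U 2) (U 3) i + Afff r (U 3) (U 2) i) + Bffff r (U 2) (U 2) (U 2) i = _
    rw [h2, Pi.add_apply]
    abel
  have h2 := hU.isSlowAddDec 2
  have h3 := hU.isSlowAddDec 3
  have hdec : IsDec T (-Lfs r c (U 3) i
      - Lss r (fastPart U0 Uh Up Uα) i + Affs r (U 2) (U 2) i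
      + (Afff r (U 2) (U 3) i + Afff r (U 3) (U 2) i) + Bffff r (U 2) (U 2) (U 2) i) :=
    (((((isDec_Lfs r c h3 i).neg).sub (isDec_Lss r hD i)).add (isDec_Affs r h2 h2 i)).add
      ((isDec_Afff r h2 h3 i).add (isDec_Afff r h3 h2 i))).add (isDec_Bffff r h2 h2 h2 i)
  have hslow : IsSlow (-Lss r Ubar i) := fun t x y θ Y θ' Y' =>
    congrArg Neg.neg (Lss_slow hI i t x y θ Y θ' Y')
  have h4 : modBar r c U 3 i t x y θ Y = -Lss r Ubar i t x y 0 0 := by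
    change barPart (intRHS r c U 3 i) t x y θ Y = _
    rw [hsplit, hdec.barPart_add hslow ht]
    rfl
  rw [h4] at h
  rw [Lss_slow hI i t x y θ Y 0 0]
  exact neg_eq_zero.1 h

/-- The nonlinearity is in divergence form in the interior and appears as its flux on the boundary,
so its mean cancels in the solvability condition: a quadratic interaction of oscillations exerts no
mean traction on `Ubar`. -/
lemma IsLeadingProfile.ls_eq_zero (hr : 1 < r) (hc : IsRayleighSpeed r c)
    (hG : ∀ i, SmoothProf (G i)) (hGm : ∀ i, EqDom T (mean (G i)) 0)
    (hU : IsLeadingProfile r c T G U Ubar U0 Uh Up Uα Up3)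
    (i : Fin 2) : EqBdy T (ls r Ubar i) 0 := by
  have hS : ∀ i, SmoothProf (Ubar i) := fun i => (hU.bar_mem i).smooth
  have hI : ∀ i, IsSlow (Ubar i) := fun i => (hU.bar_mem i).indep
  have hD := hU.isDec_fastPart
  have hy := hU.indep_fastPart
  have hm := hU.mean_fastPart hr hc
  have hspl := hU.split'
  set W := fastPart U0 Uh Up Uα with hW
  have hWS : ∀ i, SmoothProf (W i) := fun i => (hD i).isBdd.smooth
  have hWf : ∀ i, IsSlowAddDec T (W i) := fun i =>
    ⟨0, W i, .zero, isSlow_zero, hD i, (zero_add _).symm⟩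
  have hθ : ∀ i, dθ (U 2 i) = dθ (W i) := fun i => by
    rw [hspl, Pi.add_apply, ← pd_three, pd_add (hS i) (hWS i), pd_three, (hI i).dθ_eq_zero, zero_add]
  have hYd : ∀ i, dY (U 2 i) = dY (W i) := fun i => by
    rw [hspl, Pi.add_apply, ← pd_four, pd_add (hS i) (hWS i), pd_four, (hI i).dY_eq_zero, zero_add]
  have hgrad : grad Scale.fast (U 2) = grad Scale.fast W := by
    funext i j
    fin_cases j
    · exact hθ i
    · exact hYd i
  have hQ : Q r Scale.fast Scale.fast (U 2) (U 2) = Q r Scale.fast Scale.fast W W := by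
    simp only [Q, hgrad]
  have hint : intRHS r c U 2 = -Lfs r c W + Afff r W W := by
    rw [intRHS_two r c hU.zero hU.one]
    simp only [Lfs, hθ, hYd, Afff, hQ]
  have hmod : modRHS r c U 2 i = intRHS r c U 2 i :=
    barPart_add_starPart (by rw [hint]; exact indep_rhs hy i)
  obtain ⟨A, j, hA, hAj⟩ := exists_divergence_form (r := r) (c := c) hD hy hWf i
  have hQd := isDec_Q_fast_left r Scale.fast hWf hWf
  intro t ht x θ
  have hbar := hU.bar_bdy i t ht x
  -- The mean of `∂_θ A` vanishes by periodicity, that of the coupling term because `W` has mean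
  -- zero; only the normal flux remains.
  have hmean : ∀ Y ∈ Set.Ioi (0 : ℝ), mean (modRHS r c U 2 i) t x 0 0 Y
      = mean (dY (Q r Scale.fast Scale.fast W W i 1)) t x 0 0 Y := by
    intro Y hY
    have hs1 : SmoothProf (dθ A) := (hA.pd 3).isBdd.smooth
    have hs2 : SmoothProf ((r - 1) • dx (dY (W j))) := (hWS j).dY.dx.smul _
    have hs3 : SmoothProf (dY (Q r Scale.fast Scale.fast W W i 1)) := ((hQd i 1).pd 4).isBdd.smooth
    rw [hmod, hint, hAj, mean_add (hs1.add hs2) hs3, mean_add hs1 hs2,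
      mean_dθ hA.isBdd.smooth hA.isBdd.periodic, mean_smul]
    change 0 + (r - 1) * mean (dx (dY (W j))) t x 0 0 Y
      + mean (dY (Q r Scale.fast Scale.fast W W i 1)) t x 0 0 Y = _
    rw [mean_dx_dY_eq_zero (hWS j) (hm j) ht x 0 le_rfl (le_of_lt hY)]
    ring
  rw [setIntegral_congr_fun measurableSet_Ioi hmean, (hQd i 1).integral_mean_dY ht] at hbar
  have hb : bdyRHS r G U 2 i = -ls r Ubar i - ls r W i - Q r Scale.fast Scale.fast W W i 1 + G i := by
    rw [bdyRHS_two r G hU.zero hU.one]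
    change -ls r (U 2) i - Q r Scale.fast Scale.fast (U 2) (U 2) i 1 + G i = _
    rw [hQ, hspl, ls_add r hS hWS, Pi.add_apply]
    abel
  have hs1 : SmoothProf (-ls r Ubar i) := (ls_smooth hS i).neg
  have hs2 : SmoothProf (ls r W i) := ls_smooth hWS i
  have hs3 := (hQd i 1).isBdd.smooth
  have hlsW : mean (ls r W i) t x 0 0 0 = 0 := by
    have hdy : ∀ i, dy (W i) = 0 := fun i => dy_eq_zero (hy i)
    have hx : ∀ i, mean (dx (W i)) t x 0 0 0 = 0 := fun i =>
      mean_dx_eq_zero (hWS i) (hm i) ht x 0 le_rfl le_rfl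
    fin_cases i
    · change mean (dx (W 1) + dy (W 0)) t x 0 0 0 = 0
      rw [hdy, add_zero, hx]
    · change mean ((r - 2) • dx (W 0) + r • dy (W 1)) t x 0 0 0 = 0
      rw [hdy, smul_zero, add_zero, mean_smul]
      change (r - 2) * mean (dx (W 0)) t x 0 0 0 = 0
      rw [hx, mul_zero]
  rw [hb, mean_add ((hs1.sub hs2).sub hs3) (hG i), mean_sub (hs1.sub hs2) hs3, mean_sub hs1 hs2,
    mean_neg] at hbar
  change -mean (Q r Scale.fast Scale.fast W W i 1) t x 0 0 0
    = -mean (ls r Ubar i) t x 0 0 0 - mean (ls r W i) t x 0 0 0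
      - mean (Q r Scale.fast Scale.fast W W i 1) t x 0 0 0 + mean (G i) t x 0 0 0 at hbar
  have hG0 : mean (G i) t x 0 0 0 = 0 := hGm i t ht x 0 0 0 le_rfl le_rfl
  rw [hlsW, hG0, mean_of_const fun θ θ' => ls_slow hI i t x 0 θ 0 θ' 0] at hbar
  rw [ls_slow hI i t x 0 θ 0 0 0]
  change _ = (0 : ℝ)
  linarith

lemma IsLeadingProfile.Ubar_eq_zero (hr : 1 < r) (hT : 0 < T) (hc : IsRayleighSpeed r c)
    (hG : ∀ i, SmoothProf (G i)) (hGm : ∀ i, EqDom T (mean (G i)) 0)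
    (hU : IsLeadingProfile r c T G U Ubar U0 Uh Up Uα Up3)
    (i : Fin 2) : EqDom T (Ubar i) 0 := by
  have hS : ∀ i, SmoothProf (Ubar i) := fun i => (hU.bar_mem i).smooth
  have hI : ∀ i, IsSlow (Ubar i) := fun i => (hU.bar_mem i).indep
  have hD := hU.isDec_fastPart
  have hT0 : (0 : ℝ) ∈ Set.Icc 0 T := ⟨le_rfl, hT.le⟩
  -- A slow function plus a decaying one can vanish for all `Y ≥ 0` only if the slow one vanishes:
  -- let `Y → ∞`. This gives both initial conditions for `Ubar`.
  have vanish : ∀ {a b : Prof}, IsSlow a → IsDec T b → ∀ x y,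
      (∀ Y, 0 ≤ Y → a 0 x y 0 Y + b 0 x y 0 Y = 0) → a 0 x y 0 0 = 0 := by
    intro a b ha hb x y h
    have h1 := (hb.tendsto_zero hT0 x y 0).const_add (a 0 x y 0 0)
    have h2 : Tendsto (fun Y => a 0 x y 0 0 + b 0 x y 0 Y) atTop (𝓝 0) := by
      refine tendsto_const_nhds.congr' ((eventually_ge_atTop 0).mono fun Y hY => ?_)
      have h3 := h Y hY
      rw [ha 0 x y 0 Y 0 0] at h3
      exact h3.symm
    simpa using tendsto_nhds_unique h1 h2
  have hUS : ∀ i, SmoothProf (U 2 i) := fun i => (hU.isSlowAddDec 2 i).isBdd.smooth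
  intro t ht x y θ Y hy _
  rw [hI i t x y θ Y 0 0]
  refine traction_uniqueness hr hU.bar_mem
    (fun i t ht x y hy => hU.Lss_eq_zero i t ht x y 0 0 hy le_rfl)
    (fun i t ht x => hU.ls_eq_zero hr hc hG hGm i t ht x 0) (fun i x y hy => ?_)
    (fun i x y hy => ?_) i ht x hy
  · refine vanish (hI i) (hD i) x y fun Y hY => ?_
    have h := hU.past 2 i 0 x y 0 Y le_rfl hy hY
    rwa [hU.split'] at h
  · refine vanish ((hI i).pd 0) ((hD i).pd 0) x y fun Y hY => ?_
    have h1 : dt (U 2 i) 0 x y 0 Y = 0 := by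
      -- Vanishing is known for `t ≤ 0`; reversing time turns this into the half line `s ≥ 0`.
      have h2 : HasDerivAt (fun s => U 2 i (-s) x y 0 Y) (-dt (U 2 i) 0 x y 0 Y) 0 := by
        have h3 := (hUS i).hasDerivAt_t (-0) x y 0 Y
        rw [neg_zero] at h3
        have h4 := HasDerivAt.scomp_of_eq (0 : ℝ) h3 (hasDerivAt_neg 0) (by simp)
        simpa [Function.comp_def] using h4
      exact neg_eq_zero.1 (hasDerivAt_eq_zero_of_eq_zero_on_Ici
        (fun s hs => hU.past 2 i (-s) x y 0 Y (by linarith) hy hY) h2 le_rfl)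
    rw [hU.split', Pi.add_apply, ← pd_zero, pd_add (hS i) (hD i).isBdd.smooth] at h1
    exact h1

end Leading

end SVK

/-! ### Assembly of the proposition -/

theorem proposition8p2 (r c T₀ T : ℝ) (hr : 1 < r) (hc : SVK.IsRayleighSpeed r c)
    (hT : 0 < T) (hTT₀ : T ≤ T₀)
    (G : SVK.VProf) (hG : ∀ i, SVK.InSb T₀ (G i)) (hGpast : ∀ i, SVK.VanishesInPast (G i))
    (hGmean : ∀ i, SVK.EqDom T₀ (SVK.mean (G i)) 0)
    (U : ℕ → SVK.VProf) (Ubar U0 Uh Up Uα Up3 : SVK.VProf)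
    (hU : SVK.IsLeadingProfile r c T G U Ubar U0 Uh Up Uα Up3) :
    -- `U₂ = U_{2,α} ∈ S*`
    (∀ i, SVK.InSstar T (Uα i)) ∧
    (∀ i, SVK.EqDom T (U 2 i) (Uα i)) ∧
    -- the coefficients of `U₂` are amplitudes times Rayleigh modes, and its Fourier mean is zero
    (∃ α : ℝ → ℝ → ℤ → ℂ, (∀ t x n, α t x (-n) = star (α t x n)) ∧
      ∀ n : ℤ, n ≠ 0 → ∀ t ∈ Set.Icc 0 T, ∀ x y Y, 0 ≤ y → 0 ≤ Y → ∀ i,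
        SVK.mode n (U 2 i) t x y Y = α t x n * SVK.rhat r c n Y i) ∧
    (∀ i, SVK.EqDom T (SVK.mean (U 2 i)) 0) ∧
    -- `L_ss Ubar = 0` in `y > 0`, `l_s Ubar = 0` on `y = 0`
    (∀ i, SVK.EqInt T (SVK.Lss r Ubar i) 0) ∧
    (∀ i, SVK.EqBdy T (SVK.ls r Ubar i) 0) ∧
    -- all the other pieces vanish
    (∀ i, SVK.EqDom T (Ubar i) 0) ∧
    (∀ i, SVK.EqDom T (U0 i) 0) ∧
    (∀ i, SVK.EqDom T (Up i) 0) ∧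
    (∀ i, SVK.EqDom T (Uh i) 0) := by
  have hGS : ∀ i, SVK.SmoothProf (G i) := fun i => (hG i).smooth
  have hGm : ∀ i, SVK.EqDom T (SVK.mean (G i)) 0 := fun i t ht =>
    hGmean i t ⟨ht.1, ht.2.trans hTT₀⟩
  have hbar := hU.Ubar_eq_zero hr hT hc hGS hGm
  have hU2 : ∀ i, SVK.EqDom T (U 2 i) (Uα i) := by
    intro i t ht x y θ Y hy hY
    rw [hU.split']
    change Ubar i t x y θ Y + SVK.fastPart U0 Uh Up Uα i t x y θ Y = Uα i t x y θ Y
    rw [hbar i t ht x y θ Y hy hY, hU.fastPart_eq hr hc i t ht x y θ Y hy hY]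
    simp
  refine ⟨hU.alpha_mem, hU2, ?_, ?_, ?_, hU.ls_eq_zero hr hc hGS hGm, hbar, hU.U0_eq_zero hr,
    hU.Up_eq_zero, hU.Uh_eq_zero hr hc⟩
  · obtain ⟨α, hα, h⟩ := SVK.exists_amplitudes hr hc hU.alpha_mem hU.alpha_eqn hU.alpha_bdy
    refine ⟨α, hα, fun n hn t ht x y Y hy hY i => ?_⟩
    rw [← h n hn t ht x Y hY i]
    -- The amplitudes were found at `y = 0`; since `U 2` agrees with `Uα`, which does not depend on
    -- `y`, they serve for all `y ≥ 0`.
    refine SVK.mode_congr n fun θ => ?_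
    rw [hU2 i t ht x y θ Y hy hY, (hU.alpha_mem i).indep t x y θ Y 0]
  · intro i t ht x y θ Y hy hY
    rw [SVK.mean_congr (fun θ => hU2 i t ht x y θ Y hy hY) θ]
    exact hU.alpha_mean i t ht x y θ Y hy hY
  · exact fun i t ht x y θ Y hy hY => hU.Lss_eq_zero i t ht x y θ Y hy.le hY.le
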